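/- Let $Q_{3,2}=\{[x_0:\dots:x_4]\in\mathbb{RP}^4 : x_0^2=x_1^2+x_2^2+x_3^2-x_4^2\}$ be the quadric of signature $(3,2)$. A \emph{real rational knot of degree $d$} in $\mathbb{RP}^4$ is given by five real binary forms $p_0,\dots,p_4$ of degree $d$ without a common zero on $\mathbb{CP}^1$, such that the map $\mathbb{CP}^1\to\mathbb{CP}^4$, $[s:t]\mapsto[p_0(s,t):\dots:p_4(s,t)]$, is an injective immersion (the complex curve is non-singular); as a set, the knot is the image of $\mathbb{RP}^1$. \textbf{Theorem.} Let $K_1$ and $K_2$ be real rational knots of degrees $d_1$ and $d_2$ in $\mathbb{RP}^4$ that lie on $Q_{3,2}$ and meet (as real curves) in exactly one point $p$. Then for every neighbourhood $U$ of $p$ in $Q_{3,2}$ there is a real rational knot $K$ of degree $d_1+d_2$ lying on $Q_{3,2}$ that is isotopic to $K_1\cup K_2$ outside a neighbourhood of $p$ contained in $U$. That is, there are an open set $V$ with $p\in V\subseteq U$ and a smooth ambient isotopy $(H_t)_{t\in[0,1]}$ of $Q_{3,2}$, with $H_0=\mathrm{id}$ and $H_t(V)=V$ for all $t$, such that $H_1(K\setminus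 V)=(K_1\cup K_2)\setminus V$. -/

import Mathlib

open scoped LinearAlgebra.Projectivization Topology ContDiff unitInterval

noncomputable section

/-- Real projective 4-space. -/
abbrev RP4 : Type := ℙ ℝ (Fin 5 → ℝ)

/-- The usual (quotient) topology of `ℝP⁴`. -/
instance instTopologicalSpaceRP4 : TopologicalSpace RP4 :=
  inferInstanceAs (TopologicalSpace (Quotient (projectivizationSetoid ℝ (Fin 5 → ℝ))))

/-- The quadratic form `-x₀² + x₁² + x₂² + x₃² - x₄²` of signature `(3,2)`. -/
def form32 (x : Fin 5 → ℝ) : ℝ :=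
  -(x 0) ^ 2 + (x 1) ^ 2 + (x 2) ^ 2 + (x 3) ^ 2 - (x 4) ^ 2

/-- The quadric `Q_{3,2}` in `ℝP⁴`, as a set of points. -/
def quadric32 : Set RP4 := {x | form32 x.rep = 0}

theorem form32_smul (c : ℝ) (x : Fin 5 → ℝ) : form32 (c • x) = c ^ 2 * form32 x := by
  simp only [form32, Pi.smul_apply, smul_eq_mul]
  ring

theorem mk_mem_quadric32 {x : Fin 5 → ℝ} (hx : x ≠ 0) :
    Projectivization.mk ℝ x hx ∈ quadric32 ↔ form32 x = 0 := by
  obtain ⟨a, ha⟩ := Projectivization.exists_smul_eq_mk_rep ℝ x hx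
  have h : form32 (Projectivization.mk ℝ x hx).rep = (a : ℝ) ^ 2 * form32 x := by
    rw [← ha, Units.smul_def, form32_smul]
  simp [quadric32, h]

/-- The quadric `Q_{3,2}` as a topological space. -/
abbrev Q32 : Type := quadric32

/-- The point of `Q_{3,2}` with given homogeneous coordinates. -/
def Q32.mk (x : Fin 5 → ℝ) (hx : x ≠ 0) (hq : form32 x = 0) : Q32 :=
  ⟨Projectivization.mk ℝ x hx, (mk_mem_quadric32 hx).2 hq⟩

/-- A (parametrised) real rational knot of degree `d` in `ℝP⁴`: five real binary forms
`p₀, …, p₄` of degree `d`, without common zero on the complex projective line, such that the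
map `[s : t] ↦ [p₀ : … : p₄]` from `ℂP¹` to `ℂP⁴` is injective and immersive, that is, the
complex curve is non-singular. By Euler's relation (and `d ≠ 0`, which injectivity forces), the
map is immersive at `[z]` if and only if the `5 × 2` Jacobian matrix of `(p₀, …, p₄)` at `z` has
rank two. -/
structure RealRationalKnot (d : ℕ) where
  /-- the coordinate forms `p₀, …, p₄` -/
  coord : Fin 5 → MvPolynomial (Fin 2) ℝ
  homogeneous : ∀ i, (coord i).IsHomogeneous d
  no_common_zero : ∀ z : Fin 2 → ℂ, z ≠ 0 → ∃ i, MvPolynomial.aeval z (coord i) ≠ 0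
  injective : ∀ z w : Fin 2 → ℂ, z ≠ 0 → w ≠ 0 →
    (∃ c : ℂ, ∀ i, MvPolynomial.aeval z (coord i) = c * MvPolynomial.aeval w (coord i)) →
    ∃ c : ℂ, z = c • w
  immersive : ∀ z : Fin 2 → ℂ, z ≠ 0 →
    LinearIndependent ℂ (fun (j : Fin 2) (i : Fin 5) =>
      MvPolynomial.aeval z (MvPolynomial.pderiv j (coord i)))

namespace RealRationalKnot

variable {d : ℕ}

/-- The vector `(p₀(z), …, p₄(z))` for real `z = (s, t)`. -/
def evalReal (K : RealRationalKnot d) (z : Fin 2 → ℝ) : Fin 5 → ℝ :=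
  fun i => MvPolynomial.eval z (K.coord i)

/-- The knot as a subset of `ℝP⁴`: the image of `ℝP¹`. -/
def points (K : RealRationalKnot d) : Set RP4 :=
  {x | ∃ z : Fin 2 → ℝ, z ≠ 0 ∧ ∃ h : K.evalReal z ≠ 0, x = Projectivization.mk ℝ (K.evalReal z) h}

/-- The knot as a subset of the quadric (meaningful for knots that lie on the quadric). -/
def pointsInQ32 (K : RealRationalKnot d) : Set Q32 := Subtype.val ⁻¹' K.points

end RealRationalKnot

/-- `F : [0,1] × Q_{3,2} → Q_{3,2}` is smooth. As the punctured cone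
`{x ∈ ℝ⁵ ∖ 0 | form32 x = 0}` is a smooth principal bundle over `Q_{3,2}`, this means that in
homogeneous coordinates `F` is locally given by `(t, x) ↦ [L (t, x)]` with `L` of class `C^∞`
(on an open set of `ℝ × ℝ⁵`) and non-vanishing on the cone. -/
def IsSmoothFamily (F : I → Q32 → Q32) : Prop :=
  ∀ (t₀ : I) (x₀ : Fin 5 → ℝ), x₀ ≠ 0 → form32 x₀ = 0 →
    ∃ W : Set (ℝ × (Fin 5 → ℝ)), IsOpen W ∧ ((t₀ : ℝ), x₀) ∈ W ∧
      ∃ L : ℝ × (Fin 5 → ℝ) → (Fin 5 → ℝ), ContDiffOn ℝ ∞ L W ∧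
        ∀ (t : I) (x : Fin 5 → ℝ) (hx : x ≠ 0) (hq : form32 x = 0), ((t : ℝ), x) ∈ W →
          ∃ hL : L ((t : ℝ), x) ≠ 0,
            (F t (Q32.mk x hx hq) : RP4) = Projectivization.mk ℝ (L ((t : ℝ), x)) hL

/-- A smooth ambient isotopy of `Q_{3,2}`: a smooth family `H_t`, `t ∈ [0,1]`, of
diffeomorphisms of `Q_{3,2}` that starts at the identity. -/
structure AmbientIsotopy where
  /-- the diffeomorphism at time `t` -/
  toEquiv : I → Q32 ≃ Q32
  zero : toEquiv 0 = Equiv.refl Q32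
  smooth : IsSmoothFamily (fun t => toEquiv t)
  smooth_symm : IsSmoothFamily (fun t => (toEquiv t).symm)

/-- `A` and `B` are isotopic outside the set `V`: some smooth ambient isotopy of `Q_{3,2}` that
maps `V` (hence also its complement) onto itself at all times carries the part of `A` outside `V`
onto the part of `B` outside `V`. -/
def IsotopicOutside (V A B : Set Q32) : Prop :=
  ∃ H : AmbientIsotopy, (∀ t, H.toEquiv t '' V = V) ∧ H.toEquiv 1 '' (A \ V) = B \ V

end

/-! Coordinates (x, a, b, c, y) are chosen in which p = [1:0:0:0:0] and the quadric is xy = ac - b²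
(`exists_normal_coordinates`). Where x ≠ 0 the quadric is the graph of N = ac - b² over an affine
3-space with origin p. Vector addition in that space extends to a bilinear product `coneMul` of cone
vectors whose unit is the standard representative of p. If P and Q parametrise the two knots with
value p at [0:1], then P(s,t)·Q(εt,s) is a curve of degree d₁ + d₂ on the quadric. For small ε it is
close to P where t/s is bounded and to Q where s/(εt) is bounded; in the gap between these ranges
both factors are close to the unit, so the curve stays near p.

The glued curve need not be embedded over ℂ. In the affine chart, when its poles are simple, it has
the form w(z) = c + Σ κᵢ(mᵢ², mᵢ, 1)/(z - rᵢ): the residues are isotropic for N because y/x = N(w)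
has no double poles. Conversely every choice of such data gives a curve on the quadric
(`exists_coneData`, `formX_mul_formY`), so poles and residues may be perturbed freely. Embeddedness
reduces to the divided difference Σ κᵢ(mᵢ², mᵢ, 1)/((z - rᵢ)(w - rᵢ)) having no zero. These are
three equations in two unknowns, and they have no solution when the rᵢ are algebraically independent
over the field of the κᵢ, mᵢ, the mᵢ are distinct, and the κᵢ and their sum are nonzero
(`exists_sum_ne_of_normalized`).

For the isotopy, ℝ⁵ is split as ℂ × F so that the form is the difference of the squared norms of the
F- and ℂ-components. Pushing x along a small homogeneous displacement and then restoring both norms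
preserves the cone and induces an ambient isotopy of the quadric (`eventually_displace_isotopy`).
The neighbourhood V is a sector |Im| < r|Re| in the ℂ-component, cut off at a small distance from p.
Points of the old and new curves are matched by the argument of their ℂ-components. The displacement
can therefore fix the ℂ-component near the slanted faces of V and vanish near the cut-off face, so
that V is invariant at all times (`eventually_isotopicOutside`). -/

noncomputable section

/-! ### Ambient isotopies from families of homogeneous maps of ℝ⁵ -/

/-- A smooth injective local diffeomorphism has an open image and a smooth inverse. -/
theorem exists_contDiffOn_inverse {E F : Type*} [NormedAddCommGroup E] [NormedSpace ℝ E]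
    [CompleteSpace E] [NormedAddCommGroup F] [NormedSpace ℝ F] {f : E → F} {O : Set E}
    (hO : IsOpen O) (hf : ContDiffOn ℝ ∞ f O) (hinj : Set.InjOn f O)
    (hd : ∀ x ∈ O, ∃ f' : E ≃L[ℝ] F, HasFDerivAt f (f' : E →L[ℝ] F) x) :
    ∃ g : F → E, IsOpen (f '' O) ∧ ContDiffOn ℝ ∞ g (f '' O) ∧ ∀ x ∈ O, g (f x) = x := by
  classical
  rcases isEmpty_or_nonempty E with hE | hE
  · exact ⟨fun _ => 0, by simp [Set.eq_empty_of_isEmpty O], by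
      simp [Set.eq_empty_of_isEmpty O], fun x => (hE.false x).elim⟩
  set g : F → E := Function.invFunOn f O with hg
  have hgf : ∀ x ∈ O, g (f x) = x := fun x hx =>
    hinj (Function.invFunOn_mem ⟨x, hx, rfl⟩) hx (Function.invFunOn_eq ⟨x, hx, rfl⟩)
  -- The inverse function theorem supplies smooth local inverses; injectivity on `O` forces each of
  -- them to agree with the globally chosen `g`.
  have key : ∀ x ∈ O, f '' O ∈ 𝓝 (f x) ∧ ContDiffAt ℝ ∞ g (f x) := by
    intro x hx
    obtain ⟨f', hf'⟩ := hd x hx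
    have hc : ContDiffAt ℝ ∞ f x := hf.contDiffAt (hO.mem_nhds hx)
    set Φ := hc.toOpenPartialHomeomorph f hf' (by simp) with hΦ
    have hxs : x ∈ Φ.source := hc.mem_toOpenPartialHomeomorph_source hf' _
    have hxt : f x ∈ Φ.target := hc.image_mem_toOpenPartialHomeomorph_target hf' _
    have hsx : Φ.symm (f x) = x := Φ.left_inv hxs
    have hT : Φ.target ∩ Φ.symm ⁻¹' O ∈ 𝓝 (f x) :=
      (Φ.isOpen_inter_preimage_symm hO).mem_nhds ⟨hxt, by simpa [hsx] using hx⟩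
    have hT2 : ∀ y ∈ Φ.target ∩ Φ.symm ⁻¹' O, f (Φ.symm y) = y := fun y hy => Φ.right_inv hy.1
    refine ⟨Filter.mem_of_superset hT fun y hy => ⟨_, hy.2, hT2 y hy⟩, ?_⟩
    have h1 : ContDiffAt ℝ ∞ Φ.symm (f x) :=
      Φ.contDiffAt_symm hxt (f₀' := f') (by rw [hsx]; exact hf') (by rw [hsx]; exact hc)
    refine h1.congr_of_eventuallyEq ?_
    filter_upwards [hT] with y hy
    conv_lhs => rw [← hT2 y hy]
    exact hgf _ hy.2
  refine ⟨g, isOpen_iff_mem_nhds.2 ?_, ?_, hgf⟩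
  · rintro _ ⟨x, hx, rfl⟩
    exact (key x hx).1
  · rintro _ ⟨x, hx, rfl⟩
    exact (key x hx).2.contDiffWithinAt

theorem Q32.exists_rep (x : Q32) : ∃ (v : Fin 5 → ℝ) (hv : v ≠ 0) (hq : form32 v = 0),
    x = Q32.mk v hv hq :=
  ⟨x.1.rep, x.1.rep_nonzero, x.2, Subtype.ext (Projectivization.mk_rep _).symm⟩

theorem Q32.mk_eq_mk_iff {v w : Fin 5 → ℝ} {hv : v ≠ 0} {hw : w ≠ 0} {hqv : form32 v = 0}
    {hqw : form32 w = 0} :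
    Q32.mk v hv hqv = Q32.mk w hw hqw ↔ ∃ c : ℝ, c ≠ 0 ∧ c • w = v := by
  rw [Q32.mk, Q32.mk, Subtype.mk_eq_mk, Projectivization.mk_eq_mk_iff']
  constructor
  · rintro ⟨c, hc⟩
    refine ⟨c, ?_, hc⟩
    rintro rfl
    exact hv (by simpa using hc.symm)
  · rintro ⟨c, -, hc⟩
    exact ⟨c, hc⟩

theorem isUnit_of_norm_sub_one_le {E : Type*} [NormedAddCommGroup E] [NormedSpace ℝ E]
    [CompleteSpace E] (A : E →L[ℝ] E) (h : ‖A - 1‖ ≤ 1 / 2) : ∃ B : E ≃L[ℝ] E, (B : E →L[ℝ] E) = A := by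
  have h1 : IsUnit (1 - (1 - A)) := isUnit_one_sub_of_norm_lt_one (by
    rw [norm_sub_rev]; linarith)
  obtain ⟨u, hu⟩ := h1
  refine ⟨ContinuousLinearEquiv.ofUnit u, ?_⟩
  ext x
  have : (u : E →L[ℝ] E) = A := by rw [hu]; abel
  rw [← this]; rfl

/-- The derivative of `(t, x) ↦ (t, G (t, x))` is invertible where the partial derivative is. -/
theorem exists_equiv_hasFDerivAt_graph {E : Type*} [NormedAddCommGroup E] [NormedSpace ℝ E]
    {T : Type*} [NormedAddCommGroup T] [NormedSpace ℝ T]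
    {F : Type*} [NormedAddCommGroup F] [NormedSpace ℝ F]
    {G : T × E → F} {G' : T × E →L[ℝ] F} {z : T × E} (hG : HasFDerivAt G G' z)
    (B : E ≃L[ℝ] F) (hB : (B : E →L[ℝ] F) = G'.comp (ContinuousLinearMap.inr ℝ T E)) :
    ∃ f' : (T × E) ≃L[ℝ] (T × F), HasFDerivAt (fun z : T × E => (z.1, G z)) (f' : T × E →L[ℝ] T × F) z := by
  have hB' : ∀ x, B x = G' (0, x) := fun x => by
    have := congrArg (fun L => L x) hB
    simpa using this
  have hsplit : ∀ z : T × E, G' z = G' (z.1, 0) + B z.2 := fun z => by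
    rw [hB', ← map_add]; simp
  -- The derivative (t, x) ↦ (t, G'(t,0) + B x) is block triangular and is inverted by back
  -- substitution.
  refine ⟨ContinuousLinearEquiv.equivOfInverse
    ((ContinuousLinearMap.fst ℝ T E).prod G')
    ((ContinuousLinearMap.fst ℝ T F).prod ((B.symm : F →L[ℝ] E).comp
      (ContinuousLinearMap.snd ℝ T F - (G'.comp (ContinuousLinearMap.inl ℝ T E)).comp
        (ContinuousLinearMap.fst ℝ T F)))) ?_ ?_, ?_⟩
  · intro x
    ext
    · simp
    · simp [hsplit x]
  · intro x
    ext
    · simp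
    · change G' (x.1, B.symm (x.2 - G' (x.1, 0))) = x.2
      rw [hsplit]
      simp
  · exact hasFDerivAt_fst.prodMk hG

/-- A homogeneous family of maps of `ℝ⁵` that is uniformly close to the identity and preserves
the cone `form32 = 0` induces an ambient isotopy of the quadric. -/
theorem exists_ambientIsotopy_of_lipschitz (J : Set ℝ) (hJ : IsOpen J) (hIJ : Set.Icc 0 1 ⊆ J)
    (G : ℝ × (Fin 5 → ℝ) → (Fin 5 → ℝ)) (hG : ContDiffOn ℝ ∞ G (J ×ˢ {0}ᶜ))
    (hom : ∀ t ∈ J, ∀ (c : ℝ) (x : Fin 5 → ℝ), G (t, c • x) = c • G (t, x))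
    (h0 : ∀ x, G (0, x) = x)
    (hcone : ∀ t ∈ J, ∀ x, form32 (G (t, x)) = 0 ↔ form32 x = 0)
    (hlip : ∀ t ∈ J, ∀ x y, ‖(G (t, x) - x) - (G (t, y) - y)‖ ≤ 1 / 2 * ‖x - y‖) :
    ∃ H : AmbientIsotopy, ∀ (t : I) (x : Fin 5 → ℝ) (hx : x ≠ 0) (hq : form32 x = 0),
      ∃ (hy : G (t, x) ≠ 0) (hqy : form32 (G (t, x)) = 0),
        H.toEquiv t (Q32.mk x hx hq) = Q32.mk (G (t, x)) hy hqy := by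
  have hz : ∀ t ∈ J, G (t, 0) = 0 := fun t ht => by simpa using hom t ht 0 0
  have hinj : ∀ t ∈ J, Function.Injective fun x => G (t, x) := by
    intro t ht x y hxy
    have h := hlip t ht x y
    simp only at hxy
    rw [hxy, show G (t, y) - x - (G (t, y) - y) = -(x - y) by abel, norm_neg] at h
    have : ‖x - y‖ = 0 := by linarith [norm_nonneg (x - y)]
    exact sub_eq_zero.1 (norm_eq_zero.1 this)
  have hne : ∀ t ∈ J, ∀ x, x ≠ 0 → G (t, x) ≠ 0 := fun t ht x hx h =>
    hx (hinj t ht (by simpa [hz t ht] using h))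
  have hsurj : ∀ t ∈ J, Function.Surjective fun x => G (t, x) := by
    intro t ht
    -- A perturbation of the identity with Lipschitz constant 1/2 < 1 is onto, by the quantitative
    -- inverse function theorem on the whole space.
    have happ : ApproximatesLinearOn (fun x => G (t, x))
        ((ContinuousLinearEquiv.refl ℝ (Fin 5 → ℝ) : (Fin 5 → ℝ) ≃L[ℝ] (Fin 5 → ℝ)) :
          (Fin 5 → ℝ) →L[ℝ] (Fin 5 → ℝ)) Set.univ (1 / 2) := by
      intro x _ y _
      have h := hlip t ht x y
      simp only [ContinuousLinearEquiv.coe_refl, ContinuousLinearMap.coe_id', id_eq]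
      rw [sub_sub_sub_comm] at h
      simpa using h
    refine happ.surjective (Or.inr ?_)
    have : ‖((ContinuousLinearEquiv.refl ℝ (Fin 5 → ℝ)).symm : (Fin 5 → ℝ) →L[ℝ] (Fin 5 → ℝ))‖₊ = 1 := by
      simp
    rw [this]
    rw [inv_one]
    exact NNReal.half_lt_self one_ne_zero
  have hIJ' : ∀ t : I, (t : ℝ) ∈ J := fun t => hIJ t.2
  -- The map is defined on chosen representatives; homogeneity of `G` makes it independent of the
  -- choice, which is `hφ`.
  let φ : I → Q32 → Q32 := fun t x => Q32.mk (G (t, x.1.rep)) (hne t (hIJ' t) _ x.1.rep_nonzero)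
    ((hcone t (hIJ' t) _).2 x.2)
  have hφ : ∀ (t : I) (x : Fin 5 → ℝ) (hx : x ≠ 0) (hq : form32 x = 0),
      φ t (Q32.mk x hx hq) = Q32.mk (G (t, x)) (hne t (hIJ' t) x hx) ((hcone t (hIJ' t) x).2 hq) := by
    intro t x hx hq
    obtain ⟨a, ha⟩ := Projectivization.exists_smul_eq_mk_rep ℝ x hx
    refine Q32.mk_eq_mk_iff.2 ⟨a, a.ne_zero, ?_⟩
    have h1 : (Q32.mk x hx hq).1.rep = (a : ℝ) • x := by rw [Q32.mk, ← ha]; rfl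
    rw [h1, hom t (hIJ' t)]
  have hbij : ∀ t, Function.Bijective (φ t) := by
    intro t
    constructor
    · intro x y hxy
      obtain ⟨v, hv, hqv, rfl⟩ := x.exists_rep
      obtain ⟨w, hw, hqw, rfl⟩ := y.exists_rep
      rw [hφ, hφ, Q32.mk_eq_mk_iff] at hxy
      obtain ⟨c, hc, h⟩ := hxy
      rw [← hom t (hIJ' t)] at h
      exact Q32.mk_eq_mk_iff.2 ⟨c, hc, hinj t (hIJ' t) h⟩
    · intro y
      obtain ⟨w, hw, hqw, rfl⟩ := y.exists_rep
      obtain ⟨v, hv⟩ := hsurj t (hIJ' t) w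
      simp only at hv
      have hv0 : v ≠ 0 := by
        rintro rfl
        exact hw (by rw [← hv, hz t (hIJ' t)])
      refine ⟨Q32.mk v hv0 ((hcone t (hIJ' t) v).1 (hv ▸ hqw)), ?_⟩
      rw [hφ]
      exact Q32.mk_eq_mk_iff.2 ⟨1, one_ne_zero, by rw [hv, one_smul]⟩
  have hO : IsOpen (J ×ˢ ({0}ᶜ : Set (Fin 5 → ℝ))) := hJ.prod isOpen_compl_singleton
  set O := J ×ˢ ({0}ᶜ : Set (Fin 5 → ℝ)) with hOdef
  -- Inverting the graph map, instead of each `G (t, ·)` separately, gives smoothness of the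
  -- inverses jointly in t and x. The open set `J` around [0,1] provides the open domain needed for
  -- this.
  let Ψ : ℝ × (Fin 5 → ℝ) → ℝ × (Fin 5 → ℝ) := fun z => (z.1, G z)
  obtain ⟨g, hgo, hgs, hgl⟩ := exists_contDiffOn_inverse (f := Ψ) hO
    (contDiffOn_fst.prodMk hG) (by
      rintro ⟨t, x⟩ ⟨ht, -⟩ ⟨t', x'⟩ - h
      simp only [Ψ, Prod.mk.injEq] at h
      obtain ⟨rfl, h⟩ := h
      rw [hinj t ht h]) (by
      rintro ⟨t, x⟩ ⟨ht, hx⟩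
      have hd : HasFDerivAt G (fderiv ℝ G (t, x)) (t, x) :=
        ((hG.contDiffAt (hO.mem_nhds ⟨ht, hx⟩)).differentiableAt (by simp)).hasFDerivAt
      have hd2 : HasFDerivAt (fun y => G (t, y))
          ((fderiv ℝ G (t, x)).comp (ContinuousLinearMap.inr ℝ ℝ (Fin 5 → ℝ))) x :=
        hd.comp x (hasFDerivAt_prodMk_right t x)
      have hd3 := hd2.sub (hasFDerivAt_id x)
      obtain ⟨B, hB⟩ := isUnit_of_norm_sub_one_le _ (show ‖(fderiv ℝ G (t, x)).comp
          (ContinuousLinearMap.inr ℝ ℝ (Fin 5 → ℝ)) - 1‖ ≤ 1 / 2 from by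
        refine hd3.le_of_lip' (by norm_num) (Filter.Eventually.of_forall fun y => ?_)
        simpa using hlip t ht y x)
      exact exists_equiv_hasFDerivAt_graph hd B hB)
  refine ⟨⟨fun t => Equiv.ofBijective (φ t) (hbij t), ?_, ?_, ?_⟩, fun t x hx hq =>
    ⟨_, _, hφ t x hx hq⟩⟩
  · ext x
    obtain ⟨v, hv, hqv, rfl⟩ := x.exists_rep
    have := hφ 0 v hv hqv
    simp only [Equiv.ofBijective_apply, Equiv.refl_apply]
    rw [this]
    congr 1
    exact Q32.mk_eq_mk_iff.2 ⟨1, one_ne_zero, by rw [one_smul]; exact (h0 v).symm⟩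
  · intro t₀ x₀ hx₀ hq₀
    refine ⟨O, hO, ⟨hIJ' t₀, hx₀⟩, G, hG, fun t x hx hq _ => ⟨hne t (hIJ' t) x hx, ?_⟩⟩
    exact congrArg Subtype.val (hφ t x hx hq)
  · have him : ∀ t ∈ J, ∀ y, y ≠ 0 → ∃ x, x ≠ 0 ∧ G (t, x) = y := by
      intro t ht y hy
      obtain ⟨x, hx⟩ := hsurj t ht y
      refine ⟨x, ?_, hx⟩
      rintro rfl
      exact hy (by rw [← hx]; exact hz t ht)
    intro t₀ x₀ hx₀ hq₀
    obtain ⟨v₀, hv₀, hGv₀⟩ := him t₀ (hIJ' t₀) x₀ hx₀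
    refine ⟨Ψ '' O, hgo, ⟨(t₀, v₀), ⟨hIJ' t₀, hv₀⟩, by simp [Ψ, hGv₀]⟩, fun z => (g z).2,
      contDiff_snd.comp_contDiffOn hgs, fun t y hy hq _ => ?_⟩
    obtain ⟨x, hx, rfl⟩ := him t (hIJ' t) y hy
    have hgx : g ((t : ℝ), G (t, x)) = ((t : ℝ), x) := hgl (t, x) ⟨hIJ' t, hx⟩
    have hqx := (hcone t (hIJ' t) x).1 hq
    simp only [hgx]
    refine ⟨hx, ?_⟩
    change ((Equiv.ofBijective (φ t) (hbij t)).symm _ : RP4) = (Q32.mk x hx hqx : RP4)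
    rw [Subtype.coe_inj, Equiv.symm_apply_eq, Equiv.ofBijective_apply, hφ]

end

/-! ### Small homogeneous deformations induce isotopies -/

noncomputable section

/-- A homogeneous map whose derivative is `1/2`-close to the identity away from the origin
differs from the identity by a `1/2`-Lipschitz map. -/
theorem lipschitz_sub_id_of_homogeneous {E : Type*} [NormedAddCommGroup E] [NormedSpace ℝ E]
    {G : E → E} {G' : E → E →L[ℝ] E} (hom : ∀ (c : ℝ) x, G (c • x) = c • G x)
    (hd : ∀ x ≠ 0, HasFDerivAt G (G' x) x) (hb : ∀ x ≠ 0, ‖G' x - 1‖ ≤ 1 / 2) (x y : E) :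
    ‖(G x - x) - (G y - y)‖ ≤ 1 / 2 * ‖x - y‖ := by
  have hE : ∀ (c : ℝ) x, G (c • x) - c • x = c • (G x - x) := fun c x => by
    rw [hom, smul_sub]
  -- The mean value inequality applies as long as the segment avoids the origin, where `G` need not
  -- be differentiable.
  have hseg : ∀ x y : E, (0 : E) ∉ segment ℝ y x →
      ‖(G x - x) - (G y - y)‖ ≤ 1 / 2 * ‖x - y‖ := by
    intro x y h
    refine (convex_segment y x).norm_image_sub_le_of_norm_hasFDerivWithin_le
      (f := fun z => G z - z) (f' := fun z => G' z - 1) (fun z hz => ?_) (fun z hz => ?_)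
      (left_mem_segment ℝ y x) (right_mem_segment ℝ y x)
    · have hz0 : z ≠ 0 := by rintro rfl; exact h hz
      exact ((hd z hz0).sub (hasFDerivAt_id z)).hasFDerivWithinAt
    · have hz0 : z ≠ 0 := by rintro rfl; exact h hz
      exact hb z hz0
  -- Compare x with x/2: by homogeneity G - id changes by exactly half of its value at x.
  have hpt : ∀ x : E, ‖G x - x‖ ≤ 1 / 2 * ‖x‖ := by
    intro x
    rcases eq_or_ne x 0 with rfl | hx
    · have : G 0 = 0 := by simpa using hom 0 0
      simp [this]
    have h := hseg x ((1 / 2 : ℝ) • x) (by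
      rintro ⟨a, b, ha, hb, hab, h⟩
      rw [smul_smul, ← add_smul, smul_eq_zero] at h
      rcases h with h | h
      · linarith
      · exact hx h)
    rw [hE, ← one_smul ℝ (G x - x), smul_smul, ← sub_smul] at h
    rw [show x - (1 / 2 : ℝ) • x = (1 / 2 : ℝ) • x by
      conv_lhs => enter [1]; rw [← one_smul ℝ x]
      rw [← sub_smul]; norm_num] at h
    rw [norm_smul, norm_smul] at h
    norm_num at h
    linarith
  -- If the segment meets the origin, x is a nonpositive multiple of y (or y = 0), and homogeneity
  -- for negative scalars reduces the claim to `hpt`.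
  by_cases h0 : (0 : E) ∈ segment ℝ y x
  · obtain ⟨a, b, ha, hb, hab, h⟩ := h0
    rcases eq_or_lt_of_le hb with rfl | hb'
    · have : a = 1 := by linarith
      subst this
      have hy : y = 0 := by simpa using h
      subst hy
      have : G 0 = 0 := by simpa using hom 0 0
      simpa [this] using hpt x
    · have hx : x = (-(a / b)) • y := by
        have : b • x = -(a • y) := by rw [eq_neg_iff_add_eq_zero, add_comm, h]
        have h2 : x = b⁻¹ • (b • x) := by rw [smul_smul, inv_mul_cancel₀ hb'.ne', one_smul]
        rw [h2, this, smul_neg, smul_smul, neg_smul, div_eq_inv_mul]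
      have hab0 : 0 ≤ a / b := by positivity
      rw [hx, hE]
      have e1 : ∀ v : E, (-(a / b)) • v - v = (-(1 + a / b)) • v := fun v => by
        rw [neg_smul, neg_smul, add_smul, one_smul]; abel
      rw [e1, e1, norm_smul, norm_smul, norm_neg, Real.norm_of_nonneg (by positivity)]
      have := hpt y
      nlinarith [norm_nonneg (G y - y)]
  · exact hseg x y h0

/-- A smooth family of homogeneous cone-preserving maps of `ℝ⁵` that contains the identity
induces ambient isotopies for all nearby parameters. -/
theorem eventually_exists_ambientIsotopy {Y : Type*} [NormedAddCommGroup Y] [NormedSpace ℝ Y]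
    (q₀ : Y) (G : Y × ℝ × (Fin 5 → ℝ) → (Fin 5 → ℝ)) (O : Set (Y × ℝ × (Fin 5 → ℝ)))
    (hO : IsOpen O) (hq₀O : ∀ t ∈ Set.Icc (0 : ℝ) 1, ∀ x, x ≠ 0 → (q₀, t, x) ∈ O)
    (hG : ContDiffOn ℝ ∞ G O)
    (hom : ∀ q t (c : ℝ) x, G (q, t, c • x) = c • G (q, t, x))
    (h0 : ∀ q x, G (q, 0, x) = x) (hid : ∀ t x, G (q₀, t, x) = x)
    (hcone : ∀ q t x, (q, t, x) ∈ O → (form32 (G (q, t, x)) = 0 ↔ form32 x = 0)) :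
    ∀ᶠ q in 𝓝 q₀, ∃ H : AmbientIsotopy, ∀ (t : I) (x : Fin 5 → ℝ) (hx : x ≠ 0)
      (hq : form32 x = 0), ∃ (hy : G (q, t, x) ≠ 0) (hqy : form32 (G (q, t, x)) = 0),
        H.toEquiv t (Q32.mk x hx hq) = Q32.mk (G (q, t, x)) hy hqy := by
  let ι : (Fin 5 → ℝ) →L[ℝ] Y × ℝ × (Fin 5 → ℝ) :=
    (ContinuousLinearMap.inr ℝ Y (ℝ × (Fin 5 → ℝ))).comp
      (ContinuousLinearMap.inr ℝ ℝ (Fin 5 → ℝ))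
  let DG : Y × ℝ × (Fin 5 → ℝ) → (Fin 5 → ℝ) →L[ℝ] (Fin 5 → ℝ) := fun z => (fderiv ℝ G z).comp ι
  have hDGc : ContinuousOn DG O :=
    (hG.continuousOn_fderiv_of_isOpen hO (by simp)).clm_comp continuousOn_const
  have hDG : ∀ q t x, (q, t, x) ∈ O → HasFDerivAt (fun y => G (q, t, y)) (DG (q, t, x)) x := by
    intro q t x hz
    have h1 : HasFDerivAt G (fderiv ℝ G (q, t, x)) (q, t, x) :=
      ((hG.contDiffAt (hO.mem_nhds hz)).differentiableAt (by simp)).hasFDerivAt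
    exact h1.comp x ((hasFDerivAt_prodMk_right q (t, x)).comp x (hasFDerivAt_prodMk_right t x))
  -- The partial derivative in x is the identity at q₀, so `O₂` contains the compact set {q₀} ×
  -- [0,1] × sphere. The tube lemma makes the bound uniform for q near q₀.
  let O₂ : Set (Y × ℝ × (Fin 5 → ℝ)) := O ∩ (fun z => ‖DG z - 1‖) ⁻¹' Set.Iio (1 / 2)
  have hO₂ : IsOpen O₂ :=
    ((hDGc.sub continuousOn_const).norm).isOpen_inter_preimage hO isOpen_Iio
  obtain ⟨u, v, hu, hv, hqu, hKv, huv⟩ := generalized_tube_lemma (s := {q₀}) isCompact_singleton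
    ((isCompact_Icc (a := (0 : ℝ)) (b := 1)).prod (isCompact_sphere (0 : Fin 5 → ℝ) 1)) hO₂ (by
      rintro ⟨q, t, x⟩ ⟨hq, ht, hx⟩
      obtain rfl : q = q₀ := hq
      have hx0 : x ≠ 0 := by rintro rfl; simp at hx
      refine ⟨hq₀O t ht x hx0, ?_⟩
      have h1 := hDG q t x (hq₀O t ht x hx0)
      have h2 : HasFDerivAt (fun y => G (q, t, y)) (1 : (Fin 5 → ℝ) →L[ℝ] (Fin 5 → ℝ)) x := by
        simp only [hid]
        exact hasFDerivAt_id x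
      simp [h1.unique h2])
  -- A second use of the tube lemma enlarges [0,1] to an open set of times.
  obtain ⟨J, S, hJ, -, hIJ, hS, hJS⟩ := generalized_tube_lemma
    (isCompact_Icc (a := (0 : ℝ)) (b := 1)) (isCompact_sphere (0 : Fin 5 → ℝ) 1) hv hKv
  have hmem : ∀ q ∈ u, ∀ t ∈ J, ∀ x : Fin 5 → ℝ, x ≠ 0 → (q, t, ‖x‖⁻¹ • x) ∈ O₂ := by
    intro q hq t ht x hx
    refine huv ⟨hq, hJS ⟨ht, hS ?_⟩⟩
    simp [norm_smul, hx]
  -- By this scaling identity the derivative at x equals the derivative at x/‖x‖, so control on the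
  -- unit sphere is enough.
  have hsc : ∀ (x : Fin 5 → ℝ), x ≠ 0 → ∀ q t y, G (q, t, y) = ‖x‖ • G (q, t, ‖x‖⁻¹ • y) := by
    intro x hx q t y
    rw [← hom, smul_smul, mul_inv_cancel₀ (norm_ne_zero_iff.2 hx), one_smul]
  filter_upwards [hu.mem_nhds (hqu rfl)] with q hq
  refine exists_ambientIsotopy_of_lipschitz J hJ hIJ (fun z => G (q, z)) ?_ (fun t _ c x => hom q t c x)
    (fun x => h0 q x) ?_ ?_
  · rintro ⟨t, x⟩ ⟨ht, hx⟩
    refine ContDiffAt.contDiffWithinAt ?_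
    have h1 : ContDiffAt ℝ ∞ G (q, t, ‖x‖⁻¹ • x) := hG.contDiffAt (hO.mem_nhds (hmem q hq t ht x hx).1)
    have h2 : ContDiffAt ℝ ∞ (fun z : ℝ × (Fin 5 → ℝ) => ‖x‖ • G (q, z.1, ‖x‖⁻¹ • z.2)) (t, x) := by
      refine ContDiffAt.const_smul _ ?_
      refine ContDiffAt.comp (t, x) h1 ?_
      fun_prop
    refine h2.congr_of_eventuallyEq (Filter.Eventually.of_forall fun z => ?_)
    exact hsc x hx q z.1 z.2
  · intro t ht x
    rcases eq_or_ne x 0 with rfl | hx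
    · have : G (q, t, 0) = 0 := by simpa using hom q t 0 0
      rw [this]
    · have h1 := hcone q t _ (hmem q hq t ht x hx).1
      have hx' := norm_ne_zero_iff.2 hx
      rw [hom, form32_smul, form32_smul] at h1
      simpa [hx'] using h1
  · intro t ht
    refine lipschitz_sub_id_of_homogeneous (G' := fun x => DG (q, t, ‖x‖⁻¹ • x))
      (fun c x => hom q t c x) (fun x hx => ?_) (fun x hx => (hmem q hq t ht x hx).2.le)
    have h1 := hDG q t _ (hmem q hq t ht x hx).1
    have h2 : HasFDerivAt (fun y => ‖x‖ • G (q, t, ‖x‖⁻¹ • y))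
        (‖x‖ • (DG (q, t, ‖x‖⁻¹ • x)).comp (‖x‖⁻¹ • ContinuousLinearMap.id ℝ (Fin 5 → ℝ))) x :=
      (h1.comp x ((hasFDerivAt_id x).const_smul ‖x‖⁻¹)).const_smul ‖x‖
    have h3 : (‖x‖ • (DG (q, t, ‖x‖⁻¹ • x)).comp (‖x‖⁻¹ • ContinuousLinearMap.id ℝ (Fin 5 → ℝ)))
        = DG (q, t, ‖x‖⁻¹ • x) := by
      ext1 w
      simp [smul_smul, mul_inv_cancel₀ (norm_ne_zero_iff.2 hx)]
    rw [h3] at h2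
    refine h2.congr_of_eventuallyEq (Filter.Eventually.of_forall fun y => ?_)
    exact hsc x hx q t y

/-- The inverse of an ambient isotopy. -/
def AmbientIsotopy.symm (H : AmbientIsotopy) : AmbientIsotopy where
  toEquiv t := (H.toEquiv t).symm
  zero := by rw [H.zero]; rfl
  smooth := H.smooth_symm
  smooth_symm := H.smooth

theorem IsotopicOutside.symm {V A B : Set Q32} (h : IsotopicOutside V A B) :
    IsotopicOutside V B A := by
  obtain ⟨H, hV, hAB⟩ := h
  refine ⟨H.symm, fun t => ?_, ?_⟩
  · change (H.toEquiv t).symm '' V = V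
    conv_lhs => rw [← hV t]
    exact Equiv.symm_image_image _ _
  · change (H.toEquiv 1).symm '' (B \ V) = A \ V
    rw [← hAB]
    exact Equiv.symm_image_image _ _

end

/-! ### Implicit functions, homogeneous cutoffs, and the parameter of a curve as a function on ℝ⁵ -/

noncomputable section

/-- An implicit function theorem along a compact set of solutions. -/
theorem exists_implicit_of_isCompact {Y : Type*} [NormedAddCommGroup Y] [NormedSpace ℝ Y]
    [CompleteSpace Y] (q₀ : Y) (Θ : (Y × ℝ) × ℝ → ℝ) (hΘ : ContDiff ℝ ∞ Θ) {C : Set ℝ}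
    (hC : IsCompact C) (h0 : ∀ c, Θ ((q₀, c), c) = 0)
    (hd : ∀ c ∈ C, ∃ D : ℝ, D ≠ 0 ∧ HasDerivAt (fun u => Θ ((q₀, c), u)) D c) :
    ∃ (υ : Y × ℝ → ℝ) (O : Set (Y × ℝ)), IsOpen O ∧ (∀ c ∈ C, (q₀, c) ∈ O) ∧ ContDiffOn ℝ ∞ υ O ∧
      (∀ w ∈ O, Θ (w, υ w) = 0) ∧ ∀ c, (q₀, c) ∈ O → υ (q₀, c) = c := by
  -- Solving Θ(w, u) = 0 for u amounts to inverting Ψ(w, u) = (w, Θ(w, u)) at (w, 0).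
  let Ψ : (Y × ℝ) × ℝ → (Y × ℝ) × ℝ := fun z => (z.1, Θ z)
  have hΨ : ContDiff ℝ ∞ Ψ := contDiff_fst.prodMk hΘ
  let N₁ : Set ((Y × ℝ) × ℝ) := {z | fderiv ℝ Θ z (0, 1) ≠ 0}
  have hN₁ : IsOpen N₁ := by
    have : Continuous fun z => fderiv ℝ Θ z (0, 1) :=
      (hΘ.continuous_fderiv (by simp)).clm_apply continuous_const
    exact isOpen_ne_fun this continuous_const
  have hdΨ : ∀ z ∈ N₁, ∃ f' : ((Y × ℝ) × ℝ) ≃L[ℝ] ((Y × ℝ) × ℝ),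
      HasFDerivAt Ψ (f' : ((Y × ℝ) × ℝ) →L[ℝ] ((Y × ℝ) × ℝ)) z := by
    intro z hz
    refine exists_equiv_hasFDerivAt_graph (hΘ.differentiable (by simp) z).hasFDerivAt
      (ContinuousLinearEquiv.unitsEquivAut ℝ (Units.mk0 _ hz)) ?_
    ext
    simp
  let s : Set ((Y × ℝ) × ℝ) := (fun c => ((q₀, c), c)) '' C
  have hs : IsCompact s := hC.image (by fun_prop)
  have hsN : s ⊆ N₁ := by
    rintro _ ⟨c, hc, rfl⟩
    obtain ⟨D, hD, hcD⟩ := hd c hc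
    have h1 : HasFDerivAt Θ (fderiv ℝ Θ ((q₀, c), c)) ((q₀, c), c) :=
      (hΘ.differentiable (by simp) _).hasFDerivAt
    have h2 := (h1.comp c (hasFDerivAt_prodMk_right (q₀, c) c)).hasDerivAt
    have h3 := h2.unique hcD
    simp only [ContinuousLinearMap.comp_apply, ContinuousLinearMap.inr_apply] at h3
    simpa [N₁, h3] using hD
  -- A local homeomorphism that is injective on the compact set `s` is injective on a neighbourhood
  -- of it, so the local solutions fit together into one function.
  obtain ⟨t, ht, hti⟩ := Set.InjOn.exists_mem_nhdsSet (f := Ψ) (s := s) (by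
      rintro _ ⟨c, hc, rfl⟩ _ ⟨c', hc', rfl⟩ h
      simp only [Ψ, Prod.mk.injEq, true_and] at h
      simp [h.1]) hs (fun z _ => hΨ.continuous.continuousAt) (fun z hz => by
      obtain ⟨f', hf'⟩ := hdΨ z (hsN hz)
      have hc : ContDiffAt ℝ ∞ Ψ z := hΨ.contDiffAt
      refine ⟨_, (hc.toOpenPartialHomeomorph Ψ hf' (by simp)).open_source.mem_nhds
        (hc.mem_toOpenPartialHomeomorph_source hf' (by simp)), ?_⟩
      exact (hc.toOpenPartialHomeomorph Ψ hf' (by simp)).injOn)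
  let N : Set ((Y × ℝ) × ℝ) := interior t ∩ N₁
  have hN : IsOpen N := isOpen_interior.inter hN₁
  have hsN' : s ⊆ N := fun z hz => ⟨subset_interior_iff_mem_nhdsSet.2 ht hz, hsN hz⟩
  obtain ⟨g, hgo, hgs, hgl⟩ := exists_contDiffOn_inverse hN hΨ.contDiffOn
    (hti.mono (Set.inter_subset_left.trans interior_subset)) (fun z hz => hdΨ z hz.2)
  -- The second condition on w places the obvious solution ((q₀, c), c) in `N`; this makes υ(q₀, c)
  -- = c hold on the whole slice, also for c outside `C`.
  refine ⟨fun w => (g (w, 0)).2, {w | (w, (0 : ℝ)) ∈ Ψ '' N} ∩ {w | (w, w.2) ∈ N}, ?_, ?_, ?_, ?_, ?_⟩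
  · exact (hgo.preimage (by fun_prop)).inter (hN.preimage (by fun_prop))
  · intro c hc
    have : ((q₀, c), c) ∈ N := hsN' ⟨c, hc, rfl⟩
    exact ⟨⟨_, this, by simp [Ψ, h0]⟩, this⟩
  · refine contDiff_snd.comp_contDiffOn (hgs.comp (by fun_prop) fun w hw => hw.1)
  · rintro w ⟨⟨z, hz, hzw⟩, -⟩
    have h1 : z.1 = w ∧ Θ z = 0 := by simpa [Ψ] using hzw
    have h2 := hgl z hz
    simp only [← hzw, h2]
    rw [← h1.1]
    exact h1.2
  · rintro c ⟨-, hc⟩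
    have h2 := hgl _ hc
    simp only [Ψ, h0] at h2
    simp [h2]

/-- The Euclidean norm on `ℝ⁵`. -/
def euclNorm (x : Fin 5 → ℝ) : ℝ := √(∑ i, x i ^ 2)

theorem euclNorm_pos {x : Fin 5 → ℝ} (hx : x ≠ 0) : 0 < euclNorm x := by
  obtain ⟨i, hi⟩ := Function.ne_iff.1 hx
  exact Real.sqrt_pos.2 (Finset.sum_pos' (fun i _ => sq_nonneg _) ⟨i, Finset.mem_univ i, by
    have : x i ≠ 0 := hi
    positivity⟩)

theorem euclNorm_smul (c : ℝ) (x : Fin 5 → ℝ) : euclNorm (c • x) = |c| * euclNorm x := by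
  simp only [euclNorm, Pi.smul_apply, smul_eq_mul, mul_pow, ← Finset.mul_sum]
  rw [Real.sqrt_mul (sq_nonneg c), Real.sqrt_sq_eq_abs]

/-- Smoothness away from the origin is why this norm replaces the supremum norm of `Fin 5 → ℝ`: it
makes normalisation to the unit sphere smooth. -/
theorem contDiffOn_euclNorm : ContDiffOn ℝ ∞ euclNorm {0}ᶜ := by
  intro x hx
  have h := euclNorm_pos hx
  refine ContDiffAt.contDiffWithinAt (ContDiffAt.sqrt (by fun_prop) ?_)
  exact (Real.sqrt_pos.1 h).ne'

theorem continuous_euclNorm : Continuous euclNorm := by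
  unfold euclNorm
  fun_prop

/-- The Euclidean unit sphere of `ℝ⁵`. -/
def euclSphere : Set (Fin 5 → ℝ) := {x | euclNorm x = 1}

theorem isClosed_euclSphere : IsClosed euclSphere := isClosed_eq continuous_euclNorm continuous_const

theorem isCompact_euclSphere : IsCompact euclSphere := by
  refine (isCompact_closedBall (0 : Fin 5 → ℝ) 1).of_isClosed_subset isClosed_euclSphere ?_
  intro x hx
  rw [mem_closedBall_zero_iff, pi_norm_le_iff_of_nonneg zero_le_one]
  intro i
  have hx' : √(∑ i, x i ^ 2) = 1 := hx
  rw [Real.sqrt_eq_one] at hx'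
  rw [Real.norm_eq_abs, abs_le_one_iff_mul_self_le_one, ← sq, ← hx']
  exact Finset.single_le_sum (f := fun i => x i ^ 2) (fun i _ => sq_nonneg _) (Finset.mem_univ i)

theorem ne_zero_of_mem_euclSphere {x : Fin 5 → ℝ} (hx : x ∈ euclSphere) : x ≠ 0 := by
  rintro rfl
  simp [euclSphere, euclNorm] at hx

/-- The homogeneous function of degree zero obtained by averaging `g` over `± x / |x|`. -/
def homogenizeFun (g : (Fin 5 → ℝ) → ℝ) (x : Fin 5 → ℝ) : ℝ :=
  (g ((euclNorm x)⁻¹ • x) + g (-((euclNorm x)⁻¹ • x))) / 2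

/-- Scaling by a negative number swaps the two unit vectors on the line, which the average does not
see. -/
theorem homogenizeFun_smul (g : (Fin 5 → ℝ) → ℝ) {c : ℝ} (hc : c ≠ 0) (x : Fin 5 → ℝ) :
    homogenizeFun g (c • x) = homogenizeFun g x := by
  unfold homogenizeFun
  rw [euclNorm_smul, smul_smul, mul_inv, mul_assoc, mul_comm _ c, ← mul_assoc]
  rcases lt_or_gt_of_ne hc with h | h
  · rw [abs_of_neg h, inv_neg, neg_mul, inv_mul_cancel₀ hc, neg_mul, one_mul, neg_smul, neg_neg,
      add_comm]
  · rw [abs_of_pos h, inv_mul_cancel₀ hc, one_mul]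

theorem contDiffOn_homogenizeFun {g : (Fin 5 → ℝ) → ℝ} (hg : ContDiff ℝ ∞ g) :
    ContDiffOn ℝ ∞ (homogenizeFun g) {0}ᶜ := by
  have h : ContDiffOn ℝ ∞ (fun x => (euclNorm x)⁻¹ • x) {0}ᶜ :=
    (contDiffOn_euclNorm.inv fun x hx => (euclNorm_pos hx).ne').smul contDiffOn_id
  exact ((hg.comp_contDiffOn h).add (hg.comp_contDiffOn h.neg)).div_const 2

theorem exists_mem_euclSphere_homogenizeFun (g : (Fin 5 → ℝ) → ℝ) {x : Fin 5 → ℝ} (hx : x ≠ 0) :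
    ∃ c : ℝ, c ≠ 0 ∧ c • x ∈ euclSphere ∧ (-c) • x ∈ euclSphere ∧
      homogenizeFun g x = (g (c • x) + g ((-c) • x)) / 2 := by
  have h := euclNorm_pos hx
  refine ⟨(euclNorm x)⁻¹, by positivity, ?_, ?_, ?_⟩
  · change euclNorm _ = 1
    rw [euclNorm_smul, abs_of_pos (by positivity), inv_mul_cancel₀ h.ne']
  · change euclNorm _ = 1
    rw [euclNorm_smul, abs_neg, abs_of_pos (by positivity), inv_mul_cancel₀ h.ne']
  · rw [homogenizeFun, neg_smul]

/-- A homogeneous smooth Urysohn function for disjoint closed cones. -/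
theorem exists_homogeneous_cutoff (A Z : Set (Fin 5 → ℝ)) (hA : IsClosed (A ∩ euclSphere))
    (hZ : IsClosed (Z ∩ euclSphere)) (hAZ : Disjoint A Z)
    (hAs : ∀ c : ℝ, c ≠ 0 → ∀ x ∈ A, c • x ∈ A) (hZs : ∀ c : ℝ, c ≠ 0 → ∀ x ∈ Z, c • x ∈ Z) :
    ∃ χ : (Fin 5 → ℝ) → ℝ, ContDiffOn ℝ ∞ χ {0}ᶜ ∧ (∀ c : ℝ, c ≠ 0 → ∀ x, χ (c • x) = χ x) ∧
      (∀ x ∈ A, x ≠ 0 → χ x = 1) ∧ ∀ x ∈ Z, x ≠ 0 → χ x = 0 := by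
  obtain ⟨f, hf0, hf1, -⟩ := exists_contMDiffMap_zero_one_of_isClosed (n := ⊤)
    (modelWithCornersSelf ℝ (Fin 5 → ℝ)) hZ hA
    (hAZ.symm.mono Set.inter_subset_left Set.inter_subset_left)
  refine ⟨homogenizeFun f, contDiffOn_homogenizeFun f.contMDiff.contDiff,
    fun c hc x => homogenizeFun_smul _ hc x, fun x hx hx0 => ?_, fun x hx hx0 => ?_⟩
  · obtain ⟨c, hc, h1, h2, h3⟩ := exists_mem_euclSphere_homogenizeFun f hx0
    have e1 : f (c • x) = 1 := hf1 ⟨hAs c hc x hx, h1⟩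
    have e2 : f ((-c) • x) = 1 := hf1 ⟨hAs _ (neg_ne_zero.2 hc) x hx, h2⟩
    rw [h3, e1, e2]
    norm_num
  · obtain ⟨c, hc, h1, h2, h3⟩ := exists_mem_euclSphere_homogenizeFun f hx0
    have e1 : f (c • x) = 0 := hf0 ⟨hZs c hc x hx, h1⟩
    have e2 : f ((-c) • x) = 0 := hf0 ⟨hZs _ (neg_ne_zero.2 hc) x hx, h2⟩
    rw [h3, e1, e2]
    norm_num

/-- The part on the unit sphere of the cone over a compact piece of a curve. -/
theorem isCompact_cone_inter_euclSphere {γ : ℝ → Fin 5 → ℝ} (hγ : Continuous γ)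
    (hγ0 : ∀ u, γ u ≠ 0) {C : Set ℝ} (hC : IsCompact C) :
    IsCompact ({x | ∃ u ∈ C, ∃ c : ℝ, x = c • γ u} ∩ euclSphere) := by
  have h1 : Continuous fun u => (euclNorm (γ u))⁻¹ • γ u :=
    ((continuous_euclNorm.comp hγ).inv₀ fun u => (euclNorm_pos (hγ0 u)).ne').smul hγ
  have : {x | ∃ u ∈ C, ∃ c : ℝ, x = c • γ u} ∩ euclSphere =
      (fun u => (euclNorm (γ u))⁻¹ • γ u) '' C ∪ (fun u => -((euclNorm (γ u))⁻¹ • γ u)) '' C := by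
    ext x
    constructor
    · rintro ⟨⟨u, hu, c, rfl⟩, hx⟩
      have hn := euclNorm_pos (hγ0 u)
      have hx' : |c| * euclNorm (γ u) = 1 := by rw [← euclNorm_smul]; exact hx
      have hc : |c| = (euclNorm (γ u))⁻¹ := eq_inv_of_mul_eq_one_left hx'
      rcases abs_choice c with h | h
      · left
        exact ⟨u, hu, by simp only; rw [← hc, h]⟩
      · right
        exact ⟨u, hu, by simp only; rw [← hc, h, neg_smul, neg_neg]⟩
    · have key : ∀ u, (euclNorm (γ u))⁻¹ * euclNorm (γ u) = 1 := fun u =>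
        inv_mul_cancel₀ (euclNorm_pos (hγ0 u)).ne'
      have hp : ∀ u, 0 < (euclNorm (γ u))⁻¹ := fun u => inv_pos.2 (euclNorm_pos (hγ0 u))
      rintro (⟨u, hu, rfl⟩ | ⟨u, hu, rfl⟩)
      · refine ⟨⟨u, hu, _, rfl⟩, ?_⟩
        change euclNorm _ = 1
        rw [euclNorm_smul, abs_of_pos (hp u), key]
      · refine ⟨⟨u, hu, -(euclNorm (γ u))⁻¹, by simp⟩, ?_⟩
        change euclNorm (-((euclNorm (γ u))⁻¹ • γ u)) = 1
        rw [← neg_smul, euclNorm_smul, abs_neg, abs_of_pos (hp u), key]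
  rw [this]
  exact (hC.image h1).union (hC.image h1.neg)

/-- A smooth injective function of one variable has a smooth local inverse. -/
theorem exists_local_inverse_real {m : ℝ → ℝ} {O : Set ℝ} (hO : IsOpen O) (hm : ContDiffOn ℝ ∞ m O)
    {u₀ : ℝ} (hu₀ : u₀ ∈ O) (hd : deriv m u₀ ≠ 0) :
    ∃ (O' : Set ℝ) (τ : ℝ → ℝ), IsOpen O' ∧ u₀ ∈ O' ∧ O' ⊆ O ∧ IsOpen (m '' O') ∧
      ContDiffOn ℝ ∞ τ (m '' O') ∧ ∀ u ∈ O', τ (m u) = u := by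
  have hda : ∀ u ∈ O, HasDerivAt m (deriv m u) u := fun u hu =>
    ((hm.contDiffAt (hO.mem_nhds hu)).differentiableAt (by simp)).hasDerivAt
  have hdo : IsOpen (O ∩ deriv m ⁻¹' {0}ᶜ) :=
    (hm.continuousOn_deriv_of_isOpen hO (by simp)).isOpen_inter_preimage hO isOpen_compl_singleton
  have heq : ∀ u ∈ O, deriv m u ≠ 0 → ∃ f' : ℝ ≃L[ℝ] ℝ, HasFDerivAt m (f' : ℝ →L[ℝ] ℝ) u := by
    intro u hu h
    refine ⟨ContinuousLinearEquiv.unitsEquivAut ℝ (Units.mk0 _ h), ?_⟩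
    exact (hda u hu).hasFDerivAt_equiv h
  obtain ⟨f', hf'⟩ := heq u₀ hu₀ hd
  have hc : ContDiffAt ℝ ∞ m u₀ := hm.contDiffAt (hO.mem_nhds hu₀)
  set Φ := hc.toOpenPartialHomeomorph m hf' (by simp) with hΦ
  let O' := Φ.source ∩ (O ∩ deriv m ⁻¹' {0}ᶜ)
  have hO' : IsOpen O' := Φ.open_source.inter hdo
  obtain ⟨τ, h1, h2, h3⟩ := exists_contDiffOn_inverse hO' (hm.mono fun u hu => hu.2.1)
    (Φ.injOn.mono Set.inter_subset_left) (fun u hu => heq u hu.2.1 hu.2.2)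
  exact ⟨O', τ, hO', ⟨hc.mem_toOpenPartialHomeomorph_source hf' _, hu₀, hd⟩, fun u hu => hu.2.1,
    h1, h2, h3⟩

/-- The parameter of a curve embedded in projective space extends to a smooth homogeneous function
of degree zero. -/
theorem exists_homogeneous_parameter {γ γ' : ℝ → Fin 5 → ℝ} (hγ : ContDiff ℝ ∞ γ)
    (hγ0 : ∀ u, γ u ≠ 0) (hd : ∀ u, HasDerivAt γ (γ' u) u)
    (hinj : ∀ u v, ∀ c : ℝ, γ u = c • γ v → u = v)
    (himm : ∀ u, ∀ c : ℝ, γ' u ≠ c • γ u) {C : Set ℝ} (hC : IsCompact C) :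
    ∃ g : (Fin 5 → ℝ) → ℝ, ContDiffOn ℝ ∞ g {0}ᶜ ∧ (∀ c : ℝ, c ≠ 0 → ∀ x, g (c • x) = g x) ∧
      ∀ u ∈ C, g (γ u) = u := by
  -- The requirement on the value at x is a convex condition, vacuous off the cone over the curve.
  -- Hence local solutions can be glued by a partition of unity.
  let t : (Fin 5 → ℝ) → Set ℝ := fun x =>
    {y | x ∈ euclSphere → ∀ u ∈ C, (∃ c : ℝ, x = c • γ u) → y = u}
  have ht : ∀ x, Convex ℝ (t x) := by
    intro x y hy z hz a b ha hb hab hx u hu hc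
    have h1 := hy hx u hu hc
    have h2 := hz hx u hu hc
    rw [h1, h2, ← add_smul, hab, one_smul]
  have hCs := fun {C'} (h : IsCompact C') => isCompact_cone_inter_euclSphere hγ.continuous hγ0 h
  obtain ⟨g, hg⟩ := exists_contMDiffMap_forall_mem_convex_of_local (n := ⊤)
    (modelWithCornersSelf ℝ (Fin 5 → ℝ)) ht (by
    intro x₀
    by_cases hx₀ : x₀ ∈ {x | ∃ u ∈ C, ∃ c : ℝ, x = c • γ u} ∩ euclSphere
    · obtain ⟨⟨u₀, hu₀, c₀, hx₀⟩, hxs⟩ := hx₀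
      have hc₀ : c₀ ≠ 0 := by
        rintro rfl
        exact ne_zero_of_mem_euclSphere hxs (by simp [hx₀])
      obtain ⟨i, hi⟩ := Function.ne_iff.1 (hγ0 u₀)
      have hi : γ u₀ i ≠ 0 := hi
      -- If no affine coordinate γⱼ/γᵢ had nonzero derivative at u₀, then γ' would be a multiple of
      -- γ there, against `himm`.
      obtain ⟨j, hj⟩ : ∃ j, γ' u₀ j * γ u₀ i - γ u₀ j * γ' u₀ i ≠ 0 := by
        by_contra! h
        refine himm u₀ (γ' u₀ i / γ u₀ i) (funext fun j => ?_)
        have := h j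
        simp only [Pi.smul_apply, smul_eq_mul]
        field_simp
        linarith
      have hγi : ∀ k, ContDiff ℝ ∞ fun u => γ u k := fun k => contDiff_pi.1 hγ k
      have hO : IsOpen {u | γ u i ≠ 0} := isOpen_ne_fun (hγi i).continuous continuous_const
      have hm : ContDiffOn ℝ ∞ (fun u => γ u j / γ u i) {u | γ u i ≠ 0} :=
        (hγi j).contDiffOn.div (hγi i).contDiffOn fun u hu => hu
      have hdm : deriv (fun u => γ u j / γ u i) u₀ ≠ 0 := by
        have hdiv : HasDerivAt (fun u => γ u j / γ u i) _ u₀ :=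
          (hasDerivAt_pi.1 (hd u₀) j).div (hasDerivAt_pi.1 (hd u₀) i) hi
        rw [hdiv.deriv]
        exact div_ne_zero hj (pow_ne_zero 2 hi)
      obtain ⟨O', τ, hO', hu₀', hO'O, himo, hτ, hτl⟩ := exists_local_inverse_real hO hm hi hdm
      have hB := (hCs (hC.diff hO')).isClosed
      -- The ratio xⱼ/xᵢ recovers the parameter only for u in `O'`. Removing the closed cone over
      -- the rest of the arc excludes other points of the curve with the same ratio.
      refine ⟨{x | x i ≠ 0 ∧ x j / x i ∈ (fun u => γ u j / γ u i) '' O'} ∩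
        ({x | ∃ u ∈ C \ O', ∃ c : ℝ, x = c • γ u} ∩ euclSphere)ᶜ, ?_, fun x => τ (x j / x i), ?_, ?_⟩
      · refine IsOpen.mem_nhds (IsOpen.inter ?_ hB.isOpen_compl) ⟨?_, ?_⟩
        · have h1 : IsOpen {x : Fin 5 → ℝ | x i ≠ 0} := isOpen_ne_fun (by fun_prop) continuous_const
          have h2 : ContinuousOn (fun x : Fin 5 → ℝ => x j / x i) {x | x i ≠ 0} :=
            ContinuousOn.div (by fun_prop) (by fun_prop) fun x hx => hx
          exact h2.isOpen_inter_preimage h1 himo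
        · rw [hx₀]
          refine ⟨mul_ne_zero hc₀ hi, u₀, hu₀', ?_⟩
          simp only [Pi.smul_apply, smul_eq_mul]
          rw [mul_div_mul_left _ _ hc₀]
        · rintro ⟨⟨v, hv, c, hxc⟩, -⟩
          refine hv.2 ?_
          have : γ u₀ = (c₀⁻¹ * c) • γ v := by
            rw [← smul_smul, ← hxc, hx₀, smul_smul, inv_mul_cancel₀ hc₀, one_smul]
          rw [← hinj _ _ _ this]
          exact hu₀'
      · rw [contMDiffOn_iff_contDiffOn]
        have h2 : ContDiffOn ℝ ∞ (fun x : Fin 5 → ℝ => x j / x i) {x | x i ≠ 0} :=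
          ContDiffOn.div (by fun_prop) (by fun_prop) fun x hx => hx
        exact hτ.comp (h2.mono fun x hx => hx.1.1) fun x hx => hx.1.2
      · rintro x ⟨⟨hxi, -⟩, hxB⟩ hxs u hu ⟨c, hxc⟩
        have huO : u ∈ O' := by
          by_contra h
          exact hxB ⟨⟨u, ⟨hu, h⟩, c, hxc⟩, hxs⟩
        have hc : c ≠ 0 := by
          rintro rfl
          exact hxi (by simp [hxc])
        rw [hxc]
        simp only [Pi.smul_apply, smul_eq_mul]
        rw [mul_div_mul_left _ _ hc]
        exact hτl u huO
    · refine ⟨_, (hCs hC).isClosed.isOpen_compl.mem_nhds hx₀, fun _ => 0, contMDiffOn_const, ?_⟩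
      intro y hy hys u hu hc
      exact (hy ⟨⟨u, hu, hc⟩, hys⟩).elim)
  refine ⟨homogenizeFun g, contDiffOn_homogenizeFun g.contMDiff.contDiff,
    fun c hc x => homogenizeFun_smul _ hc x, fun u hu => ?_⟩
  obtain ⟨c, hc, h1, h2, h3⟩ := exists_mem_euclSphere_homogenizeFun g (hγ0 u)
  rw [h3, hg _ h1 u hu ⟨c, rfl⟩, hg _ h2 u hu ⟨-c, rfl⟩]
  ring

end

/-! ### The displacement field carrying a curve to a nearby curve -/

noncomputable section

/-- A smooth function that is `0` on `[-m, m]` and `1` outside `(-M, M)`. -/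
theorem exists_smooth_cutoff_abs {m M : ℝ} (hm : 0 ≤ m) (hmM : m < M) :
    ∃ η : ℝ → ℝ, ContDiff ℝ ∞ η ∧ (∀ u, |u| ≤ m → η u = 0) ∧ ∀ u, M ≤ |u| → η u = 1 := by
  have h : 0 < M ^ 2 - m ^ 2 := by nlinarith
  refine ⟨fun u => Real.smoothTransition ((u ^ 2 - m ^ 2) / (M ^ 2 - m ^ 2)),
    Real.smoothTransition.contDiff.comp (by fun_prop), fun u hu => ?_, fun u hu => ?_⟩
  · refine Real.smoothTransition.zero_of_nonpos (div_nonpos_of_nonpos_of_nonneg ?_ h.le)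
    have := sq_le_sq' (by linarith [neg_abs_le u]) ((le_abs_self u).trans hu)
    linarith
  · refine Real.smoothTransition.one_of_one_le ((one_le_div h).2 ?_)
    have : M ^ 2 ≤ |u| ^ 2 := pow_le_pow_left₀ (by linarith) hu 2
    rw [sq_abs] at this
    linarith

variable {F : Type*} [NormedAddCommGroup F] [InnerProductSpace ℝ F]

/-- The cone (without apex) over a piece of a curve. -/
def curveCone (γ : ℝ → Fin 5 → ℝ) (C : Set ℝ) : Set (Fin 5 → ℝ) :=
  {x | x ≠ 0 ∧ ∃ u ∈ C, ∃ c : ℝ, x = c • γ u}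

theorem isCompact_curveCone_inter {γ : ℝ → Fin 5 → ℝ} (hγ : Continuous γ)
    (hγ0 : ∀ u, γ u ≠ 0) {C : Set ℝ} (hC : IsCompact C) :
    IsCompact (curveCone γ C ∩ euclSphere) := by
  convert isCompact_cone_inter_euclSphere hγ hγ0 hC using 1
  ext x
  simp only [curveCone, Set.mem_inter_iff, Set.mem_ofPred_eq]
  exact ⟨fun h => ⟨h.1.2, h.2⟩, fun h => ⟨⟨ne_zero_of_mem_euclSphere h.2, h.1⟩, h.2⟩⟩

theorem smul_mem_curveCone {γ : ℝ → Fin 5 → ℝ} {C : Set ℝ} {c : ℝ} (hc : c ≠ 0) {x : Fin 5 → ℝ}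
    (hx : x ∈ curveCone γ C) : c • x ∈ curveCone γ C := by
  obtain ⟨h0, u, hu, k, rfl⟩ := hx
  exact ⟨smul_ne_zero hc h0, u, hu, c * k, by rw [smul_smul]⟩

theorem mem_curveCone {γ : ℝ → Fin 5 → ℝ} (hγ0 : ∀ u, γ u ≠ 0) {C : Set ℝ} {u : ℝ} (hu : u ∈ C) :
    γ u ∈ curveCone γ C := ⟨hγ0 u, u, hu, 1, by simp⟩

/-- The displacement field that moves the curve `γ = Γ (q₀, ·)` to the nearby curve `Γ (q, ·)`. -/
theorem exists_displacement {Y : Type*} [NormedAddCommGroup Y] [NormedSpace ℝ Y] [CompleteSpace Y]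
    (e : (Fin 5 → ℝ) ≃L[ℝ] ℂ × F) (he : ∀ x, form32 x = ‖(e x).2‖ ^ 2 - ‖(e x).1‖ ^ 2)
    (q₀ : Y) (Γ : Y × ℝ → Fin 5 → ℝ) (hΓ : ContDiff ℝ ∞ Γ)
    (hγ0 : ∀ u, Γ (q₀, u) ≠ 0) (hγq : ∀ u, form32 (Γ (q₀, u)) = 0)
    (hinj : ∀ u v, ∀ c : ℝ, Γ (q₀, u) = c • Γ (q₀, v) → u = v)
    {γ' : ℝ → Fin 5 → ℝ} (hd : ∀ u, HasDerivAt (fun u => Γ (q₀, u)) (γ' u) u)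
    (himm : ∀ u, ∀ c : ℝ, γ' u ≠ c • Γ (q₀, u))
    {M₀ M₁ M : ℝ} (hM₀ : 0 < M₀) (hM₀₁ : M₀ < M₁)
    (hang : ∀ u, M₀ ≤ |u| → ((starRingEnd ℂ) (e (Γ (q₀, u))).1 * (e (γ' u)).1).im ≠ 0)
    (Z' Fc : Set (Fin 5 → ℝ)) (hZ' : IsClosed (Z' ∩ euclSphere)) (hFc : IsClosed (Fc ∩ euclSphere))
    (hZ's : ∀ c : ℝ, c ≠ 0 → ∀ x ∈ Z', c • x ∈ Z') (hFcs : ∀ c : ℝ, c ≠ 0 → ∀ x ∈ Fc, c • x ∈ Fc)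
    (hAZ : ∀ u ∈ Set.Icc (-M) M, Γ (q₀, u) ∉ Z')
    (hAF : ∀ u ∈ Set.Icc (-M) M, Γ (q₀, u) ∈ Fc → M₁ < |u|) :
    ∃ (D : Y × (Fin 5 → ℝ) → ℂ × F) (OD : Set (Y × (Fin 5 → ℝ))) (υ : Y × ℝ → ℝ)
      (OS : Set (Y × ℝ)),
      IsOpen OD ∧ (∀ x, x ≠ 0 → (q₀, x) ∈ OD) ∧ ContDiffOn ℝ ∞ D OD ∧
      (∀ q (c : ℝ) x, D (q, c • x) = c • D (q, x)) ∧ (∀ x, D (q₀, x) = 0) ∧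
      (∀ q, ∀ x ∈ Z', x ≠ 0 → D (q, x) = 0) ∧
      (∀ q x, x ≠ 0 → (q, x) ∈ OD → x ∈ Fc → (D (q, x)).1 = 0) ∧
      IsOpen OS ∧ (∀ u ∈ Set.Icc (-M) M, (q₀, u) ∈ OS) ∧ ContDiffOn ℝ ∞ υ OS ∧
      (∀ u ∈ Set.Icc (-M) M, υ (q₀, u) = u) ∧
      ∀ q, ∀ u ∈ Set.Icc (-M) M, (q, u) ∈ OS → form32 (Γ (q, υ (q, u))) = 0 →
        ∃ κ : ℝ, 0 < κ ∧ e (Γ (q₀, u)) + D (q, Γ (q₀, u)) = κ • e (Γ (q, υ (q, u))) := by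
  set γ : ℝ → Fin 5 → ℝ := fun u => Γ (q₀, u) with hγdef
  have hγ : ContDiff ℝ ∞ γ := hΓ.comp (by fun_prop)
  let a : Y × ℝ → ℂ := fun w => (e (Γ w)).1
  have ha : ContDiff ℝ ∞ a := contDiff_fst.comp (e.contDiff.comp hΓ)
  have hnorm : ∀ w, form32 (Γ w) = 0 → ‖(e (Γ w)).2‖ = ‖(e (Γ w)).1‖ := fun w hw => by
    have := he (Γ w)
    rw [hw] at this
    exact (pow_left_inj₀ (norm_nonneg _) (norm_nonneg _) two_ne_zero).1 (by linarith)
  have ha0 : ∀ u, a (q₀, u) ≠ 0 := by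
    intro u h
    have h1 := hnorm (q₀, u) (hγq u)
    have h2 : (e (Γ (q₀, u))).1 = 0 := h
    rw [h2, norm_zero, norm_eq_zero] at h1
    exact hγ0 u (e.injective (by rw [map_zero]; exact Prod.ext h2 h1))
  -- the matching reparametrisation
  let Θ : (Y × ℝ) × ℝ → ℝ := fun z => ((starRingEnd ℂ) (a (q₀, z.1.2)) * a (z.1.1, z.2)).im
  have hΘ : ContDiff ℝ ∞ Θ := by
    have h1 : ContDiff ℝ ∞ fun z : (Y × ℝ) × ℝ => (starRingEnd ℂ) (a (q₀, z.1.2)) :=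
      Complex.conjCLE.contDiff.comp (ha.comp (by fun_prop))
    have h2 : ContDiff ℝ ∞ fun z : (Y × ℝ) × ℝ => a (z.1.1, z.2) := ha.comp (by fun_prop)
    exact Complex.imCLM.contDiff.comp (h1.mul h2)
  -- The cutoff below vanishes only where the parameter function `g` exceeds M + 1 in absolute
  -- value, so the reparametrisation has to be controlled on a range larger than [-M, M].
  have hCc : IsCompact (Set.Icc (-(M + 2)) (M + 2) ∩ {u | M₀ ≤ |u|}) :=
    isCompact_Icc.inter_right (isClosed_le continuous_const continuous_abs)
  -- Θ = 0 says that the ℂ-components of γ(c) and Γ(q, u) are real multiples of each other. The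
  -- nonzero angular velocity `hang`, available for |c| ≥ M₀, allows solving for u near c.
  obtain ⟨υ₀, O, hO, hOC, hυ₀, hυΘ, hυq⟩ := exists_implicit_of_isCompact q₀ Θ hΘ hCc
    (fun c => by
      change ((starRingEnd ℂ) (a (q₀, c)) * a (q₀, c)).im = 0
      rw [← Complex.normSq_eq_conj_mul_self]
      exact Complex.ofReal_im _)
    (fun c hc => by
      refine ⟨_, hang c hc.2, ?_⟩
      have h1 : HasDerivAt (fun u => a (q₀, u)) (e (γ' c)).1 c :=
        ((ContinuousLinearMap.fst ℝ ℂ F).hasFDerivAt.comp_hasDerivAt c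
          (e.toContinuousLinearMap.hasFDerivAt.comp_hasDerivAt c (hd c)))
      exact Complex.imCLM.hasFDerivAt.comp_hasDerivAt c
        (h1.const_mul ((starRingEnd ℂ) (e (Γ (q₀, c))).1)))
  obtain ⟨η, hη, hη0, hη1⟩ := exists_smooth_cutoff_abs hM₀.le hM₀₁
  -- This interpolates between the unchanged parameter for |u| ≤ M₀, where matching by argument may
  -- be impossible, and the matched parameter for |u| ≥ M₁.
  let υ : Y × ℝ → ℝ := fun w => w.2 + η w.2 * (υ₀ w - w.2)
  let O' : Set (Y × ℝ) := O ∪ {w | |w.2| < M₀}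
  have hυO : ∀ w : Y × ℝ, |w.2| < M₀ → υ w = w.2 := fun w hw => by simp [υ, hη0 _ hw.le]
  have hO'2 : IsOpen {w : Y × ℝ | |w.2| < M₀} := isOpen_lt (by fun_prop) continuous_const
  have hO' : IsOpen O' := hO.union hO'2
  have hυs : ContDiffOn ℝ ∞ υ O' := by
    rintro w (hw | hw)
    · have h1 : ContDiffAt ℝ ∞ υ₀ w := hυ₀.contDiffAt (hO.mem_nhds hw)
      refine ContDiffAt.contDiffWithinAt (ContDiffAt.add (by fun_prop)
        ((hη.contDiffAt.comp w contDiffAt_snd).mul (h1.sub (by fun_prop))))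
    · refine ContDiffAt.contDiffWithinAt (ContDiffAt.congr_of_eventuallyEq (f := fun w => w.2)
        (by fun_prop) ?_)
      filter_upwards [hO'2.mem_nhds hw] with v hv using hυO v hv
  have hυq' : ∀ u, |u| ≤ M + 2 → υ (q₀, u) = u := by
    intro u hu
    rcases lt_or_ge |u| M₀ with h | h
    · exact hυO _ h
    · simp [υ, hυq u (hOC u ⟨abs_le.1 hu, h⟩)]
  have hO'C : ∀ u, |u| ≤ M + 2 → (q₀, u) ∈ O' := by
    intro u hu
    rcases lt_or_ge |u| M₀ with h | h
    · exact Or.inr h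
    · exact Or.inl (hOC u ⟨abs_le.1 hu, h⟩)
  -- Positivity of this real part picks the same ray instead of the opposite one, and excludes a
  -- vanishing ℂ-component.
  let pos : Y × ℝ → ℝ := fun w => ((starRingEnd ℂ) (a (q₀, w.2)) * a (w.1, υ w)).re
  have hposc : ContinuousOn pos O' := by
    have h1 : Continuous fun w : Y × ℝ => (starRingEnd ℂ) (a (q₀, w.2)) :=
      Complex.continuous_conj.comp (ha.continuous.comp (by fun_prop))
    have h2 : ContinuousOn (fun w : Y × ℝ => a (w.1, υ w)) O' :=
      ha.continuous.comp_continuousOn (continuousOn_fst.prodMk hυs.continuousOn)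
    exact Complex.continuous_re.comp_continuousOn (h1.continuousOn.mul h2)
  let OS : Set (Y × ℝ) := O' ∩ pos ⁻¹' Set.Ioi 0
  have hOS : IsOpen OS := hposc.isOpen_inter_preimage hO' isOpen_Ioi
  have hOSC : ∀ u, |u| ≤ M + 2 → (q₀, u) ∈ OS := by
    intro u hu
    refine ⟨hO'C u hu, ?_⟩
    change 0 < ((starRingEnd ℂ) (a (q₀, u)) * a (q₀, υ (q₀, u))).re
    rw [hυq' u hu, ← Complex.normSq_eq_conj_mul_self, Complex.ofReal_re]
    exact Complex.normSq_pos.2 (ha0 u)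
  have hOSa : ∀ w ∈ OS, a (w.1, υ w) ≠ 0 := by
    rintro w ⟨-, hw⟩ h
    have hw' : 0 < ((starRingEnd ℂ) (a (q₀, w.2)) * a (w.1, υ w)).re := hw
    rw [h] at hw'
    simp at hw'
  -- Representatives are normalised to have ℂ-component of norm 1; on the quadric the F-component
  -- then has norm 1 as well.
  let R : Y × ℝ → ℂ × F := fun w => (‖a w‖)⁻¹ • e (Γ w)
  have hR : ContDiffOn ℝ ∞ R {w | a w ≠ 0} := by
    refine ContDiffOn.smul (ContDiffOn.inv (ContDiffOn.norm ℝ ha.contDiffOn fun w hw => hw)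
      fun w hw => norm_ne_zero_iff.2 hw) (e.contDiff.comp hΓ).contDiffOn
  let S : Y × ℝ → ℂ × F := fun w => R (w.1, υ w) - R (q₀, w.2)
  have hS : ContDiffOn ℝ ∞ S OS := by
    have h1 : ContDiffOn ℝ ∞ υ OS := hυs.mono Set.inter_subset_left
    refine (hR.comp (contDiffOn_fst.prodMk h1) fun w hw => hOSa w hw).sub ?_
    exact hR.comp (by fun_prop) fun w _ => ha0 w.2
  have hS0 : ∀ u, |u| ≤ M + 2 → S (q₀, u) = 0 := fun u hu => by simp [S, hυq' u hu]
  -- For matched parameters the two ℂ-components lie on the same ray, so their normalisations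
  -- coincide and the ℂ-part of the displacement vanishes.
  have hSm : ∀ w ∈ OS, M₁ ≤ |w.2| → (S w).1 = 0 := by
    rintro w hwOS hw
    have hwO : w ∈ O := by
      rcases hwOS.1 with h | h
      · exact h
      · have h : |w.2| < M₀ := h
        linarith
    have hpos : 0 < ((starRingEnd ℂ) (a (q₀, w.2)) * a (w.1, υ w)).re := hwOS.2
    have hυw : υ w = υ₀ w := by simp [υ, hη1 _ hw]
    have him : ((starRingEnd ℂ) (a (q₀, w.2)) * a (w.1, υ w)).im = 0 := by
      rw [hυw]; exact hυΘ w hwO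
    set k := ((starRingEnd ℂ) (a (q₀, w.2)) * a (w.1, υ w)).re with hk
    have hkk : (starRingEnd ℂ) (a (q₀, w.2)) * a (w.1, υ w) = (k : ℂ) := Complex.ext rfl (by simpa using him)
    have hn : (Complex.normSq (a (q₀, w.2)) : ℂ) ≠ 0 := by
      exact_mod_cast (Complex.normSq_pos.2 (ha0 w.2)).ne'
    have heq : a (w.1, υ w) = ((k / Complex.normSq (a (q₀, w.2)) : ℝ) : ℂ) * a (q₀, w.2) := by
      push_cast
      rw [div_mul_eq_mul_div, eq_div_iff hn, ← hkk, ← Complex.mul_conj]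
      ring
    have hc : 0 < k / Complex.normSq (a (q₀, w.2)) := div_pos hpos (Complex.normSq_pos.2 (ha0 w.2))
    change (‖a (w.1, υ w)‖)⁻¹ • a (w.1, υ w) - (‖a (q₀, w.2)‖)⁻¹ • a (q₀, w.2) = 0
    rw [heq, norm_mul, Complex.norm_real, Real.norm_of_nonneg hc.le, ← Complex.real_smul, smul_smul,
      mul_inv, mul_right_comm, inv_mul_cancel₀ hc.ne', one_mul, sub_self]
  obtain ⟨g, hg, hgs, hgγ⟩ := exists_homogeneous_parameter hγ hγ0 hd hinj himm
    (isCompact_Icc (a := -M) (b := M))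
  -- the cutoff
  have hgc : ContinuousOn (fun x => |g x|) euclSphere :=
    (hg.continuousOn.mono fun x hx => ne_zero_of_mem_euclSphere hx).abs
  have hA := (isCompact_curveCone_inter hγ.continuous hγ0 (isCompact_Icc (a := -M) (b := M))).isClosed
  have hgA : ∀ x ∈ curveCone γ (Set.Icc (-M) M), ∃ u ∈ Set.Icc (-M) M, ∃ c : ℝ, c ≠ 0 ∧
      x = c • γ u ∧ g x = u := by
    rintro x ⟨hx, u, hu, c, rfl⟩
    have hc : c ≠ 0 := by
      rintro rfl
      simp at hx
    exact ⟨u, hu, c, hc, rfl, by rw [hgs c hc, hgγ u hu]⟩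
  have hcl1 : IsClosed ({x | M + 1 ≤ |g x|} ∩ euclSphere) := by
    rw [Set.inter_comm]
    exact hgc.preimage_isClosed_of_isClosed isClosed_euclSphere isClosed_Ici
  have hcl2 : IsClosed ({x | |g x| ≤ M₁} ∩ euclSphere) := by
    rw [Set.inter_comm]
    exact hgc.preimage_isClosed_of_isClosed isClosed_euclSphere isClosed_Iic
  -- Besides `Z'`, the cutoff must kill the points with |g| ≥ M + 1, where `S` is not controlled,
  -- and the points of `Fc` with |g| ≤ M₁, where the ℂ-part of `S` need not vanish.
  obtain ⟨χ, hχ, hχs, hχ1, hχ0⟩ := exists_homogeneous_cutoff (curveCone γ (Set.Icc (-M) M))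
    (Z' ∪ ({x | x ≠ 0 ∧ M + 1 ≤ |g x|} ∪ {x | x ≠ 0 ∧ x ∈ Fc ∧ |g x| ≤ M₁})) hA (by
      have : (Z' ∪ ({x | x ≠ 0 ∧ M + 1 ≤ |g x|} ∪ {x | x ≠ 0 ∧ x ∈ Fc ∧ |g x| ≤ M₁})) ∩ euclSphere
        = (Z' ∩ euclSphere) ∪ (({x | M + 1 ≤ |g x|} ∩ euclSphere) ∪
          ((Fc ∩ euclSphere) ∩ ({x | |g x| ≤ M₁} ∩ euclSphere))) := by
        ext x
        have := @ne_zero_of_mem_euclSphere x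
        simp only [Set.mem_inter_iff, Set.mem_union, Set.mem_ofPred_eq]
        tauto
      rw [this]
      exact hZ'.union (hcl1.union (hFc.inter hcl2)))
    (by
      rw [Set.disjoint_left]
      intro x hx hxZ
      obtain ⟨u, hu, c, hc, rfl, hgx⟩ := hgA x hx
      have hcc : γ u = c⁻¹ • c • γ u := by rw [smul_smul, inv_mul_cancel₀ hc, one_smul]
      rcases hxZ with h | ⟨-, h⟩ | ⟨-, h, h'⟩
      · refine hAZ u hu ?_
        change γ u ∈ Z'
        rw [hcc]
        exact hZ's _ (inv_ne_zero hc) _ h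
      · rw [hgx] at h
        have := abs_le.2 hu
        linarith
      · rw [hgx] at h'
        have h2 : γ u ∈ Fc := by
          rw [hcc]
          exact hFcs _ (inv_ne_zero hc) _ h
        exact absurd (hAF u hu h2) (not_lt.2 h'))
    (fun c hc x hx => smul_mem_curveCone hc hx) (by
      rintro c hc x (h | ⟨h0, h⟩ | ⟨h0, h, h'⟩)
      · exact Or.inl (hZ's c hc x h)
      · exact Or.inr (Or.inl ⟨smul_ne_zero hc h0, by rw [hgs c hc]; exact h⟩)
      · exact Or.inr (Or.inr ⟨smul_ne_zero hc h0, hFcs c hc x h, by rw [hgs c hc]; exact h'⟩))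
  -- A factor of degree one that equals the norm of the ℂ-component at γ(u): both inner products
  -- there equal that norm. It undoes the normalisation in `R` and makes the field homogeneous.
  let ip : (Fin 5 → ℝ) → ℝ := fun x =>
    (inner ℝ (R (q₀, g x)).1 (e x).1 + inner ℝ (R (q₀, g x)).2 (e x).2) / 2
  have hip : ContDiffOn ℝ ∞ ip {0}ᶜ := by
    have h1 : ContDiffOn ℝ ∞ (fun x => R (q₀, g x)) {0}ᶜ :=
      hR.comp (contDiffOn_const.prodMk hg) fun x _ => ha0 (g x)
    have h2 : ContDiffOn ℝ ∞ e {0}ᶜ := e.contDiff.contDiffOn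
    exact ((h1.fst.inner ℝ h2.fst).add (h1.snd.inner ℝ h2.snd)).div_const 2
  let D : Y × (Fin 5 → ℝ) → ℂ × F := fun z => (χ z.2 * ip z.2) • S (z.1, g z.2)
  let OD : Set (Y × (Fin 5 → ℝ)) := {z | z.2 ≠ 0 ∧ (z.1, g z.2) ∈ OS} ∪ {z | z.2 ≠ 0 ∧ M + 1 < |g z.2|}
  have hDχ : ∀ q x, x ≠ 0 → M + 1 ≤ |g x| → D (q, x) = 0 := fun q x hx h => by
    simp [D, hχ0 x (Or.inr (Or.inl ⟨hx, h⟩)) hx]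
  have hne : IsOpen {z : Y × (Fin 5 → ℝ) | z.2 ≠ 0} := isOpen_ne_fun continuous_snd continuous_const
  have hgz : ContinuousOn (fun z : Y × (Fin 5 → ℝ) => g z.2) {z | z.2 ≠ 0} :=
    hg.continuousOn.comp continuousOn_snd fun z hz => hz
  have hOD1 : IsOpen {z : Y × (Fin 5 → ℝ) | z.2 ≠ 0 ∧ (z.1, g z.2) ∈ OS} :=
    (continuousOn_fst.prodMk hgz).isOpen_inter_preimage hne hOS
  have hOD2 : IsOpen {z : Y × (Fin 5 → ℝ) | z.2 ≠ 0 ∧ M + 1 < |g z.2|} :=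
    hgz.abs.isOpen_inter_preimage hne isOpen_Ioi
  refine ⟨D, OD, υ, OS, hOD1.union hOD2, ?_, ?_, ?_, ?_, ?_, ?_, hOS, ?_, hυs.mono Set.inter_subset_left,
    ?_, ?_⟩
  · intro x hx
    rcases lt_or_ge (M + 1) |g x| with h | h
    · exact Or.inr ⟨hx, h⟩
    · exact Or.inl ⟨hx, hOSC _ (by linarith)⟩
  · rintro z (hz | hz)
    · refine ContDiffAt.contDiffWithinAt ?_
      have h1 : ContDiffAt ℝ ∞ (fun z : Y × (Fin 5 → ℝ) => g z.2) z :=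
        (hg.contDiffAt (isOpen_compl_singleton.mem_nhds hz.1)).comp z contDiffAt_snd
      have h2 : ContDiffAt ℝ ∞ (fun z : Y × (Fin 5 → ℝ) => χ z.2) z :=
        (hχ.contDiffAt (isOpen_compl_singleton.mem_nhds hz.1)).comp z contDiffAt_snd
      have h3 : ContDiffAt ℝ ∞ (fun z : Y × (Fin 5 → ℝ) => ip z.2) z :=
        (hip.contDiffAt (isOpen_compl_singleton.mem_nhds hz.1)).comp z contDiffAt_snd
      exact (h2.mul h3).smul ((hS.contDiffAt (hOS.mem_nhds hz.2)).comp z (contDiffAt_fst.prodMk h1))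
    · refine ContDiffAt.contDiffWithinAt (ContDiffAt.congr_of_eventuallyEq (f := fun _ => 0)
        (by fun_prop) ?_)
      filter_upwards [hOD2.mem_nhds hz] with v hv using hDχ v.1 v.2 hv.1 hv.2.le
  · intro q c x
    rcases eq_or_ne c 0 with rfl | hc
    · simp [D, ip]
    · have h1 : ip (c • x) = c * ip x := by
        simp only [ip, hgs c hc, map_smul, Prod.smul_fst, Prod.smul_snd, real_inner_smul_right]
        ring
      simp only [D, h1, hχs c hc, hgs c hc, smul_smul]
      ring_nf
  · intro x
    rcases eq_or_ne x 0 with rfl | hx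
    · simp [D, ip]
    rcases le_or_gt (M + 1) |g x| with h | h
    · exact hDχ _ x hx h
    · simp [D, hS0 _ (show |g x| ≤ M + 2 by linarith)]
  · intro q x hx hx0
    simp [D, hχ0 x (Or.inl hx) hx0]
  · intro q x hx hxD hxF
    rcases hxD with h | h
    · rcases le_or_gt |g x| M₁ with h' | h'
      · simp [D, hχ0 x (Or.inr (Or.inr ⟨hx, hxF, h'⟩)) hx]
      · simp [D, hSm _ h.2 h'.le]
    · rw [hDχ q x hx h.2.le]; rfl
  · intro u hu
    exact hOSC u (by have := abs_le.2 hu; linarith)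
  · intro u hu
    exact hυq' u (by have := abs_le.2 hu; linarith)
  · intro q u hu hqu hq
    have h1 := hgγ u hu
    have h2 := hχ1 (γ u) (mem_curveCone hγ0 hu) (hγ0 u)
    have hau : 0 < ‖a (q₀, u)‖ := norm_pos_iff.2 (ha0 u)
    have h3 : ip (γ u) = ‖a (q₀, u)‖ := by
      have e1 : (e (γ u)).1 = a (q₀, u) := rfl
      have e2 : ‖(e (γ u)).2‖ = ‖a (q₀, u)‖ := hnorm _ (hγq u)
      simp only [ip, h1, R]
      change (inner ℝ (‖a (q₀, u)‖⁻¹ • (e (γ u)).1) _ + inner ℝ (‖a (q₀, u)‖⁻¹ • (e (γ u)).2) _) / 2 = _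
      rw [real_inner_smul_left, real_inner_smul_left, real_inner_self_eq_norm_sq,
        real_inner_self_eq_norm_sq, e2, e1]
      field_simp
      ring
    have hau' : 0 < ‖a (q, υ (q, u))‖ := norm_pos_iff.2 (hOSa _ hqu)
    refine ⟨‖a (q₀, u)‖ * ‖a (q, υ (q, u))‖⁻¹, by positivity, ?_⟩
    change e (γ u) + (χ (γ u) * ip (γ u)) • S (q, g (γ u)) = _
    rw [h1, h2, h3, one_mul]
    simp only [S, R, smul_sub, smul_smul, mul_inv_cancel₀ hau.ne', one_smul]
    abel

end

/-! ### Cones in ℝ⁵, neighbourhoods of a point of the quadric, rescaling -/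

noncomputable section

/-- A point of the quadric lies on the line spanned by `v`. -/
def Q32.On (x : Q32) (v : Fin 5 → ℝ) : Prop := ∃ c : ℝ, x.1.rep = c • v

theorem Q32.exists_mk_rep {w : Fin 5 → ℝ} (hw : w ≠ 0) (hq : form32 w = 0) :
    ∃ a : ℝ, a ≠ 0 ∧ (Q32.mk w hw hq).1.rep = a • w := by
  obtain ⟨a, ha⟩ := Projectivization.exists_smul_eq_mk_rep ℝ w hw
  exact ⟨a, a.ne_zero, by rw [Q32.mk, ← ha]; rfl⟩

theorem Q32.on_mk {w : Fin 5 → ℝ} (hw : w ≠ 0) (hq : form32 w = 0) {v : Fin 5 → ℝ} :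
    (Q32.mk w hw hq).On v ↔ ∃ c : ℝ, w = c • v := by
  obtain ⟨a, ha, h⟩ := Q32.exists_mk_rep hw hq
  rw [Q32.On, h]
  constructor
  · rintro ⟨c, hc⟩
    exact ⟨a⁻¹ * c, by rw [← smul_smul, ← hc, smul_smul, inv_mul_cancel₀ ha, one_smul]⟩
  · rintro ⟨c, rfl⟩
    exact ⟨a * c, by rw [smul_smul]⟩

/-- The subset of the quadric defined by a cone in `ℝ⁵`. -/
def coneSet (S : Set (Fin 5 → ℝ)) : Set Q32 := {x | x.1.rep ∈ S}

theorem mem_coneSet_mk {S : Set (Fin 5 → ℝ)} (hS : ∀ c : ℝ, c ≠ 0 → ∀ x ∈ S, c • x ∈ S)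
    {w : Fin 5 → ℝ} (hw : w ≠ 0) (hq : form32 w = 0) : Q32.mk w hw hq ∈ coneSet S ↔ w ∈ S := by
  obtain ⟨a, ha, h⟩ := Q32.exists_mk_rep hw hq
  change (Q32.mk w hw hq).1.rep ∈ S ↔ w ∈ S
  rw [h]
  refine ⟨fun h1 => ?_, hS a ha w⟩
  have := hS a⁻¹ (inv_ne_zero ha) _ h1
  rwa [smul_smul, inv_mul_cancel₀ ha, one_smul] at this

theorem isQuotientMap_projectivization_mk :
    Topology.IsQuotientMap (Projectivization.mk' ℝ : {v : Fin 5 → ℝ // v ≠ 0} → RP4) :=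
  isQuotientMap_quotient_mk'

theorem isOpen_coneSet {S : Set (Fin 5 → ℝ)} (hS : ∀ c : ℝ, c ≠ 0 → ∀ x ∈ S, c • x ∈ S)
    (hSo : IsOpen S) : IsOpen (coneSet S) := by
  have h1 : IsOpen {x : RP4 | x.rep ∈ S} := by
    rw [← isQuotientMap_projectivization_mk.isOpen_preimage]
    have : Projectivization.mk' ℝ ⁻¹' {x : RP4 | x.rep ∈ S} = Subtype.val ⁻¹' S := by
      ext ⟨v, hv⟩
      obtain ⟨a, ha⟩ := Projectivization.exists_smul_eq_mk_rep ℝ v hv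
      change (Projectivization.mk ℝ v hv).rep ∈ S ↔ v ∈ S
      rw [← ha, Units.smul_def]
      refine ⟨fun h => ?_, hS _ a.ne_zero v⟩
      have := hS _ (inv_ne_zero a.ne_zero) _ h
      rwa [smul_smul, inv_mul_cancel₀ a.ne_zero, one_smul] at this
    rw [this]
    exact hSo.preimage continuous_subtype_val
  exact h1.preimage continuous_subtype_val

theorem exists_open_cone_of_mem_nhds {p : Fin 5 → ℝ} (hp : p ≠ 0) (hpq : form32 p = 0)
    {U : Set Q32} (hU : U ∈ 𝓝 (Q32.mk p hp hpq)) :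
    ∃ W : Set (Fin 5 → ℝ), IsOpen W ∧ (∀ c : ℝ, c ≠ 0 → ∀ x ∈ W, c • x ∈ W) ∧ p ∈ W ∧
      ∀ (w : Fin 5 → ℝ) (hw : w ≠ 0) (hq : form32 w = 0), w ∈ W → Q32.mk w hw hq ∈ U := by
  obtain ⟨O, hOU, hO, hpO⟩ := mem_nhds_iff.1 hU
  obtain ⟨O', hO', rfl⟩ := isOpen_induced_iff.1 hO
  refine ⟨Subtype.val '' ((Projectivization.mk' ℝ : {v : Fin 5 → ℝ // v ≠ 0} → RP4) ⁻¹' O'), ?_, ?_,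
    ⟨⟨p, hp⟩, hpO, rfl⟩, ?_⟩
  · exact (IsOpen.isOpenMap_subtype_val isOpen_compl_singleton) _
      (hO'.preimage isQuotientMap_projectivization_mk.continuous)
  · rintro c hc _ ⟨⟨v, hv⟩, hvO, rfl⟩
    refine ⟨⟨c • v, smul_ne_zero hc hv⟩, ?_, rfl⟩
    have : Projectivization.mk ℝ (c • v) (smul_ne_zero hc hv) = Projectivization.mk ℝ v hv :=
      (Projectivization.mk_eq_mk_iff' ℝ _ _ _ _).2 ⟨c, rfl⟩
    change Projectivization.mk ℝ (c • v) _ ∈ O'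
    rw [this]
    exact hvO
  · rintro _ hw hq ⟨⟨w, hw'⟩, hwO, rfl⟩
    exact hOU hwO

/-- A function on `ℝ⁵ ∖ 0`, homogeneous of degree zero, that measures the distance of the spanned
line to the line spanned by `p`. -/
def projDist (p x : Fin 5 → ℝ) : ℝ :=
  min ‖x - (‖x‖ / ‖p‖) • p‖ ‖x + (‖x‖ / ‖p‖) • p‖ / ‖x‖

theorem projDist_smul (p : Fin 5 → ℝ) {c : ℝ} (hc : c ≠ 0) (x : Fin 5 → ℝ) :
    projDist p (c • x) = projDist p x := by
  have hc' : 0 < |c| := abs_pos.2 hc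
  have key : min ‖c • x - (‖c • x‖ / ‖p‖) • p‖ ‖c • x + (‖c • x‖ / ‖p‖) • p‖ =
      |c| * min ‖x - (‖x‖ / ‖p‖) • p‖ ‖x + (‖x‖ / ‖p‖) • p‖ := by
    rw [norm_smul, Real.norm_eq_abs, mul_div_assoc, ← smul_smul, mul_min_of_nonneg _ _ hc'.le]
    have e : ∀ v : Fin 5 → ℝ, |c| * ‖v‖ = ‖c • v‖ := fun v => by
      rw [norm_smul, Real.norm_eq_abs]
    rw [e, e, smul_sub, smul_add]
    rcases abs_choice c with h | h
    · rw [h]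
    · rw [h, neg_smul, sub_neg_eq_add, ← sub_eq_add_neg, min_comm]
  rw [projDist, key, norm_smul, Real.norm_eq_abs, mul_div_mul_left _ _ hc'.ne', projDist]

theorem continuousOn_projDist (p : Fin 5 → ℝ) : ContinuousOn (projDist p) {0}ᶜ := by
  unfold projDist
  exact ContinuousOn.div (by fun_prop) (by fun_prop) fun x hx => norm_ne_zero_iff.2 hx

theorem projDist_self {p : Fin 5 → ℝ} (hp : p ≠ 0) : projDist p p = 0 := by
  simp [projDist, div_self (norm_ne_zero_iff.2 hp)]

/-- After scaling to unit length with the right sign, x lies within δ of p/‖p‖, so these sets are a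
basis of conical neighbourhoods. The factor 3 leaves room for the nested shells ρ, 2ρ, 3ρ around the
boundary of V. -/
theorem exists_projDist_subset {p : Fin 5 → ℝ} (hp : p ≠ 0) {W : Set (Fin 5 → ℝ)} (hW : IsOpen W)
    (hWs : ∀ c : ℝ, c ≠ 0 → ∀ x ∈ W, c • x ∈ W) (hpW : p ∈ W) :
    ∃ ρ > 0, ∀ x, x ≠ 0 → projDist p x ≤ 3 * ρ → x ∈ W := by
  have hp' := norm_pos_iff.2 hp
  obtain ⟨δ, hδ, hball⟩ := Metric.isOpen_iff.1 hW _ (hWs (‖p‖⁻¹) (by positivity) p hpW)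
  refine ⟨δ / 6, by positivity, fun x hx h => ?_⟩
  have hx' := norm_pos_iff.2 hx
  have h2 : min ‖x - (‖x‖ / ‖p‖) • p‖ ‖x + (‖x‖ / ‖p‖) • p‖ < δ * ‖x‖ := by
    rw [projDist, div_le_iff₀ hx'] at h
    have : 0 < δ * ‖x‖ := by positivity
    linarith
  have key : ∀ s : ℝ, s ≠ 0 → |s| = 1 → ‖x - s • (‖x‖ / ‖p‖) • p‖ < δ * ‖x‖ → x ∈ W := by
    intro s hs hs1 h
    have hmem : (s⁻¹ * ‖x‖⁻¹) • x ∈ W := by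
      refine hball ?_
      rw [Metric.mem_ball, dist_eq_norm]
      have : (s⁻¹ * ‖x‖⁻¹) • x - ‖p‖⁻¹ • p = (s⁻¹ * ‖x‖⁻¹) • (x - s • (‖x‖ / ‖p‖) • p) := by
        rw [smul_sub, smul_smul, smul_smul]
        congr 2
        field_simp
      rw [this, norm_smul, norm_mul, norm_inv, norm_inv, norm_norm, Real.norm_eq_abs, hs1, inv_one,
        one_mul, inv_mul_lt_iff₀ hx', mul_comm]
      exact h
    have := hWs (s * ‖x‖) (by positivity) _ hmem
    rwa [smul_smul, show s * ‖x‖ * (s⁻¹ * ‖x‖⁻¹) = 1 by field_simp, one_smul] at this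
  rcases min_lt_iff.1 h2 with h | h
  · exact key 1 one_ne_zero abs_one (by rwa [one_smul])
  · exact key (-1) (by norm_num) (by norm_num) (by rwa [neg_smul, one_smul, sub_neg_eq_add])

/-- The vector of the length of `v` in the direction of `w`. -/
def rescale {E : Type*} [NormedAddCommGroup E] [NormedSpace ℝ E] (v w : E) : E :=
  (‖v‖ / ‖w‖) • w

theorem rescale_self {E : Type*} [NormedAddCommGroup E] [NormedSpace ℝ E] (v : E) :
    rescale v v = v := by
  rcases eq_or_ne v 0 with rfl | h
  · simp [rescale]
  · rw [rescale, div_self (norm_ne_zero_iff.2 h), one_smul]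

theorem rescale_smul {E : Type*} [NormedAddCommGroup E] [NormedSpace ℝ E] (c : ℝ) (v w : E) :
    rescale (c • v) (c • w) = c • rescale v w := by
  rcases eq_or_ne c 0 with rfl | h
  · simp [rescale]
  · rw [rescale, rescale, norm_smul, norm_smul, mul_div_mul_left _ _ (norm_ne_zero_iff.2 h),
      smul_comm]

theorem norm_rescale {E : Type*} [NormedAddCommGroup E] [NormedSpace ℝ E] {v w : E} (hw : w ≠ 0) :
    ‖rescale v w‖ = ‖v‖ := by
  have := norm_pos_iff.2 hw
  rw [rescale, norm_smul, norm_div, norm_norm, norm_norm, div_mul_cancel₀ _ this.ne']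

/-- Used with the imaginary and real parts of the ℂ-component of a curve as `f` and `g`: it yields
the slope of a sector that misses the curve on a compact shell. -/
theorem exists_pos_mul_lt_of_isCompact {C : Set ℝ} (hC : IsCompact C) {f g : ℝ → ℝ}
    (hf : Continuous f) (hg : Continuous g) (h : ∀ u ∈ C, f u ≠ 0) :
    ∃ r > 0, ∀ r' ≤ r, ∀ u ∈ C, r' * |g u| < |f u| := by
  rcases C.eq_empty_or_nonempty with rfl | hne
  · exact ⟨1, one_pos, by simp⟩
  obtain ⟨u₀, hu₀, hmin⟩ := hC.exists_isMinOn hne hf.abs.continuousOn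
  obtain ⟨u₁, hu₁, hmax⟩ := hC.exists_isMaxOn hne hg.abs.continuousOn
  have h0 : 0 < |f u₀| := abs_pos.2 (h u₀ hu₀)
  have h1 : 0 < |g u₁| + 1 := by positivity
  refine ⟨|f u₀| / (|g u₁| + 1), by positivity, fun r' hr' u hu => ?_⟩
  calc r' * |g u| ≤ |f u₀| / (|g u₁| + 1) * |g u₁| :=
        mul_le_mul hr' (hmax hu) (abs_nonneg _) (by positivity)
    _ < |f u₀| := by
        rw [div_mul_eq_mul_div, div_lt_iff₀ h1]
        nlinarith
    _ ≤ |f u| := hmin hu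

end

/-! ### Displacing and restoring norms -/

noncomputable section

variable {F : Type*} [NormedAddCommGroup F] [InnerProductSpace ℝ F]

/-- The map of `ℝ⁵ = ℂ × F` that moves `x` in the direction of `D (q, x)` and restores the norms of
the two components. -/
def displace {Y : Type*} (e : (Fin 5 → ℝ) ≃L[ℝ] ℂ × F) (D : Y × (Fin 5 → ℝ) → ℂ × F)
    (z : Y × ℝ × (Fin 5 → ℝ)) : Fin 5 → ℝ :=
  e.symm (rescale (e z.2.2).1 ((e z.2.2).1 + z.2.1 • (D (z.1, z.2.2)).1),
    rescale (e z.2.2).2 ((e z.2.2).2 + z.2.1 • (D (z.1, z.2.2)).2))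

theorem displace_of_eq_zero {Y : Type*} (e : (Fin 5 → ℝ) ≃L[ℝ] ℂ × F) {D : Y × (Fin 5 → ℝ) → ℂ × F}
    {q : Y} {x : Fin 5 → ℝ} (h : D (q, x) = 0) (t : ℝ) : displace e D (q, t, x) = x := by
  simp [displace, h, rescale_self]

theorem fst_displace_of_eq_zero {Y : Type*} (e : (Fin 5 → ℝ) ≃L[ℝ] ℂ × F)
    {D : Y × (Fin 5 → ℝ) → ℂ × F} {q : Y} {x : Fin 5 → ℝ} (h : (D (q, x)).1 = 0) (t : ℝ) :
    (e (displace e D (q, t, x))).1 = (e x).1 := by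
  simp [displace, h, rescale_self]

theorem displace_smul {Y : Type*} (e : (Fin 5 → ℝ) ≃L[ℝ] ℂ × F) {D : Y × (Fin 5 → ℝ) → ℂ × F}
    (hom : ∀ q (c : ℝ) x, D (q, c • x) = c • D (q, x)) (q : Y) (t c : ℝ) (x : Fin 5 → ℝ) :
    displace e D (q, t, c • x) = c • displace e D (q, t, x) := by
  simp only [displace, hom, map_smul, Prod.smul_fst, Prod.smul_snd]
  rw [smul_comm t c (D (q, x)).1, smul_comm t c (D (q, x)).2, ← smul_add, ← smul_add,
    rescale_smul, rescale_smul, ← map_smul]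
  rfl

/-- The open set of parameters on which `displace e D` is well behaved. -/
def displaceDomain {Y : Type*} (e : (Fin 5 → ℝ) ≃L[ℝ] ℂ × F) (D : Y × (Fin 5 → ℝ) → ℂ × F)
    (OD : Set (Y × (Fin 5 → ℝ))) : Set (Y × ℝ × (Fin 5 → ℝ)) :=
  {z | (z.1, z.2.2) ∈ OD ∧ ((e z.2.2).1 ≠ 0 ∧ (e z.2.2).2 ≠ 0 ∧
      (e z.2.2).1 + z.2.1 • (D (z.1, z.2.2)).1 ≠ 0 ∧ (e z.2.2).2 + z.2.1 • (D (z.1, z.2.2)).2 ≠ 0)} ∪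
  -- Here a component may vanish, and `rescale` is not smooth. This region is far from the quadric,
  -- where the norms agree, and the fields used later vanish on it, so that the map is the identity
  -- there.
  {z | z.2.2 ≠ 0 ∧ (2 * ‖(e z.2.2).1‖ < ‖(e z.2.2).2‖ ∨ 2 * ‖(e z.2.2).2‖ < ‖(e z.2.2).1‖)}

section

variable {Y : Type*} [NormedAddCommGroup Y] [NormedSpace ℝ Y]
  {e : (Fin 5 → ℝ) ≃L[ℝ] ℂ × F} {D : Y × (Fin 5 → ℝ) → ℂ × F} {OD : Set (Y × (Fin 5 → ℝ))}

theorem isOpen_displaceDomain_aux₁ (hOD : IsOpen OD) (hD : ContDiffOn ℝ ∞ D OD) :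
    IsOpen {z : Y × ℝ × (Fin 5 → ℝ) | (z.1, z.2.2) ∈ OD ∧ ((e z.2.2).1 ≠ 0 ∧ (e z.2.2).2 ≠ 0 ∧
      (e z.2.2).1 + z.2.1 • (D (z.1, z.2.2)).1 ≠ 0 ∧
      (e z.2.2).2 + z.2.1 • (D (z.1, z.2.2)).2 ≠ 0)} := by
  let s : Set (Y × ℝ × (Fin 5 → ℝ)) := {z | (z.1, z.2.2) ∈ OD}
  have hs : IsOpen s := hOD.preimage (by fun_prop)
  have hDs : ContinuousOn (fun z : Y × ℝ × (Fin 5 → ℝ) => D (z.1, z.2.2)) s :=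
    hD.continuousOn.comp (by fun_prop) fun z hz => hz
  have he : ContinuousOn (fun z : Y × ℝ × (Fin 5 → ℝ) => e z.2.2) s :=
    (e.continuous.comp (continuous_snd.comp continuous_snd)).continuousOn
  have ht : ContinuousOn (fun z : Y × ℝ × (Fin 5 → ℝ) => z.2.1) s := by fun_prop
  have h := (he.fst.prodMk (he.snd.prodMk ((he.fst.add (ht.smul hDs.fst)).prodMk
    (he.snd.add (ht.smul hDs.snd))))).isOpen_inter_preimage hs
    (t := {w : ℂ × F × ℂ × F | w.1 ≠ 0 ∧ w.2.1 ≠ 0 ∧ w.2.2.1 ≠ 0 ∧ w.2.2.2 ≠ 0}) (by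
      refine IsOpen.inter (isOpen_ne_fun (by fun_prop) (by fun_prop)) (IsOpen.inter
        (isOpen_ne_fun (by fun_prop) (by fun_prop)) (IsOpen.inter
        (isOpen_ne_fun (by fun_prop) (by fun_prop)) (isOpen_ne_fun (by fun_prop) (by fun_prop)))))
  exact h

omit [NormedSpace ℝ Y] in
theorem isOpen_displaceDomain_aux₂ :
    IsOpen {z : Y × ℝ × (Fin 5 → ℝ) | z.2.2 ≠ 0 ∧
      (2 * ‖(e z.2.2).1‖ < ‖(e z.2.2).2‖ ∨ 2 * ‖(e z.2.2).2‖ < ‖(e z.2.2).1‖)} := by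
  have he : Continuous (fun z : Y × ℝ × (Fin 5 → ℝ) => e z.2.2) :=
    e.continuous.comp (continuous_snd.comp continuous_snd)
  have h1 := continuous_const.mul (f := fun _ => (2 : ℝ)) he.fst.norm
  have h2 := continuous_const.mul (f := fun _ => (2 : ℝ)) he.snd.norm
  have h0 : IsOpen {z : Y × ℝ × (Fin 5 → ℝ) | z.2.2 ≠ 0} :=
    isOpen_ne_fun (continuous_snd.comp continuous_snd) continuous_const
  exact h0.inter ((isOpen_lt h1 he.snd.norm).union (isOpen_lt h2 he.fst.norm))

theorem isOpen_displaceDomain (hOD : IsOpen OD) (hD : ContDiffOn ℝ ∞ D OD) :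
    IsOpen (displaceDomain e D OD) :=
  (isOpen_displaceDomain_aux₁ hOD hD).union isOpen_displaceDomain_aux₂

theorem ContDiffAt.rescale {E E' : Type*} [NormedAddCommGroup E] [NormedSpace ℝ E]
    [NormedAddCommGroup E'] [InnerProductSpace ℝ E'] {v w : E → E'} {x : E}
    (hv : ContDiffAt ℝ ∞ v x) (hw : ContDiffAt ℝ ∞ w x) (hv0 : v x ≠ 0) (hw0 : w x ≠ 0) :
    ContDiffAt ℝ ∞ (fun y => _root_.rescale (v y) (w y)) x :=
  ((hv.norm ℝ hv0).div (hw.norm ℝ hw0) (norm_ne_zero_iff.2 hw0)).smul hw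

theorem contDiffOn_displace (hOD : IsOpen OD) (hD : ContDiffOn ℝ ∞ D OD)
    (hdeg : ∀ q x, x ≠ 0 → 2 * ‖(e x).1‖ < ‖(e x).2‖ ∨ 2 * ‖(e x).2‖ < ‖(e x).1‖ → D (q, x) = 0) :
    ContDiffOn ℝ ∞ (displace e D) (displaceDomain e D OD) := by
  rintro z (⟨hz, h1, h2, h3, h4⟩ | hz)
  · refine ContDiffAt.contDiffWithinAt ?_
    have hDz : ContDiffAt ℝ ∞ (fun z : Y × ℝ × (Fin 5 → ℝ) => D (z.1, z.2.2)) z :=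
      ContDiffAt.comp z (hD.contDiffAt (hOD.mem_nhds hz)) (by fun_prop)
    have hez : ContDiffAt ℝ ∞ (fun z : Y × ℝ × (Fin 5 → ℝ) => e z.2.2) z :=
      (e.contDiff.comp (contDiff_snd.comp contDiff_snd)).contDiffAt
    have ht : ContDiffAt ℝ ∞ (fun z : Y × ℝ × (Fin 5 → ℝ) => z.2.1) z := by fun_prop
    exact e.symm.contDiff.contDiffAt.comp z
      ((hez.fst.rescale (hez.fst.add (ht.smul hDz.fst)) h1 h3).prodMk
        (hez.snd.rescale (hez.snd.add (ht.smul hDz.snd)) h2 h4))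
  · refine ContDiffAt.contDiffWithinAt (ContDiffAt.congr_of_eventuallyEq (f := fun z => z.2.2)
      (by fun_prop) ?_)
    filter_upwards [isOpen_displaceDomain_aux₂.mem_nhds hz] with w hw
    exact displace_of_eq_zero e (hdeg w.1 w.2.2 hw.1 hw.2) w.2.1

omit [NormedAddCommGroup Y] [NormedSpace ℝ Y] in
theorem mem_displaceDomain {q₀ : Y} (hq₀ : ∀ x, x ≠ 0 → (q₀, x) ∈ OD) (hDq : ∀ x, D (q₀, x) = 0)
    (t : ℝ) {x : Fin 5 → ℝ} (hx : x ≠ 0) : (q₀, t, x) ∈ displaceDomain e D OD := by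
  have hex : e x ≠ 0 := fun h => hx (e.injective (by rw [h, map_zero]))
  by_cases h : (e x).1 ≠ 0 ∧ (e x).2 ≠ 0
  · left
    refine ⟨hq₀ x hx, h.1, h.2, ?_, ?_⟩ <;> simp [hDq, h.1, h.2]
  · right
    refine ⟨hx, ?_⟩
    simp only
    rcases eq_or_ne (e x).1 0 with h1 | h1
    · have h2 : (e x).2 ≠ 0 := fun h2 => hex (Prod.ext h1 h2)
      left
      rw [h1, norm_zero, mul_zero]
      exact norm_pos_iff.2 h2
    · have h2 : (e x).2 = 0 := by
        by_contra h2
        exact h ⟨h1, h2⟩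
      right
      rw [h2, norm_zero, mul_zero]
      exact norm_pos_iff.2 h1

omit [NormedAddCommGroup Y] [NormedSpace ℝ Y] in
theorem form32_displace (he : ∀ x, form32 x = ‖(e x).2‖ ^ 2 - ‖(e x).1‖ ^ 2)
    (hdeg : ∀ q x, x ≠ 0 → 2 * ‖(e x).1‖ < ‖(e x).2‖ ∨ 2 * ‖(e x).2‖ < ‖(e x).1‖ → D (q, x) = 0)
    (q : Y) (t : ℝ) (x : Fin 5 → ℝ) (h : (q, t, x) ∈ displaceDomain e D OD) :
    form32 (displace e D (q, t, x)) = form32 x := by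
  rcases h with ⟨-, -, -, h3, h4⟩ | hz
  · rw [he, he]
    simp only [displace, ContinuousLinearEquiv.apply_symm_apply]
    rw [norm_rescale h3, norm_rescale h4]
  · rw [displace_of_eq_zero e (hdeg q x hz.1 hz.2) t]

/-- `displace e D (q, ·)` is uniformly close to the identity for `q` near `q₀`. -/
theorem eventually_displace_mem (hOD : IsOpen OD) {q₀ : Y} (hq₀ : ∀ x, x ≠ 0 → (q₀, x) ∈ OD)
    (hD : ContDiffOn ℝ ∞ D OD) (hom : ∀ q (c : ℝ) x, D (q, c • x) = c • D (q, x))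
    (hDq : ∀ x, D (q₀, x) = 0)
    (hdeg : ∀ q x, x ≠ 0 → 2 * ‖(e x).1‖ < ‖(e x).2‖ ∨ 2 * ‖(e x).2‖ < ‖(e x).1‖ → D (q, x) = 0)
    {B W : Set (Fin 5 → ℝ)} (hB : IsClosed (B ∩ euclSphere))
    (hBs : ∀ c : ℝ, c ≠ 0 → ∀ x ∈ B, c • x ∈ B) (hW : IsOpen W)
    (hWs : ∀ c : ℝ, c ≠ 0 → ∀ x ∈ W, c • x ∈ W) (hBW : ∀ x ∈ B, x ≠ 0 → x ∈ W) :
    ∀ᶠ q in 𝓝 q₀, ∀ t : I, ∀ x ∈ B, x ≠ 0 → displace e D (q, t, x) ∈ W := by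
  have hK : IsCompact (B ∩ euclSphere) :=
    isCompact_euclSphere.of_isClosed_subset hB Set.inter_subset_right
  have hop : IsOpen (displaceDomain e D OD ∩ displace e D ⁻¹' W) :=
    (contDiffOn_displace hOD hD hdeg).continuousOn.isOpen_inter_preimage
      (isOpen_displaceDomain hOD hD) hW
  -- At q₀ the map is the identity at all times, so compactness of [0,1] × (B ∩ sphere) gives
  -- uniform control for q near q₀; homogeneity extends it to the cone.
  obtain ⟨u, v, hu, -, hqu, hKv, huv⟩ := generalized_tube_lemma (s := {q₀}) isCompact_singleton
    ((isCompact_Icc (a := (0 : ℝ)) (b := 1)).prod hK) hop (by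
      rintro ⟨q, t, x⟩ ⟨hq, -, hx⟩
      obtain rfl : q = q₀ := hq
      have hx0 := ne_zero_of_mem_euclSphere hx.2
      refine ⟨mem_displaceDomain hq₀ hDq t hx0, ?_⟩
      change displace e D (q, t, x) ∈ W
      rw [displace_of_eq_zero e (hDq x)]
      exact hBW x hx.1 hx0)
  filter_upwards [hu.mem_nhds (hqu rfl)] with q hq t x hx hx0
  have hn := euclNorm_pos hx0
  have h1 : (q, (t : ℝ), (euclNorm x)⁻¹ • x) ∈ displaceDomain e D OD ∩ displace e D ⁻¹' W := by
    refine huv ⟨hq, hKv ⟨t.2, hBs _ (by positivity) x hx, ?_⟩⟩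
    change euclNorm _ = 1
    rw [euclNorm_smul, abs_of_pos (by positivity), inv_mul_cancel₀ hn.ne']
  have h2 : displace e D (q, (t : ℝ), (euclNorm x)⁻¹ • x) ∈ W := h1.2
  rw [displace_smul e hom] at h2
  have h3 := hWs _ hn.ne' _ h2
  rwa [smul_smul, mul_inv_cancel₀ hn.ne', one_smul] at h3

theorem eventually_displace_isotopy (he : ∀ x, form32 x = ‖(e x).2‖ ^ 2 - ‖(e x).1‖ ^ 2)
    (hOD : IsOpen OD) {q₀ : Y} (hq₀ : ∀ x, x ≠ 0 → (q₀, x) ∈ OD)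
    (hD : ContDiffOn ℝ ∞ D OD) (hom : ∀ q (c : ℝ) x, D (q, c • x) = c • D (q, x))
    (hDq : ∀ x, D (q₀, x) = 0)
    (hdeg : ∀ q x, x ≠ 0 → 2 * ‖(e x).1‖ < ‖(e x).2‖ ∨ 2 * ‖(e x).2‖ < ‖(e x).1‖ → D (q, x) = 0) :
    ∀ᶠ q in 𝓝 q₀, ∃ H : AmbientIsotopy, ∀ (t : I) (x : Fin 5 → ℝ) (hx : x ≠ 0)
      (hq : form32 x = 0), ∃ (hy : displace e D (q, t, x) ≠ 0)
        (hqy : form32 (displace e D (q, t, x)) = 0),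
        H.toEquiv t (Q32.mk x hx hq) = Q32.mk (displace e D (q, t, x)) hy hqy :=
  eventually_exists_ambientIsotopy q₀ (displace e D) (displaceDomain e D OD)
    (isOpen_displaceDomain hOD hD) (fun t _ x hx => mem_displaceDomain hq₀ hDq t hx)
    (contDiffOn_displace hOD hD hdeg) (displace_smul e hom)
    (fun q x => by simp [displace, rescale_self]) (fun t x => displace_of_eq_zero e (hDq x) t)
    fun q t x h => by rw [form32_displace he hdeg q t x h]

end

end

/-! ### Isotopy outside an invariant neighbourhood -/

noncomputable section

variable {F : Type*} [NormedAddCommGroup F] [InnerProductSpace ℝ F]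

/-- The cone of vectors whose distance to the line of `p` and coordinates satisfy a condition. -/
def regionCone (p : Fin 5 → ℝ) (e : (Fin 5 → ℝ) ≃L[ℝ] ℂ × F) (T : Set (ℝ × ℂ × F)) :
    Set (Fin 5 → ℝ) := {x | x ≠ 0 ∧ (projDist p x, e x) ∈ T}

section

variable {p : Fin 5 → ℝ} {e : (Fin 5 → ℝ) ≃L[ℝ] ℂ × F} {T : Set (ℝ × ℂ × F)}

theorem smul_mem_regionCone (hT : ∀ c : ℝ, c ≠ 0 → ∀ w ∈ T, (w.1, c • w.2) ∈ T) (c : ℝ) (hc : c ≠ 0)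
    (x : Fin 5 → ℝ) (hx : x ∈ regionCone p e T) : c • x ∈ regionCone p e T :=
  ⟨smul_ne_zero hc hx.1, by rw [projDist_smul p hc, map_smul]; exact hT c hc _ hx.2⟩

theorem continuousOn_region : ContinuousOn (fun x => (projDist p x, e x)) {0}ᶜ :=
  (continuousOn_projDist p).prodMk e.continuous.continuousOn

theorem isOpen_regionCone (hT : IsOpen T) : IsOpen (regionCone p e T) :=
  continuousOn_region.isOpen_inter_preimage isOpen_compl_singleton hT

theorem isClosed_regionCone_inter (hT : IsClosed T) :
    IsClosed (regionCone p e T ∩ euclSphere) := by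
  have h : regionCone p e T ∩ euclSphere =
      euclSphere ∩ (fun x => (projDist p x, e x)) ⁻¹' T := by
    ext x
    exact ⟨fun h => ⟨h.2, h.1.2⟩, fun h => ⟨⟨ne_zero_of_mem_euclSphere h.1, h.2⟩, h.1⟩⟩
  rw [h]
  exact (continuousOn_region.mono fun x hx => ne_zero_of_mem_euclSphere hx).preimage_isClosed_of_isClosed
    isClosed_euclSphere hT

end

theorem isOpen_compl_curveCone {γ : ℝ → Fin 5 → ℝ} (hγ : Continuous γ)
    (hγ0 : ∀ u, γ u ≠ 0) {C : Set ℝ} (hC : IsCompact C) :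
    IsOpen {x | x ≠ 0 ∧ x ∉ curveCone γ C} := by
  have h1 : ContinuousOn (fun x => (euclNorm x)⁻¹ • x) ({0}ᶜ : Set (Fin 5 → ℝ)) :=
    (contDiffOn_euclNorm.continuousOn.inv₀ fun x hx => (euclNorm_pos hx).ne').smul continuousOn_id
  have h2 := h1.isOpen_inter_preimage isOpen_compl_singleton
    (isCompact_curveCone_inter hγ hγ0 hC).isClosed.isOpen_compl
  convert h2 using 1
  ext x
  refine and_congr_right fun (hx : x ≠ 0) => not_congr ?_
  have hn := euclNorm_pos hx
  constructor
  · intro h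
    refine ⟨smul_mem_curveCone (inv_ne_zero hn.ne') h, ?_⟩
    change euclNorm _ = 1
    rw [euclNorm_smul, abs_of_pos (by positivity), inv_mul_cancel₀ hn.ne']
  · rintro ⟨h, -⟩
    have := smul_mem_curveCone hn.ne' h
    rwa [smul_smul, mul_inv_cancel₀ hn.ne', one_smul] at this

theorem exists_abs_bound_of_mem_cocompact {s : Set ℝ} (hs : s ∈ Filter.cocompact ℝ) :
    ∃ b : ℝ, ∀ u, b ≤ |u| → u ∈ s := by
  obtain ⟨K, hK, hKs⟩ := Filter.mem_cocompact.1 hs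
  obtain ⟨b, hb⟩ := hK.isBounded.exists_norm_le
  refine ⟨b + 1, fun u hu => hKs fun h => ?_⟩
  have := hb u h
  rw [Real.norm_eq_abs] at this
  linarith

theorem smul_im_re_ineq {c : ℝ} (hc : c ≠ 0) (z : ℂ) :
    |(c • z).im| = |c| * |z.im| ∧ |(c • z).re| = |c| * |z.re| ∧ 0 < |c| := by
  simp [abs_mul, hc]

/-- At time 1 the point of γᵢ at u goes to the point of Γᵢ at υᵢ(u). Points of γᵢ outside `S` have
|u| + 1 ≤ L, so a shift of the parameter by less than 1 keeps them in [-L, L]; conversely every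
parameter in [-L, L] is hit. -/
theorem isotopicOutside_of_matching {S : Set (Fin 5 → ℝ)} (hSs : ∀ c : ℝ, c ≠ 0 → ∀ x ∈ S, c • x ∈ S)
    {H : AmbientIsotopy} {G : ℝ → (Fin 5 → ℝ) → Fin 5 → ℝ}
    (hH : ∀ (t : I) (x : Fin 5 → ℝ) (hx : x ≠ 0) (hq : form32 x = 0),
      ∃ (hy : G t x ≠ 0) (hqy : form32 (G t x) = 0),
        H.toEquiv t (Q32.mk x hx hq) = Q32.mk (G t x) hy hqy)
    (hS : ∀ (t : I) (x : Fin 5 → ℝ), x ≠ 0 → form32 x = 0 → (G t x ∈ S ↔ x ∈ S))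
    {ι : Type*} {γ Γ : ι → ℝ → Fin 5 → ℝ} {υ : ι → ℝ → ℝ} {p : Fin 5 → ℝ} (hp : p ∈ S)
    (hγ0 : ∀ i u, γ i u ≠ 0) (hγq : ∀ i u, form32 (γ i u) = 0) {L : ℝ}
    (hbL : ∀ i u, γ i u ∉ S → |u| + 1 ≤ L)
    (hυ : ∀ i, ContinuousOn (υ i) (Set.Icc (-(L + 1)) (L + 1)))
    (hυ1 : ∀ i, ∀ u ∈ Set.Icc (-(L + 1)) (L + 1), |υ i u - u| < 1)
    (hm : ∀ i, ∀ u ∈ Set.Icc (-(L + 1)) (L + 1), ∃ k : ℝ, k ≠ 0 ∧ G 1 (γ i u) = k • Γ i (υ i u))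
    {K : Set Q32}
    (hK : ∀ x, x ∉ coneSet S → (x ∈ K ↔ ∃ i, ∃ u ∈ Set.Icc (-L) L, x.On (Γ i u))) :
    IsotopicOutside (coneSet S) {x | x.On p ∨ ∃ i u, x.On (γ i u)} K := by
  have hmemV : ∀ t x, H.toEquiv t x ∈ coneSet S ↔ x ∈ coneSet S := by
    intro t x
    obtain ⟨v, hv, hq, rfl⟩ := x.exists_rep
    obtain ⟨hy, hqy, h⟩ := hH t v hv hq
    rw [h, mem_coneSet_mk hSs, mem_coneSet_mk hSs, hS t v hv hq]
  have hV : ∀ t, H.toEquiv t '' coneSet S = coneSet S := by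
    intro t
    ext x
    constructor
    · rintro ⟨y, hy, rfl⟩
      exact (hmemV t y).2 hy
    · intro hx
      refine ⟨(H.toEquiv t).symm x, (hmemV t _).1 ?_, ?_⟩ <;> simp [hx]
  have hG1 : ∀ i, ∀ u ∈ Set.Icc (-(L + 1)) (L + 1), ∀ x : Q32, x.On (Γ i (υ i u)) →
      x = H.toEquiv 1 (Q32.mk (γ i u) (hγ0 i u) (hγq i u)) := by
    intro i u hu x hx
    obtain ⟨v, hv, hq, rfl⟩ := x.exists_rep
    obtain ⟨c, hc⟩ := (Q32.on_mk hv hq).1 hx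
    obtain ⟨hy, hqy, h⟩ := hH 1 (γ i u) (hγ0 i u) (hγq i u)
    obtain ⟨k, hk, hGk⟩ := hm i u hu
    have hGk' : G ((1 : I) : ℝ) (γ i u) = k • Γ i (υ i u) := by simpa using hGk
    rw [h, Q32.mk_eq_mk_iff]
    have hc0 : c ≠ 0 := by
      rintro rfl
      simp [hc] at hv
    refine ⟨c * k⁻¹, mul_ne_zero hc0 (inv_ne_zero hk), ?_⟩
    rw [hGk', hc, smul_smul, mul_assoc, inv_mul_cancel₀ hk, mul_one]
  refine ⟨H, hV, ?_⟩
  ext x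
  constructor
  · rintro ⟨y, ⟨hy, hyV⟩, rfl⟩
    refine ⟨?_, fun h => hyV ((hmemV 1 y).1 h)⟩
    rw [hK _ fun h => hyV ((hmemV 1 y).1 h)]
    obtain ⟨v, hv, hq, rfl⟩ := y.exists_rep
    rw [mem_coneSet_mk hSs] at hyV
    have hc0 : ∀ (c : ℝ) w, v = c • w → c ≠ 0 := by
      rintro c w rfl rfl
      simp at hv
    rcases hy with hy | ⟨i, u, hy⟩
    · obtain ⟨c, hc⟩ := (Q32.on_mk hv hq).1 hy
      exact absurd (hc ▸ hSs c (hc0 c p hc) p hp) hyV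
    · obtain ⟨c, hc⟩ := (Q32.on_mk hv hq).1 hy
      have huS : γ i u ∉ S := fun h => hyV (hc ▸ hSs c (hc0 c _ hc) _ h)
      have huL := hbL i u huS
      have hu : u ∈ Set.Icc (-(L + 1)) (L + 1) := abs_le.1 (by linarith)
      refine ⟨i, υ i u, abs_le.1 ?_, ?_⟩
      · have h1 := hυ1 i u hu
        have h2 := abs_sub_abs_le_abs_sub (υ i u) u
        linarith
      · have : Q32.mk v hv hq = Q32.mk (γ i u) (hγ0 i u) (hγq i u) :=
          Q32.mk_eq_mk_iff.2 ⟨c, hc0 c _ hc, hc.symm⟩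
        obtain ⟨hy, hqy, h⟩ := hH 1 (γ i u) (hγ0 i u) (hγq i u)
        obtain ⟨k, hk, hGk⟩ := hm i u hu
        rw [this, h, Q32.on_mk]
        exact ⟨k, by simpa using hGk⟩
  · rintro ⟨hx, hxV⟩
    obtain ⟨i, w, hw, hxw⟩ := (hK x hxV).1 hx
    have hL : 0 ≤ L := by linarith [hw.1, hw.2]
    have hle : -(L + 1) ≤ L + 1 := by linarith
    have h1 := abs_lt.1 (hυ1 i (-(L + 1)) ⟨le_rfl, hle⟩)
    have h2 := abs_lt.1 (hυ1 i (L + 1) ⟨hle, le_rfl⟩)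
    -- Since |υ - id| < 1, the endpoints ±(L + 1) are sent beyond ±L.
    obtain ⟨u, hu, rfl⟩ := intermediate_value_Icc hle (hυ i)
      (show w ∈ Set.Icc _ _ from ⟨by linarith [hw.1], by linarith [hw.2]⟩)
    have := hG1 i u hu x hxw
    refine ⟨_, ⟨?_, ?_⟩, this.symm⟩
    · exact Or.inr ⟨i, u, (Q32.on_mk _ _).2 ⟨1, by simp⟩⟩
    · rwa [← hmemV 1, ← this]

theorem euclNorm_inv_smul_mem {x : Fin 5 → ℝ} (hx : x ≠ 0) : (euclNorm x)⁻¹ • x ∈ euclSphere := by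
  have hn := euclNorm_pos hx
  change euclNorm _ = 1
  rw [euclNorm_smul, abs_of_pos (by positivity), inv_mul_cancel₀ hn.ne']

set_option maxHeartbeats 1000000 in
/-- Two embedded curves on the quadric through a common point `p`, given by parametrisations of
their complements of `p`, are isotopic outside a neighbourhood of `p` to any closed set that is, away
from that neighbourhood, parametrised by small perturbations of these parametrisations. -/
theorem eventually_isotopicOutside {Y : Type*} [NormedAddCommGroup Y] [NormedSpace ℝ Y]
    [CompleteSpace Y]
    (e : (Fin 5 → ℝ) ≃L[ℝ] ℂ × F) (he : ∀ x, form32 x = ‖(e x).2‖ ^ 2 - ‖(e x).1‖ ^ 2)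
    {p : Fin 5 → ℝ} (hp0 : p ≠ 0) (hpq : form32 p = 0) (hpre : (e p).1.re ≠ 0)
    (hpim : (e p).1.im = 0)
    (q₀ : Y) (Γ : Fin 2 → Y × ℝ → Fin 5 → ℝ) (hΓ : ∀ i, ContDiff ℝ ∞ (Γ i))
    (hγ0 : ∀ i u, Γ i (q₀, u) ≠ 0) (hγq : ∀ i u, form32 (Γ i (q₀, u)) = 0)
    (hinj : ∀ i u v, ∀ c : ℝ, Γ i (q₀, u) = c • Γ i (q₀, v) → u = v)
    (hdisj : ∀ i j, i ≠ j → ∀ u v, ∀ c : ℝ, Γ i (q₀, u) ≠ c • Γ j (q₀, v))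
    (hlim : ∀ i, Filter.Tendsto (fun u => projDist p (Γ i (q₀, u))) (Filter.cocompact ℝ) (𝓝 0))
    (hpγ : ∀ i u, ∀ c : ℝ, p ≠ c • Γ i (q₀, u))
    {γ' : Fin 2 → ℝ → Fin 5 → ℝ} (hd : ∀ i u, HasDerivAt (fun u => Γ i (q₀, u)) (γ' i u) u)
    (himm : ∀ i u, ∀ c : ℝ, γ' i u ≠ c • Γ i (q₀, u))
    {M₀ : ℝ} (hM₀ : 0 < M₀)
    (hang : ∀ i u, M₀ ≤ |u| → ((starRingEnd ℂ) (e (Γ i (q₀, u))).1 * (e (γ' i u)).1).im ≠ 0)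
    (him : ∀ i u, M₀ ≤ |u| → (e (Γ i (q₀, u))).1.im ≠ 0)
    {U : Set Q32} (hU : U ∈ 𝓝 (Q32.mk p hp0 hpq)) :
    ∃ W : Set (Fin 5 → ℝ), IsOpen W ∧ (∀ c : ℝ, c ≠ 0 → ∀ x ∈ W, c • x ∈ W) ∧ p ∈ W ∧
      coneSet W ⊆ U ∧ ∃ L₀ : ℝ, ∀ L ≥ L₀, ∀ᶠ q in 𝓝 q₀, (∀ i u, form32 (Γ i (q, u)) = 0) →
        ∀ K : Set Q32, (∀ x, x ∉ coneSet W → (x ∈ K ↔ ∃ i, ∃ u ∈ Set.Icc (-L) L, x.On (Γ i (q, u)))) →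
          IsotopicOutside (coneSet W) K {x | x.On p ∨ ∃ i u, x.On (Γ i (q₀, u))} := by
  set M₁ := M₀ + 1 with hM₁
  have hM₀₁ : M₀ < M₁ := by linarith
  have hγc : ∀ i, Continuous fun u => Γ i (q₀, u) := fun i => (hΓ i).continuous.comp (by fun_prop)
  obtain ⟨WU, hWU, hWUs, hpWU, hWUU⟩ := exists_open_cone_of_mem_nhds hp0 hpq hU
  -- choice of the size of the neighbourhood
  obtain ⟨ρ, hρ, hρW⟩ := exists_projDist_subset hp0
    (W := WU ∩ ({x | (e x).1.re ≠ 0} ∩ ⋂ i : Fin 2,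
      {x | x ≠ 0 ∧ x ∉ curveCone (fun u => Γ i (q₀, u)) (Set.Icc (-M₁) M₁)}))
    (hWU.inter ((isOpen_ne_fun (Complex.continuous_re.comp (continuous_fst.comp e.continuous))
      continuous_const).inter (isOpen_iInter_of_finite fun i =>
        isOpen_compl_curveCone (hγc i) (hγ0 i) isCompact_Icc)))
    (by
      rintro c hc x ⟨h1, h2, h3⟩
      refine ⟨hWUs c hc x h1, ?_, Set.mem_iInter.2 fun i => ?_⟩
      · have h2' : (e x).1.re ≠ 0 := h2
        change (e (c • x)).1.re ≠ 0
        rw [map_smul, Prod.smul_fst, Complex.smul_re]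
        exact smul_ne_zero hc h2'
      · have h3' := Set.mem_iInter.1 h3 i
        refine ⟨smul_ne_zero hc h3'.1, fun h => h3'.2 ?_⟩
        have := smul_mem_curveCone (inv_ne_zero hc) h
        rwa [smul_smul, inv_mul_cancel₀ hc, one_smul] at this)
    (by
      refine ⟨hpWU, hpre, Set.mem_iInter.2 fun i => ⟨hp0, ?_⟩⟩
      rintro ⟨-, u, -, c, h⟩
      exact hpγ i u c h)
  have hρU : ∀ x, x ≠ 0 → projDist p x ≤ 3 * ρ → x ∈ WU := fun x hx h => (hρW x hx h).1
  have hρre : ∀ x, x ≠ 0 → projDist p x ≤ 3 * ρ → 0 < |(e x).1.re| := fun x hx h =>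
    abs_pos.2 (hρW x hx h).2.1
  have hρM : ∀ i u, projDist p (Γ i (q₀, u)) ≤ 3 * ρ → M₁ < |u| := by
    intro i u h
    by_contra! hu
    exact (Set.mem_iInter.1 (hρW _ (hγ0 i u) h).2.2 i).2 (mem_curveCone (hγ0 i) (abs_le.1 hu))
  have hprojc : ∀ i, Continuous fun u => projDist p (Γ i (q₀, u)) := fun i =>
    (continuousOn_projDist p).comp_continuous (hγc i) fun u => hγ0 i u
  -- On the shell ρ ≤ `projDist` ≤ 3ρ the curves have |u| > M₁, hence nonzero imaginary part. By
  -- compactness they avoid a thin sector around the real direction.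
  have hr : ∀ i, ∃ r > 0, ∀ r' ≤ r, ∀ u ∈ {u | ρ ≤ projDist p (Γ i (q₀, u)) ∧
      projDist p (Γ i (q₀, u)) ≤ 3 * ρ}, r' * |(e (Γ i (q₀, u))).1.re| < |(e (Γ i (q₀, u))).1.im| := by
    intro i
    refine exists_pos_mul_lt_of_isCompact ?_ (f := fun u => (e (Γ i (q₀, u))).1.im)
      (g := fun u => (e (Γ i (q₀, u))).1.re)
      (Complex.continuous_im.comp (continuous_fst.comp (e.continuous.comp (hγc i))))
      (Complex.continuous_re.comp (continuous_fst.comp (e.continuous.comp (hγc i)))) ?_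
    · obtain ⟨b, hb⟩ := exists_abs_bound_of_mem_cocompact
        ((hlim i).eventually (gt_mem_nhds hρ))
      refine (isCompact_Icc (a := -b) (b := b)).of_isClosed_subset
        ((isClosed_le continuous_const (hprojc i)).inter (isClosed_le (hprojc i) continuous_const)) ?_
      rintro u ⟨hu, -⟩
      rw [Set.mem_Icc, ← abs_le]
      by_contra! h
      exact absurd (hb u h.le) (not_lt.2 hu)
    · rintro u ⟨-, hu⟩
      exact him i u ((hM₀₁.trans (hρM i u hu)).le)
  choose rr hrr hrr' using hr
  obtain ⟨r, hr0, hr⟩ : ∃ r > 0, ∀ i, 2 * r ≤ rr i :=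
    ⟨min (rr 0) (rr 1) / 2, by have := lt_min (hrr 0) (hrr 1); linarith, fun i => by
      have h0 := min_le_left (rr 0) (rr 1)
      have h1 := min_le_right (rr 0) (rr 1)
      fin_cases i <;> simp <;> linarith⟩
  have hrlat : ∀ i u, ρ ≤ projDist p (Γ i (q₀, u)) → projDist p (Γ i (q₀, u)) ≤ 3 * ρ →
      2 * r * |(e (Γ i (q₀, u))).1.re| < |(e (Γ i (q₀, u))).1.im| := fun i u h1 h2 =>
    hrr' i _ (hr i) u ⟨h1, h2⟩
  -- `TV` defines V: the sector of slope r up to distance 2ρ. `Tlat` surrounds the cut-off face and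
  -- is avoided by the curves, `TF` surrounds the slanted faces, and `Tdeg` is a region off the
  -- quadric on which the norms of the components are far apart.
  let TV : Set (ℝ × ℂ × F) := {w | w.1 < 2 * ρ ∧ |w.2.1.im| < r * |w.2.1.re|}
  let Tlat : Set (ℝ × ℂ × F) := {w | (ρ ≤ w.1 ∧ w.1 ≤ 3 * ρ) ∧ |w.2.1.im| ≤ 2 * r * |w.2.1.re|}
  let Tdeg : Set (ℝ × ℂ × F) := {w | 2 * ‖w.2.1‖ ≤ ‖w.2.2‖ ∨ 2 * ‖w.2.2‖ ≤ ‖w.2.1‖}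
  let TF : Set (ℝ × ℂ × F) := {w | w.1 ≤ 3 * ρ ∧ r / 2 * |w.2.1.re| ≤ |w.2.1.im| ∧
    |w.2.1.im| ≤ 2 * r * |w.2.1.re|}
  have c1 : Continuous fun w : ℝ × ℂ × F => |w.2.1.im| :=
    (Complex.continuous_im.comp (by fun_prop)).abs
  have c2 : Continuous fun w : ℝ × ℂ × F => |w.2.1.re| :=
    (Complex.continuous_re.comp (by fun_prop)).abs
  have ck : ∀ k : ℝ, Continuous fun w : ℝ × ℂ × F => k * |w.2.1.re| := fun k =>
    continuous_const.mul c2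
  have cf : Continuous fun w : ℝ × ℂ × F => w.1 := continuous_fst
  have n1 : Continuous fun w : ℝ × ℂ × F => ‖w.2.1‖ := by fun_prop
  have n2 : Continuous fun w : ℝ × ℂ × F => ‖w.2.2‖ := by fun_prop
  have n1' : Continuous fun w : ℝ × ℂ × F => 2 * ‖w.2.1‖ := by fun_prop
  have n2' : Continuous fun w : ℝ × ℂ × F => 2 * ‖w.2.2‖ := by fun_prop
  have hTVo : IsOpen TV := (isOpen_lt cf continuous_const).inter (isOpen_lt c1 (ck _))
  have hTlatc : IsClosed Tlat := ((isClosed_le continuous_const cf).inter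
    (isClosed_le cf continuous_const)).inter (isClosed_le c1 (ck _))
  have hTdegc : IsClosed Tdeg := (isClosed_le n1' n2).union (isClosed_le n2' n1)
  have hTFc : IsClosed TF := (isClosed_le cf continuous_const).inter
    ((isClosed_le (ck _) c1).inter (isClosed_le c1 (ck _)))
  have hTVs : ∀ c : ℝ, c ≠ 0 → ∀ w ∈ TV, (w.1, c • w.2) ∈ TV := by
    rintro c hc w ⟨h1, h2⟩
    obtain ⟨e1, e2, e3⟩ := smul_im_re_ineq hc w.2.1
    exact ⟨h1, by change |(c • w.2.1).im| < r * |(c • w.2.1).re|; rw [e1, e2]; nlinarith⟩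
  have hTlats : ∀ c : ℝ, c ≠ 0 → ∀ w ∈ Tlat, (w.1, c • w.2) ∈ Tlat := by
    rintro c hc w ⟨h1, h2⟩
    obtain ⟨e1, e2, e3⟩ := smul_im_re_ineq hc w.2.1
    exact ⟨h1, by change |(c • w.2.1).im| ≤ 2 * r * |(c • w.2.1).re|; rw [e1, e2]; nlinarith⟩
  have hTdegs : ∀ c : ℝ, c ≠ 0 → ∀ w ∈ Tdeg, (w.1, c • w.2) ∈ Tdeg := by
    rintro c hc w h
    have hc' : 0 < |c| := abs_pos.2 hc
    change 2 * ‖c • w.2.1‖ ≤ ‖c • w.2.2‖ ∨ 2 * ‖c • w.2.2‖ ≤ ‖c • w.2.1‖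
    rw [norm_smul, norm_smul, Real.norm_eq_abs]
    rcases h with h | h
    · left; nlinarith
    · right; nlinarith
  have hTFs : ∀ c : ℝ, c ≠ 0 → ∀ w ∈ TF, (w.1, c • w.2) ∈ TF := by
    rintro c hc w ⟨h1, h2, h3⟩
    obtain ⟨e1, e2, e3⟩ := smul_im_re_ineq hc w.2.1
    exact ⟨h1, by change r / 2 * |(c • w.2.1).re| ≤ |(c • w.2.1).im|; rw [e1, e2]; nlinarith,
      by change |(c • w.2.1).im| ≤ 2 * r * |(c • w.2.1).re|; rw [e1, e2]; nlinarith⟩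
  set Vc := regionCone p e TV with hVc
  have hVcs : ∀ c : ℝ, c ≠ 0 → ∀ x ∈ Vc, c • x ∈ Vc := smul_mem_regionCone hTVs
  have hpV : p ∈ Vc := by
    refine ⟨hp0, ?_, ?_⟩
    · simp only [projDist_self hp0]; positivity
    · simp only [hpim, abs_zero]
      have := abs_pos.2 hpre
      positivity
  have hVo : IsOpen Vc := isOpen_regionCone hTVo
  refine ⟨Vc, hVo, hVcs, hpV, ?_, ?_⟩
  · intro x hx
    obtain ⟨v, hv, hq, rfl⟩ := x.exists_rep
    rw [mem_coneSet_mk hVcs] at hx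
    exact hWUU v hv hq (hρU v hv (by have : projDist p v < 2 * ρ := hx.2.1; linarith))
  obtain ⟨ρ', hρ', hρV⟩ := exists_projDist_subset hp0 hVo hVcs hpV
  have hb : ∀ i, ∃ b : ℝ, ∀ u, b ≤ |u| → Γ i (q₀, u) ∈ Vc := by
    intro i
    obtain ⟨b, hb⟩ := exists_abs_bound_of_mem_cocompact ((hlim i).eventually
      (gt_mem_nhds (show 0 < 3 * ρ' by positivity)))
    exact ⟨b, fun u hu => hρV _ (hγ0 i u) (hb u hu).le⟩
  choose b hb using hb
  -- Beyond `b i` the curve lies in V; the extra 1 absorbs the change of parameter.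
  refine ⟨max (b 0) (b 1) + 1, fun L hL => ?_⟩
  have hbL : ∀ i u, Γ i (q₀, u) ∉ Vc → |u| + 1 ≤ L := by
    intro i u hu
    have h1 : |u| < b i := by
      by_contra! h
      exact hu (hb i u h)
    have h2 : b i ≤ max (b 0) (b 1) := by fin_cases i <;> simp
    linarith
  set M := L + 1 with hM
  have hnb : ∀ x, form32 x = 0 → ‖(e x).2‖ = ‖(e x).1‖ := fun x hx => by
    have := he x
    rw [hx] at this
    exact (pow_left_inj₀ (norm_nonneg _) (norm_nonneg _) two_ne_zero).1 (by linarith)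
  have hna : ∀ x, x ≠ 0 → form32 x = 0 → 0 < ‖(e x).1‖ := fun x hx hq => by
    rw [norm_pos_iff]
    intro h
    have h2 := hnb x hq
    rw [h, norm_zero, norm_eq_zero] at h2
    exact hx (e.injective (by rw [map_zero]; exact Prod.ext h h2))
  -- The field of curve i also has to vanish along the other curve, so that the sum of the two
  -- fields moves each curve as its own field does.
  let Z : Fin 2 → Set (Fin 5 → ℝ) := fun i => (⋃ j ∈ {j | i ≠ j},
      curveCone (fun u => Γ j (q₀, u)) (Set.Icc (-M) M)) ∪ (regionCone p e Tlat ∪ regionCone p e Tdeg)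
  have hZcl : ∀ i, IsClosed (Z i ∩ euclSphere) := by
    intro i
    simp only [Z, Set.union_inter_distrib_right, Set.iUnion₂_inter]
    refine IsClosed.union ?_ ((isClosed_regionCone_inter hTlatc).union (isClosed_regionCone_inter hTdegc))
    exact Set.Finite.isClosed_biUnion (Set.toFinite _) fun j _ =>
      (isCompact_curveCone_inter (hγc j) (hγ0 j) isCompact_Icc).isClosed
  have hZs : ∀ i, ∀ c : ℝ, c ≠ 0 → ∀ x ∈ Z i, c • x ∈ Z i := by
    rintro i c hc x (h | h | h)
    · left
      simp only [Set.mem_iUnion] at h ⊢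
      obtain ⟨j, hj, h⟩ := h
      exact ⟨j, hj, smul_mem_curveCone hc h⟩
    · exact Or.inr (Or.inl (smul_mem_regionCone hTlats c hc x h))
    · exact Or.inr (Or.inr (smul_mem_regionCone hTdegs c hc x h))
  have hD := fun i => exists_displacement e he q₀ (Γ i) (hΓ i) (hγ0 i) (hγq i) (hinj i) (hd i)
    (himm i) (M := M) hM₀ hM₀₁ (hang i) (Z i) (regionCone p e TF) (hZcl i)
    (isClosed_regionCone_inter hTFc) (hZs i) (smul_mem_regionCone hTFs) (by
      rintro u hu (h | h | h)
      · simp only [Set.mem_iUnion] at h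
        obtain ⟨j, hj, -, v, -, c, h⟩ := h
        exact hdisj i j hj u v c h
      · obtain ⟨-, ⟨h1, h2⟩, h3⟩ := h
        exact absurd (hrlat i u h1 h2) (not_lt.2 h3)
      · have h1 := hnb _ (hγq i u)
        have h2 := hna _ (hγ0 i u) (hγq i u)
        obtain ⟨-, h | h⟩ := h
        · simp only at h; linarith
        · simp only at h; linarith) (by
      rintro u hu ⟨-, h, -⟩
      exact hρM i u h)
  choose D OD υ OS hODo hODq hDs hDhom hDq hDZ hDF hOSo hOSq hυs hυq hDm using hD
  let DD : Y × (Fin 5 → ℝ) → ℂ × F := fun z => D 0 z + D 1 z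
  let OO : Set (Y × (Fin 5 → ℝ)) := OD 0 ∩ OD 1
  have hOO : IsOpen OO := (hODo 0).inter (hODo 1)
  have hOOq : ∀ x, x ≠ 0 → (q₀, x) ∈ OO := fun x hx => ⟨hODq 0 x hx, hODq 1 x hx⟩
  have hDDs : ContDiffOn ℝ ∞ DD OO :=
    ((hDs 0).mono Set.inter_subset_left).add ((hDs 1).mono Set.inter_subset_right)
  have hDDhom : ∀ q (c : ℝ) x, DD (q, c • x) = c • DD (q, x) := fun q c x => by
    simp only [DD, hDhom, smul_add]
  have hDDq : ∀ x, DD (q₀, x) = 0 := fun x => by simp only [DD, hDq, add_zero]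
  have hDDlat : ∀ q x, x ∈ regionCone p e Tlat → DD (q, x) = 0 := fun q x hx => by
    simp only [DD, hDZ 0 q x (Or.inr (Or.inl hx)) hx.1, hDZ 1 q x (Or.inr (Or.inl hx)) hx.1, add_zero]
  have hDDdeg : ∀ q x, x ≠ 0 → 2 * ‖(e x).1‖ < ‖(e x).2‖ ∨ 2 * ‖(e x).2‖ < ‖(e x).1‖ →
      DD (q, x) = 0 := fun q x hx h => by
    have hx' : x ∈ regionCone p e Tdeg := ⟨hx, h.imp le_of_lt le_of_lt⟩
    simp only [DD, hDZ 0 q x (Or.inr (Or.inr hx')) hx, hDZ 1 q x (Or.inr (Or.inr hx')) hx, add_zero]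
  have hDDF : ∀ q x, (q, x) ∈ OO → x ∈ regionCone p e TF → (DD (q, x)).1 = 0 := fun q x hq hx => by
    simp only [DD, Prod.fst_add, hDF 0 q x hx.1 hq.1 hx, hDF 1 q x hx.1 hq.2 hx, add_zero]
  have ev1 := eventually_displace_isotopy he hOO hOOq hDDs hDDhom hDDq hDDdeg
  -- A closed conical condition is carried into any open conical condition that contains it,
  -- uniformly in time, once q is near q₀. The shells of `ev2` to `ev5` are instances.
  have close : ∀ B W : Set (ℝ × ℂ × F), IsClosed B → IsOpen W →
      (∀ c : ℝ, c ≠ 0 → ∀ w ∈ B, (w.1, c • w.2) ∈ B) → (∀ c : ℝ, c ≠ 0 → ∀ w ∈ W, (w.1, c • w.2) ∈ W) →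
      (∀ x, x ≠ 0 → (projDist p x, e x) ∈ B → (projDist p x, e x) ∈ W) →
      ∀ᶠ q in 𝓝 q₀, ∀ t : I, ∀ x, x ≠ 0 → (projDist p x, e x) ∈ B →
        displace e DD (q, t, x) ∈ regionCone p e W := by
    intro B W hB hW hBs hWs h
    filter_upwards [eventually_displace_mem hOO hOOq hDDs hDDhom hDDq hDDdeg
      (isClosed_regionCone_inter hB) (smul_mem_regionCone hBs) (isOpen_regionCone hW)
      (smul_mem_regionCone hWs) fun x hx hx0 => ⟨hx0, h x hx0 hx.2⟩] with q hq t x hx hxB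
    exact hq t x ⟨hx, hxB⟩ hx
  have ev2 := close {w | w.1 ≤ ρ} {w | w.1 < 2 * ρ} (isClosed_le cf continuous_const)
    (isOpen_lt cf continuous_const) (fun _ _ _ h => h) (fun _ _ _ h => h) (fun x _ h => by
      have h' : projDist p x ≤ ρ := h
      change projDist p x < 2 * ρ
      linarith)
  have ev3 := close {w | w.1 ≤ 3 * ρ ∧ |w.2.1.im| ≤ r / 2 * |w.2.1.re|} {w | |w.2.1.im| < r * |w.2.1.re|}
    ((isClosed_le cf continuous_const).inter (isClosed_le c1 (ck _))) (isOpen_lt c1 (ck _))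
    (fun c hc w h => by
      obtain ⟨e1, e2, e3⟩ := smul_im_re_ineq hc w.2.1
      refine ⟨h.1, ?_⟩
      change |(c • w.2.1).im| ≤ r / 2 * |(c • w.2.1).re|
      rw [e1, e2]
      nlinarith [h.2])
    (fun c hc w h => by
      obtain ⟨e1, e2, e3⟩ := smul_im_re_ineq hc w.2.1
      have h' : |w.2.1.im| < r * |w.2.1.re| := h
      change |(c • w.2.1).im| < r * |(c • w.2.1).re|
      rw [e1, e2]
      nlinarith)
    (fun x hx h => by
      have h1 := hρre x hx h.1
      have h2 : |(e x).1.im| ≤ r / 2 * |(e x).1.re| := h.2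
      change |(e x).1.im| < r * |(e x).1.re|
      nlinarith [mul_pos hr0 h1])
  have ev4 := close {w | 3 * ρ ≤ w.1} {w | 2 * ρ < w.1} (isClosed_le continuous_const cf)
    (isOpen_lt continuous_const cf) (fun _ _ _ h => h) (fun _ _ _ h => h) (fun x _ h => by
      have h' : 3 * ρ ≤ projDist p x := h
      change 2 * ρ < projDist p x
      linarith)
  have ev5 := close {w | w.1 ≤ 3 * ρ ∧ 2 * r * |w.2.1.re| ≤ |w.2.1.im|} {w | r * |w.2.1.re| < |w.2.1.im|}
    ((isClosed_le cf continuous_const).inter (isClosed_le (ck _) c1)) (isOpen_lt (ck _) c1)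
    (fun c hc w h => by
      obtain ⟨e1, e2, e3⟩ := smul_im_re_ineq hc w.2.1
      refine ⟨h.1, ?_⟩
      change 2 * r * |(c • w.2.1).re| ≤ |(c • w.2.1).im|
      rw [e1, e2]
      nlinarith [h.2])
    (fun c hc w h => by
      obtain ⟨e1, e2, e3⟩ := smul_im_re_ineq hc w.2.1
      have h' : r * |w.2.1.re| < |w.2.1.im| := h
      change r * |(c • w.2.1).re| < |(c • w.2.1).im|
      rw [e1, e2]
      nlinarith)
    (fun x hx h => by
      have h1 := hρre x hx h.1
      have h2 : 2 * r * |(e x).1.re| ≤ |(e x).1.im| := h.2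
      change r * |(e x).1.re| < |(e x).1.im|
      nlinarith [mul_pos hr0 h1])
  have ev6 : ∀ᶠ q in 𝓝 q₀, ∀ x, x ≠ 0 → x ∈ regionCone p e TF → (DD (q, x)).1 = 0 := by
    obtain ⟨u, v, hu, -, hqu, hKv, huv⟩ := generalized_tube_lemma (s := {q₀}) isCompact_singleton
      isCompact_euclSphere hOO (by
        rintro ⟨q, x⟩ ⟨hq, hx⟩
        obtain rfl : q = q₀ := hq
        exact hOOq x (ne_zero_of_mem_euclSphere hx))
    filter_upwards [hu.mem_nhds (hqu rfl)] with q hq x hx hxF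
    have hn := euclNorm_pos hx
    have := hDDF q _ (huv ⟨hq, hKv (euclNorm_inv_smul_mem hx)⟩)
      (smul_mem_regionCone hTFs _ (inv_ne_zero hn.ne') x hxF)
    rw [hDDhom, Prod.smul_fst, smul_eq_zero] at this
    exact this.resolve_left (inv_ne_zero hn.ne')
  have ev7 : ∀ᶠ q in 𝓝 q₀, ∀ i, ∀ u ∈ Set.Icc (-M) M, (q, u) ∈ OS i ∧ |υ i (q, u) - u| < 1 := by
    rw [Filter.eventually_all]
    intro i
    have hop : IsOpen (OS i ∩ (fun z : Y × ℝ => |υ i z - z.2|) ⁻¹' Set.Iio 1) :=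
      ContinuousOn.isOpen_inter_preimage (((hυs i).continuousOn.sub continuousOn_snd).abs) (hOSo i)
        isOpen_Iio
    obtain ⟨u, v, hu, -, hqu, hKv, huv⟩ := generalized_tube_lemma (s := {q₀}) isCompact_singleton
      (isCompact_Icc (a := -M) (b := M)) hop (by
        rintro ⟨q, x⟩ ⟨hq, hx⟩
        obtain rfl : q = q₀ := hq
        refine ⟨hOSq i x hx, ?_⟩
        change |υ i (q, x) - x| < 1
        rw [hυq i x hx, sub_self, abs_zero]
        exact one_pos)
    filter_upwards [hu.mem_nhds (hqu rfl)] with q hq x hx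
    exact huv ⟨hq, hKv hx⟩
  filter_upwards [ev1, ev2, ev3, ev4, ev5, ev6, ev7] with q ⟨H, hH⟩ h2 h3 h4 h5 h6 h7 hqq K hK
  refine IsotopicOutside.symm (isotopicOutside_of_matching hVcs
    (G := fun t x => displace e DD (q, t, x)) hH ?_ hpV hγ0 hγq hbL
    (υ := fun i u => υ i (q, u)) (Γ := fun i u => Γ i (q, u)) ?_ ?_ ?_ hK)
  -- Invariance of V: points well inside or outside either defining inequality cannot cross it,
  -- points near the cut-off face do not move, and points near a slanted face keep their
  -- ℂ-component.
  · intro t x hx hqx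
    have hlat : ρ ≤ projDist p x → projDist p x ≤ 3 * ρ → |(e x).1.im| ≤ 2 * r * |(e x).1.re| →
        displace e DD (q, t, x) = x := fun a1 a2 a3 =>
      displace_of_eq_zero e (hDDlat q x ⟨hx, ⟨a1, a2⟩, a3⟩) t
    have hfst : projDist p x ≤ 3 * ρ → r / 2 * |(e x).1.re| ≤ |(e x).1.im| →
        |(e x).1.im| ≤ 2 * r * |(e x).1.re| → (e (displace e DD (q, t, x))).1 = (e x).1 :=
      fun a1 a2 a3 => fst_displace_of_eq_zero e (h6 x hx ⟨hx, a1, a2, a3⟩) t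
    rcases le_total (3 * ρ) (projDist p x) with hd3 | hd3
    · have hG := h4 t x hx hd3
      have hG' : 2 * ρ < projDist p (displace e DD (q, t, x)) := hG.2
      constructor
      · intro h
        have : projDist p (displace e DD (q, t, x)) < 2 * ρ := h.2.1
        linarith
      · intro h
        have : projDist p x < 2 * ρ := h.2.1
        linarith
    rcases le_total (2 * r * |(e x).1.re|) |(e x).1.im| with hf | hf
    · have hG := h5 t x hx ⟨hd3, hf⟩
      have hG' : r * |(e (displace e DD (q, t, x))).1.re| < |(e (displace e DD (q, t, x))).1.im| := hG.2
      constructor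
      · intro h
        have : |(e (displace e DD (q, t, x))).1.im| < r * |(e (displace e DD (q, t, x))).1.re| := h.2.2
        linarith
      · intro h
        have h1 : |(e x).1.im| < r * |(e x).1.re| := h.2.2
        have := mul_nonneg hr0.le (abs_nonneg (e x).1.re)
        linarith
    rcases le_total ρ (projDist p x) with hd1 | hd1
    · rw [hlat hd1 hd3 hf]
    have hG2 := h2 t x hx hd1
    have hG2' : projDist p (displace e DD (q, t, x)) < 2 * ρ := hG2.2
    have hd2 : projDist p x < 2 * ρ := by linarith
    rcases le_total (r / 2 * |(e x).1.re|) |(e x).1.im| with hf2 | hf2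
    · have h0 := hfst hd3 hf2 hf
      simp only [hVc, regionCone, TV, Set.mem_ofPred_eq, h0, hG2', hd2, hx, true_and, ne_eq, hG2.1,
        not_false_eq_true]
    · have hG3 := h3 t x hx ⟨hd3, hf2⟩
      refine iff_of_true ⟨hG3.1, hG2', hG3.2⟩ ⟨hx, hd2, ?_⟩
      have h1 := hρre x hx hd3
      change |(e x).1.im| < r * |(e x).1.re|
      nlinarith [mul_pos hr0 h1]
  · exact fun i => (hυs i).continuousOn.comp (by fun_prop) fun u hu => (h7 i u hu).1
  · exact fun i u hu => (h7 i u hu).2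
  · intro i u hu
    obtain ⟨hO, -⟩ := h7 i u hu
    obtain ⟨κ, hκ, hm⟩ := hDm i q u hu hO (hqq i _)
    have hDDi : DD (q, Γ i (q₀, u)) = D i (q, Γ i (q₀, u)) := by
      have h0 : ∀ j, j ≠ i → D j (q, Γ i (q₀, u)) = 0 := fun j hj =>
        hDZ j q _ (Or.inl (Set.mem_iUnion₂.2 ⟨i, hj, mem_curveCone (hγ0 i) hu⟩)) (hγ0 i u)
      simp only [DD]
      fin_cases i
      · simp only [Fin.zero_eta] at h0 ⊢
        rw [h0 1 (by decide), add_zero]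
      · simp only [Fin.mk_one] at h0 ⊢
        rw [h0 0 (by decide), zero_add]
    set y := Γ i (q, υ i (q, u)) with hy
    set x := Γ i (q₀, u) with hx
    -- Otherwise the displacement would send x to the zero vector, which represents no point of the
    -- quadric.
    have hey : e y ≠ 0 := by
      intro h0
      rw [h0, smul_zero, ← hDDi] at hm
      obtain ⟨hy0, -, -⟩ := hH 1 x (hγ0 i u) (hγq i u)
      apply hy0
      have e1 : (e x).1 + (DD (q, x)).1 = 0 := congrArg Prod.fst hm
      have e2 : (e x).2 + (DD (q, x)).2 = 0 := congrArg Prod.snd hm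
      simp [displace, rescale, e1, e2]
    have hnx := hnb x (hγq i u)
    have hny := hnb y (hqq i _)
    have hy1 : 0 < ‖(e y).1‖ := by
      rw [norm_pos_iff]
      intro h
      rw [h, norm_zero, norm_eq_zero] at hny
      exact hey (Prod.ext h hny)
    refine ⟨‖(e x).1‖ / ‖(e y).1‖, (div_pos (hna x (hγ0 i u) (hγq i u)) hy1).ne', ?_⟩
    have e1 : (e x).1 + (DD (q, x)).1 = κ • (e y).1 := by rw [hDDi]; exact congrArg Prod.fst hm
    have e2 : (e x).2 + (DD (q, x)).2 = κ • (e y).2 := by rw [hDDi]; exact congrArg Prod.snd hm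
    apply e.injective
    -- Both x and y are on the quadric, so the two norms agree for each and the two rescaling
    -- factors are equal. The result is thus a multiple of y itself.
    simp only [displace, one_smul, ContinuousLinearEquiv.apply_symm_apply, e1, e2, map_smul, rescale,
      norm_smul, smul_smul, hnx, hny]
    have hk : ‖(e x).1‖ / (‖κ‖ * ‖(e y).1‖) * κ = ‖(e x).1‖ / ‖(e y).1‖ := by
      rw [Real.norm_eq_abs, abs_of_pos hκ]
      field_simp
    rw [hk]
    rfl

end

/-! ### Rational curves on the complexified quadric in partial fractions -/

noncomputable section

set_option linter.unusedSectionVars false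

open MvPolynomial in
/-- Five complex binary forms define an injective immersion of the complex projective line. -/
structure IsEmbedding (G : Fin 5 → MvPolynomial (Fin 2) ℂ) : Prop where
  no_common_zero : ∀ z : Fin 2 → ℂ, z ≠ 0 → ∃ i, eval z (G i) ≠ 0
  injective : ∀ z w : Fin 2 → ℂ, z ≠ 0 → w ≠ 0 →
    (∃ c : ℂ, ∀ i, eval z (G i) = c * eval w (G i)) → ∃ c : ℂ, z = c • w
  immersive : ∀ z : Fin 2 → ℂ, z ≠ 0 →
    LinearIndependent ℂ (fun (j : Fin 2) (i : Fin 5) => eval z (pderiv j (G i)))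

/-- Data describing a rational curve on the complexified cone `x y = a c - b ^ 2`: the roots `r` of
the first coordinate and the principal parts `κ (m ^ 2, m, 1)` of the next three. -/
structure ConeData (ι : Type*) where
  /-- leading coefficient -/
  k : ℂ
  /-- value at infinity -/
  c : Fin 3 → ℂ
  /-- roots -/
  r : ι → ℂ
  /-- size of the principal parts -/
  κ : ι → ℂ
  /-- direction of the principal parts -/
  m : ι → ℂ

namespace ConeData

open MvPolynomial

variable {ι : Type*} [Fintype ι] [DecidableEq ι] (D : ConeData ι)

/-- The direction `(m ^ 2, m, 1)`. -/
def dir (m : ℂ) : Fin 3 → ℂ := ![m ^ 2, m, 1]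

/-- The residue vectors. -/
def res (i : ι) (j : Fin 3) : ℂ := D.κ i * dir (D.m i) j

/-- The linear form with root `r`. -/
def lin (r : ℂ) : MvPolynomial (Fin 2) ℂ := X 0 - C r * X 1

/-- The product of the linear forms with roots in `S`. -/
def prodLin (S : Finset ι) : MvPolynomial (Fin 2) ℂ := ∏ i ∈ S, lin (D.r i)

/-- The polar form of `a c - b ^ 2`. -/
def polar {R : Type*} [CommRing R] (w w' : Fin 3 → R) : R := w 0 * w' 2 + w 2 * w' 0 - 2 * w 1 * w' 1

/-- The first coordinate form. -/
def formX : MvPolynomial (Fin 2) ℂ := C D.k * D.prodLin Finset.univ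

/-- The middle coordinate forms. -/
def formW (j : Fin 3) : MvPolynomial (Fin 2) ℂ :=
  C D.k * (C (D.c j) * D.prodLin Finset.univ +
    X 1 * ∑ i, C (D.res i j) * D.prodLin (Finset.univ.erase i))

/-- The last coordinate form. -/
def formY : MvPolynomial (Fin 2) ℂ :=
  C D.k * (C (polar D.c D.c / 2) * D.prodLin Finset.univ +
    X 1 * ∑ i, C (polar D.c (D.res i)) * D.prodLin (Finset.univ.erase i) +
    -- In the affine chart y/x = N(w), expanded by bilinearity. The terms i = j have coefficient
    -- zero, so erasing the same index twice does no harm.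
    X 1 ^ 2 * ∑ i, ∑ j, C (polar (D.res i) (D.res j) / 2) *
      D.prodLin ((Finset.univ.erase i).erase j))

/-- All five coordinate forms. -/
def form : Fin 5 → MvPolynomial (Fin 2) ℂ :=
  ![D.formX, D.formW 0, D.formW 1, D.formW 2, D.formY]

theorem prodLin_erase (i : ι) : lin (D.r i) * D.prodLin (Finset.univ.erase i) =
    D.prodLin Finset.univ :=
  Finset.mul_prod_erase _ (fun i => lin (D.r i)) (Finset.mem_univ i)

theorem prodLin_erase_mul {i j : ι} (h : i ≠ j) :
    D.prodLin (Finset.univ.erase i) * D.prodLin (Finset.univ.erase j) =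
      D.prodLin Finset.univ * D.prodLin ((Finset.univ.erase i).erase j) := by
  have h1 : lin (D.r j) * D.prodLin ((Finset.univ.erase i).erase j) = D.prodLin (Finset.univ.erase i) :=
    Finset.mul_prod_erase _ (fun i => lin (D.r i)) (by simp [h.symm])
  rw [← h1, ← D.prodLin_erase j]
  ring

/-- The direction (m², m, 1) satisfies ac = b². This removes the double poles of y/x and makes the
last coordinate a form of the right degree. -/
theorem polar_res_self (i : ι) : polar (D.res i) (D.res i) = 0 := by
  simp only [polar, res, dir, Matrix.cons_val]
  ring

theorem formX_mul_formY :
    D.formX * D.formY - D.formW 0 * D.formW 2 + D.formW 1 ^ 2 = 0 := by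
  set P := D.prodLin Finset.univ with hP
  -- For i ≠ j the product of the two cofactors is divisible by P; the diagonal terms, for which
  -- this fails, have coefficient zero.
  have key : ∑ i, ∑ j, C (polar (D.res i) (D.res j) / 2) *
      (D.prodLin (Finset.univ.erase i) * D.prodLin (Finset.univ.erase j)) =
      P * ∑ i, ∑ j, C (polar (D.res i) (D.res j) / 2) *
      D.prodLin ((Finset.univ.erase i).erase j) := by
    simp only [Finset.mul_sum]
    refine Finset.sum_congr rfl fun i _ => Finset.sum_congr rfl fun j _ => ?_
    by_cases h : i = j
    · subst h
      simp [polar_res_self]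
    · rw [D.prodLin_erase_mul h]
      ring
  have key2 : ∑ i, ∑ j, C (polar (D.res i) (D.res j) / 2) *
      (D.prodLin (Finset.univ.erase i) * D.prodLin (Finset.univ.erase j)) =
      (∑ i, C (D.res i 0) * D.prodLin (Finset.univ.erase i)) *
        (∑ i, C (D.res i 2) * D.prodLin (Finset.univ.erase i)) -
      (∑ i, C (D.res i 1) * D.prodLin (Finset.univ.erase i)) ^ 2 := by
    have h2 : (C (1 / 2 : ℂ) : MvPolynomial (Fin 2) ℂ) + C (1 / 2) = 1 := by
      rw [← C_add, ← C_1]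
      norm_num
    have e1 : ∀ i j, C (polar (D.res i) (D.res j) / 2) *
      (D.prodLin (Finset.univ.erase i) * D.prodLin (Finset.univ.erase j)) =
      C (1 / 2) * ((C (D.res i 0) * D.prodLin (Finset.univ.erase i)) * (C (D.res j 2) * D.prodLin (Finset.univ.erase j))
      ) + C (1 / 2) * ((C (D.res i 2) * D.prodLin (Finset.univ.erase i)) * (C (D.res j 0) * D.prodLin (Finset.univ.erase j)))
      - (C (D.res i 1) * D.prodLin (Finset.univ.erase i)) * (C (D.res j 1) * D.prodLin (Finset.univ.erase j)) := by
      intro i j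
      have : polar (D.res i) (D.res j) / 2 = 1 / 2 * (D.res i 0 * D.res j 2) +
        1 / 2 * (D.res i 2 * D.res j 0) - D.res i 1 * D.res j 1 := by
        simp only [polar]
        ring
      rw [this]
      simp only [C_add, C_sub, C_mul]
      ring
    simp only [e1, Finset.sum_sub_distrib, Finset.sum_add_distrib, ← Finset.mul_sum]
    simp only [← Finset.sum_mul]
    linear_combination ((∑ i, C (D.res i 0) * D.prodLin (Finset.univ.erase i)) *
        (∑ i, C (D.res i 2) * D.prodLin (Finset.univ.erase i))) * h2
  have key3 : ∑ i, C (polar D.c (D.res i)) * D.prodLin (Finset.univ.erase i) =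
      C (D.c 0) * (∑ i, C (D.res i 2) * D.prodLin (Finset.univ.erase i)) +
      C (D.c 2) * (∑ i, C (D.res i 0) * D.prodLin (Finset.univ.erase i)) -
      2 * C (D.c 1) * (∑ i, C (D.res i 1) * D.prodLin (Finset.univ.erase i)) := by
    simp only [Finset.mul_sum, ← Finset.sum_add_distrib, ← Finset.sum_sub_distrib]
    refine Finset.sum_congr rfl fun i _ => ?_
    simp only [polar, C_add, C_sub, C_mul, map_ofNat]
    ring
  have key4 : C (polar D.c D.c / 2) = (C (D.c 0) * C (D.c 2) - C (D.c 1) ^ 2 : MvPolynomial (Fin 2) ℂ) := by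
    rw [← C_mul, ← C_pow, ← C_sub]
    congr 1
    simp only [polar]
    ring
  rw [key2] at key
  simp only [formX, formY, formW, key3, key4, ← hP]
  linear_combination (- C D.k ^ 2 * X 1 ^ 2) * key

theorem isHomogeneous_lin (r : ℂ) : (lin r).IsHomogeneous 1 :=
  (isHomogeneous_X ℂ 0).sub (by simpa using (isHomogeneous_C (Fin 2) r).mul (isHomogeneous_X ℂ 1))

theorem isHomogeneous_prodLin (S : Finset ι) : (D.prodLin S).IsHomogeneous S.card := by
  have := IsHomogeneous.prod S (fun i => lin (D.r i)) (fun _ => 1) fun i _ => isHomogeneous_lin (D.r i)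
  simpa [prodLin] using this

theorem isHomogeneous_C_mul {n : ℕ} (c : ℂ) {p : MvPolynomial (Fin 2) ℂ} (h : p.IsHomogeneous n) :
    (C c * p).IsHomogeneous n := by simpa using (isHomogeneous_C (Fin 2) c).mul h

theorem isHomogeneous_form (hι : 2 ≤ Fintype.card ι) (i : Fin 5) :
    (D.form i).IsHomogeneous (Fintype.card ι) := by
  have h0 : (D.prodLin Finset.univ).IsHomogeneous (Fintype.card ι) := D.isHomogeneous_prodLin _
  have h1 : ∀ f : ι → ℂ, (X 1 * ∑ i, C (f i) * D.prodLin (Finset.univ.erase i)).IsHomogeneous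
      (Fintype.card ι) := by
    intro f
    have : (∑ i, C (f i) * D.prodLin (Finset.univ.erase i)).IsHomogeneous (Fintype.card ι - 1) :=
      IsHomogeneous.sum _ _ _ fun i _ => isHomogeneous_C_mul _ (by
        have := D.isHomogeneous_prodLin (Finset.univ.erase i)
        rwa [Finset.card_erase_of_mem (Finset.mem_univ i), Finset.card_univ] at this)
    have h := (isHomogeneous_X ℂ (1 : Fin 2)).mul this
    rwa [show 1 + (Fintype.card ι - 1) = Fintype.card ι by lia] at h
  have h2 : (X 1 ^ 2 * ∑ i, ∑ j, C (polar (D.res i) (D.res j) / 2) *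
      D.prodLin ((Finset.univ.erase i).erase j)).IsHomogeneous (Fintype.card ι) := by
    have : (∑ i, ∑ j, C (polar (D.res i) (D.res j) / 2) *
      D.prodLin ((Finset.univ.erase i).erase j)).IsHomogeneous (Fintype.card ι - 2) := by
      refine IsHomogeneous.sum _ _ _ fun i _ => IsHomogeneous.sum _ _ _ fun j _ => ?_
      by_cases h : i = j
      · subst h
        simp [polar_res_self, isHomogeneous_zero]
      · refine isHomogeneous_C_mul _ ?_
        have := D.isHomogeneous_prodLin ((Finset.univ.erase i).erase j)
        rwa [Finset.card_erase_of_mem (by simp [Ne.symm h]), Finset.card_erase_of_mem (Finset.mem_univ i),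
          Finset.card_univ, Nat.sub_sub] at this
    have h := ((isHomogeneous_X ℂ (1 : Fin 2)).pow 2).mul this
    rwa [show 1 * 2 + (Fintype.card ι - 2) = Fintype.card ι by lia] at h
  have hW : ∀ j, (D.formW j).IsHomogeneous (Fintype.card ι) := fun j =>
    isHomogeneous_C_mul _ ((isHomogeneous_C_mul _ h0).add (h1 _))
  fin_cases i
  · exact isHomogeneous_C_mul _ h0
  · exact hW 0
  · exact hW 1
  · exact hW 2
  · exact isHomogeneous_C_mul _ (((isHomogeneous_C_mul _ h0).add (h1 _)).add h2)

/-- The bilinear quotient of `W (z) X (z') - W (z') X (z)` by `t s' - t' s`. -/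
def delta (z : Fin 2 → ℂ) (j : Fin 3) : MvPolynomial (Fin 2) ℂ :=
  C (D.k ^ 2) * ∑ i, C (D.res i j) * D.prodLin (Finset.univ.erase i) *
    C (eval z (D.prodLin (Finset.univ.erase i)))

/-- The difference of the affine curve W/X at two parameters, with denominators cleared, is
divisible by their determinant. The quotient `delta` decides injectivity off the diagonal and
immersion on it. -/
theorem formW_mul_sub (z : Fin 2 → ℂ) (j : Fin 3) :
    D.formW j * C (eval z D.formX) - C (eval z (D.formW j)) * D.formX =
      (X 1 * C (z 0) - X 0 * C (z 1)) * D.delta z j := by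
  have e1 : ∀ i, D.prodLin Finset.univ * C (eval z (D.prodLin (Finset.univ.erase i))) =
      (X 0 - C (D.r i) * X 1) * (D.prodLin (Finset.univ.erase i) *
        C (eval z (D.prodLin (Finset.univ.erase i)))) := fun i => by
    rw [← D.prodLin_erase i, lin]
    ring
  have e2 : ∀ i, D.prodLin (Finset.univ.erase i) * C (eval z (D.prodLin Finset.univ)) =
      (C (z 0) - C (D.r i) * C (z 1)) * (D.prodLin (Finset.univ.erase i) *
        C (eval z (D.prodLin (Finset.univ.erase i)))) := fun i => by
    rw [← D.prodLin_erase i, lin]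
    simp only [map_mul, map_sub, eval_X, eval_C]
    ring
  simp only [formW, formX, delta, map_mul, map_add, eval_C, eval_X, map_sum]
  have e3 : (∑ i, C (D.res i j) * D.prodLin (Finset.univ.erase i)) * C (eval z (D.prodLin Finset.univ))
      * X 1 - C (z 1) * (∑ i, C (D.res i j) * C (eval z (D.prodLin (Finset.univ.erase i)))) *
      D.prodLin Finset.univ = (X 1 * C (z 0) - X 0 * C (z 1)) *
      ∑ i, C (D.res i j) * D.prodLin (Finset.univ.erase i) *
        C (eval z (D.prodLin (Finset.univ.erase i))) := by
    simp only [Finset.sum_mul, Finset.mul_sum, ← Finset.sum_sub_distrib]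
    refine Finset.sum_congr rfl fun i _ => ?_
    linear_combination C (D.res i j) * X 1 * e2 i - C (z 1) * C (D.res i j) * e1 i
  simp only [map_pow]
  linear_combination C D.k ^ 2 * e3

theorem eval_lin (z : Fin 2 → ℂ) (r : ℂ) : eval z (lin r) = z 0 - r * z 1 := by simp [lin]

theorem eval_prodLin (z : Fin 2 → ℂ) (S : Finset ι) :
    eval z (D.prodLin S) = ∏ i ∈ S, (z 0 - D.r i * z 1) := by
  simp [prodLin, map_prod, eval_lin]

theorem eval_delta (z w : Fin 2 → ℂ) (j : Fin 3) : eval w (D.delta z j) =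
    D.k ^ 2 * ∑ i, D.res i j * (∏ l ∈ Finset.univ.erase i, (w 0 - D.r l * w 1)) *
      ∏ l ∈ Finset.univ.erase i, (z 0 - D.r l * z 1) := by
  simp [delta, eval_prodLin]

/-- Genericity of the data, which makes the curve embedded. -/
structure Generic : Prop where
  k_ne : D.k ≠ 0
  κ_ne : ∀ i, D.κ i ≠ 0
  r_inj : Function.Injective D.r
  m_inj : Function.Injective D.m
  -- The divided difference of the affine curve has no zero; the case z = w, where it is the
  -- derivative up to a scalar, is included.
  sum_ne : ∀ z w : Fin 2 → ℂ, z ≠ 0 → w ≠ 0 → (∀ i, z 0 - D.r i * z 1 ≠ 0) →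
    (∀ i, w 0 - D.r i * w 1 ≠ 0) →
    ∃ j, ∑ i, D.res i j * ((z 0 - D.r i * z 1) * (w 0 - D.r i * w 1))⁻¹ ≠ 0

variable {D}

theorem prod_ne_of_root (h : D.Generic) {z : Fin 2 → ℂ} (hz : z ≠ 0) {i : ι}
    (hi : z 0 - D.r i * z 1 = 0) : z 1 ≠ 0 ∧ ∏ l ∈ Finset.univ.erase i, (z 0 - D.r l * z 1) ≠ 0 := by
  have h1 : z 1 ≠ 0 := by
    intro h1
    rw [h1, mul_zero, sub_zero] at hi
    exact hz (by ext l; fin_cases l <;> simp [hi, h1])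
  refine ⟨h1, Finset.prod_ne_zero_iff.2 fun l hl h2 => (Finset.mem_erase.1 hl).1 (h.r_inj ?_)⟩
  exact mul_right_cancel₀ h1 (by linear_combination hi - h2)

theorem sum_res_of_root {z : Fin 2 → ℂ} {i : ι} (hi : z 0 - D.r i * z 1 = 0)
    (j : Fin 3) (f : ι → ℂ) :
    ∑ l, D.res l j * f l * ∏ l' ∈ Finset.univ.erase l, (z 0 - D.r l' * z 1) =
      D.res i j * f i * ∏ l' ∈ Finset.univ.erase i, (z 0 - D.r l' * z 1) := by
  refine Finset.sum_eq_single i (fun l _ hl => ?_) (by simp)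
  rw [Finset.prod_eq_zero (i := i) (by simp [hl.symm]) hi, mul_zero]

theorem exists_res_ne (h : ∀ i, D.κ i ≠ 0) (i : ι) : D.res i 2 ≠ 0 := by
  simp [res, dir, h i]

/-- At a pole only one summand of `delta` survives, and its last entry is nonzero; away from the
poles this is genericity. Two different poles have to be excluded, because every summand then
vanishes. -/
theorem exists_eval_delta_ne (h : D.Generic) {z w : Fin 2 → ℂ} (hz : z ≠ 0) (hw : w ≠ 0)
    (hzw : ∀ i i', z 0 - D.r i * z 1 = 0 → w 0 - D.r i' * w 1 = 0 → i = i') :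
    ∃ j, eval w (D.delta z j) ≠ 0 := by
  have hk := pow_ne_zero 2 h.k_ne
  by_cases hzp : ∃ i, z 0 - D.r i * z 1 = 0
  · obtain ⟨i, hi⟩ := hzp
    refine ⟨2, ?_⟩
    rw [eval_delta, sum_res_of_root hi 2]
    refine mul_ne_zero hk (mul_ne_zero (mul_ne_zero (exists_res_ne h.κ_ne i) ?_)
      (prod_ne_of_root h hz hi).2)
    refine Finset.prod_ne_zero_iff.2 fun l hl hl0 => (Finset.mem_erase.1 hl).1 (hzw i l hi hl0).symm
  by_cases hwp : ∃ i, w 0 - D.r i * w 1 = 0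
  · obtain ⟨i, hi⟩ := hwp
    refine ⟨2, ?_⟩
    rw [eval_delta]
    have := sum_res_of_root hi 2 fun l => ∏ l' ∈ Finset.univ.erase l, (z 0 - D.r l' * z 1)
    simp only [mul_right_comm _ (∏ l' ∈ _, (w 0 - D.r l' * w 1))]
    rw [this]
    refine mul_ne_zero hk (mul_ne_zero (mul_ne_zero (exists_res_ne h.κ_ne i) ?_)
      (prod_ne_of_root h hw hi).2)
    exact Finset.prod_ne_zero_iff.2 fun l hl hl0 => hzp ⟨l, hl0⟩
  · push Not at hzp hwp
    obtain ⟨j, hj⟩ := h.sum_ne z w hz hw hzp hwp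
    refine ⟨j, ?_⟩
    rw [eval_delta]
    refine mul_ne_zero hk ?_
    have : ∑ i, D.res i j * (∏ l ∈ Finset.univ.erase i, (w 0 - D.r l * w 1)) *
        ∏ l ∈ Finset.univ.erase i, (z 0 - D.r l * z 1) =
        ((∏ l, (z 0 - D.r l * z 1)) * ∏ l, (w 0 - D.r l * w 1)) *
        ∑ i, D.res i j * ((z 0 - D.r i * z 1) * (w 0 - D.r i * w 1))⁻¹ := by
      rw [Finset.mul_sum]
      refine Finset.sum_congr rfl fun i _ => ?_
      rw [← Finset.mul_prod_erase _ _ (Finset.mem_univ i), ← Finset.mul_prod_erase _ (fun l =>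
        (w 0 - D.r l * w 1)) (Finset.mem_univ i)]
      set A := ∏ l ∈ Finset.univ.erase i, (z 0 - D.r l * z 1)
      set B := ∏ l ∈ Finset.univ.erase i, (w 0 - D.r l * w 1)
      rw [mul_inv]
      linear_combination (-D.res i j * A * B * (w 0 - D.r i * w 1) * (w 0 - D.r i * w 1)⁻¹) *
        mul_inv_cancel₀ (hzp i) - D.res i j * A * B * mul_inv_cancel₀ (hwp i)
    rw [this]
    exact mul_ne_zero (mul_ne_zero (Finset.prod_ne_zero_iff.2 fun l _ => hzp l)
      (Finset.prod_ne_zero_iff.2 fun l _ => hwp l)) hj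

theorem eval_formX_eq_zero (h : D.Generic) {z : Fin 2 → ℂ} :
    eval z D.formX = 0 ↔ ∃ i, z 0 - D.r i * z 1 = 0 := by
  simp [formX, eval_prodLin, h.k_ne, Finset.prod_eq_zero_iff]

theorem eval_formW_of_root {z : Fin 2 → ℂ} {i : ι} (hi : z 0 - D.r i * z 1 = 0)
    (j : Fin 3) : eval z (D.formW j) =
      D.k * z 1 * (∏ l ∈ Finset.univ.erase i, (z 0 - D.r l * z 1)) * D.res i j := by
  have h1 := sum_res_of_root hi j fun _ => 1
  simp only [mul_one] at h1
  have h2 : ∏ l, (z 0 - D.r l * z 1) = 0 := Finset.prod_eq_zero (Finset.mem_univ i) hi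
  simp only [formW, map_mul, map_add, eval_C, eval_X, map_sum, eval_prodLin, h1, h2]
  ring

theorem no_common_zero (h : D.Generic) {z : Fin 2 → ℂ} (hz : z ≠ 0) :
    ∃ i, eval z (D.form i) ≠ 0 := by
  by_cases hX : eval z D.formX = 0
  · obtain ⟨i, hi⟩ := (eval_formX_eq_zero h).1 hX
    obtain ⟨h1, h2⟩ := prod_ne_of_root h hz hi
    refine ⟨3, ?_⟩
    change eval z (D.formW 2) ≠ 0
    rw [eval_formW_of_root hi]
    exact mul_ne_zero (mul_ne_zero (mul_ne_zero h.k_ne h1) h2) (exists_res_ne h.κ_ne i)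
  · exact ⟨0, hX⟩

theorem isEmbedding_form (h : D.Generic) (hι : 2 ≤ Fintype.card ι) : IsEmbedding D.form where
  no_common_zero z hz := no_common_zero h hz
  injective := by
    rintro z w hz hw ⟨c, hc⟩
    have hX : eval z D.formX = c * eval w D.formX := hc 0
    have hW : ∀ j, eval z (D.formW j) = c * eval w (D.formW j) := by
      intro j
      fin_cases j
      exacts [hc 1, hc 2, hc 3]
    have hc0 : c ≠ 0 := by
      rintro rfl
      obtain ⟨i, hi⟩ := no_common_zero h hz
      exact hi (by rw [hc, zero_mul])
    -- At a pole the image point has middle coordinates proportional to (m², m, 1), and the mᵢ are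
    -- distinct.
    have hsame : ∀ i i', z 0 - D.r i * z 1 = 0 → w 0 - D.r i' * w 1 = 0 → i = i' := by
      intro i i' hi hi'
      obtain ⟨h1, h2⟩ := prod_ne_of_root h hz hi
      obtain ⟨h3, h4⟩ := prod_ne_of_root h hw hi'
      have e1 := hW 1
      have e2 := hW 2
      rw [eval_formW_of_root hi, eval_formW_of_root hi'] at e1 e2
      simp only [res, dir, Matrix.cons_val, mul_one] at e1 e2
      set A := D.k * z 1 * ∏ l ∈ Finset.univ.erase i, (z 0 - D.r l * z 1)
      have hA : A * D.κ i ≠ 0 := mul_ne_zero (mul_ne_zero (mul_ne_zero h.k_ne h1) h2) (h.κ_ne i)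
      refine h.m_inj (mul_left_cancel₀ hA ?_)
      linear_combination e1 - D.m i' * e2
    -- Equal image points annihilate the left side of `formW_mul_sub`, while `delta` is nonzero, so
    -- the determinant vanishes.
    have hdet : z 1 * w 0 - z 0 * w 1 = 0 := by
      obtain ⟨j, hj⟩ := exists_eval_delta_ne h hw hz fun i i' hi hi' => (hsame i' i hi' hi).symm
      have := congrArg (eval z) (D.formW_mul_sub w j)
      simp only [map_sub, map_mul, eval_C, eval_X] at this
      rw [hX, hW] at this
      refine (mul_eq_zero.1 (?_ : _ * eval z (D.delta w j) = 0)).resolve_right hj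
      rw [← this]
      ring
    by_cases hw1 : w 1 = 0
    · have hw0 : w 0 ≠ 0 := fun hw0 => hw (by ext l; fin_cases l <;> simp [hw0, hw1])
      have hz1 : z 1 = 0 := by
        rw [hw1, mul_zero, sub_zero] at hdet
        exact (mul_eq_zero.1 hdet).resolve_right hw0
      refine ⟨z 0 / w 0, ?_⟩
      ext l
      fin_cases l
      · simp [hw0]
      · simp [hz1, hw1]
    · refine ⟨z 1 / w 1, ?_⟩
      ext l
      fin_cases l
      · simp only [Fin.zero_eta, Pi.smul_apply, smul_eq_mul]
        field_simp
        linear_combination - hdet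
      · simp [hw1]
  immersive := by
    intro z hz
    rw [Fintype.linearIndependent_iff]
    intro g hg
    have hg' : ∀ i, g 0 * eval z (pderiv 0 (D.form i)) + g 1 * eval z (pderiv 1 (D.form i)) = 0 := by
      intro i
      have := congrFun hg i
      simpa [Fin.sum_univ_two] using this
    have hgX := hg' 0
    have hgW : ∀ j, g 0 * eval z (pderiv 0 (D.formW j)) + g 1 * eval z (pderiv 1 (D.formW j)) = 0 := by
      intro j
      fin_cases j
      exacts [hg' 1, hg' 2, hg' 3]
    change g 0 * eval z (pderiv 0 D.formX) + g 1 * eval z (pderiv 1 D.formX) = 0 at hgX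
    obtain ⟨j, hj⟩ := exists_eval_delta_ne h hz hz fun i i' hi hi' => by
      obtain ⟨h1, -⟩ := prod_ne_of_root h hz hi
      exact h.r_inj (mul_right_cancel₀ h1 (by linear_combination hi' - hi))
    -- Differentiating `formW_mul_sub` on the diagonal shows that a vanishing combination of the
    -- partial derivatives points along z. Euler's relation then excludes a nonzero one.
    have hdet : g 1 * z 0 - g 0 * z 1 = 0 := by
      have e := D.formW_mul_sub z j
      have e0 := congrArg (fun p => eval z (pderiv 0 p)) e
      have e1 := congrArg (fun p => eval z (pderiv 1 p)) e
      simp only [map_sub, Derivation.leibniz, smul_eq_mul, pderiv_C, map_add, map_mul, eval_C, eval_X,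
        pderiv_X, Pi.single_apply] at e0 e1
      simp at e0 e1
      refine (mul_eq_zero.1 (?_ : _ * eval z (D.delta z j) = 0)).resolve_right hj
      linear_combination (- g 0) * e0 - g 1 * e1 + eval z D.formX * hgW j - eval z (D.formW j) * hgX
    obtain ⟨i, hi⟩ := no_common_zero h hz
    have heul := congrArg (eval z) (D.isHomogeneous_form hι i).sum_X_mul_pderiv
    simp only [Fin.sum_univ_two, map_add, map_mul, eval_X, nsmul_eq_mul, map_natCast] at heul
    have hcard : (Fintype.card ι : ℂ) ≠ 0 := Nat.cast_ne_zero.2 (by lia)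
    have hE : (Fintype.card ι : ℂ) * eval z (D.form i) ≠ 0 := mul_ne_zero hcard hi
    have e0 : g 0 * ((Fintype.card ι : ℂ) * eval z (D.form i)) = 0 := by
      linear_combination (- g 0) * heul + z 0 * hg' i - eval z (pderiv 1 (D.form i)) * hdet
    have e1 : g 1 * ((Fintype.card ι : ℂ) * eval z (D.form i)) = 0 := by
      linear_combination (- g 1) * heul + z 1 * hg' i + eval z (pderiv 0 (D.form i)) * hdet
    intro l
    fin_cases l
    · exact (mul_eq_zero.1 e0).resolve_right hE
    · exact (mul_eq_zero.1 e1).resolve_right hE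

end ConeData

end

/-! ### Genericity by transcendence degree -/

noncomputable section

theorem countable_algebraic_adjoin (K : Subfield ℂ) [Countable K] {s : Set ℂ} (hs : s.Countable) :
    {a : ℂ | IsAlgebraic (Algebra.adjoin K s) a}.Countable := by
  have : Countable (Algebra.adjoin K s) := by
    rw [← Cardinal.mk_le_aleph0_iff]
    refine (Algebra.cardinalMk_adjoin_le K s).trans ?_
    exact max_le (max_le (Cardinal.mk_le_aleph0_iff.2 inferInstance)
      (Cardinal.mk_le_aleph0_iff.2 hs.to_subtype)) le_rfl
  exact Algebraic.countable (Algebra.adjoin K s) ℂ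

/-- Each new number only has to avoid the countable set of reals algebraic over the previous ones,
whose complement is dense. -/
theorem exists_small_algebraicIndependent (K : Subfield ℂ) [Countable K] {δ : ℝ} (hδ : 0 < δ)
    (ι : Type) [Finite ι] :
    ∃ x : ι → ℝ, (∀ i, |x i| < δ) ∧ AlgebraicIndependent K (fun i => (x i : ℂ)) := by
  induction ι using Finite.induction_empty_option with
  | of_equiv e h =>
    obtain ⟨x, hx, hi⟩ := h
    refine ⟨x ∘ e.symm, fun i => hx _, ?_⟩
    have := (algebraicIndependent_equiv (R := K) (f := fun i => (x i : ℂ)) e.symm).2 hi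
    exact this
  | h_empty =>
    exact ⟨fun _ => 0, fun i => i.elim, algebraicIndependent_empty_type_iff.2
      (algebraMap K ℂ).injective⟩
  | h_option h =>
    obtain ⟨x, hx, hi⟩ := h
    have h1 : ((fun t : ℝ => (t : ℂ)) ⁻¹' {a : ℂ | IsAlgebraic
        (Algebra.adjoin K (Set.range fun i => (x i : ℂ))) a}).Countable :=
      (countable_algebraic_adjoin K (Set.countable_range _)).preimage Complex.ofReal_injective
    obtain ⟨t, ht, htδ⟩ := (h1.dense_compl ℝ).exists_mem_open (isOpen_Ioo (a := 0) (b := δ))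
      (Set.nonempty_Ioo.2 hδ)
    refine ⟨fun o => o.elim t x, ?_, ?_⟩
    · rintro (_ | i)
      · exact abs_lt.2 ⟨by simp only [Option.elim]; linarith [htδ.1], htδ.2⟩
      · exact hx i
    · convert (hi.option_iff_transcendental (t : ℂ)).2 ht using 1
      ext (_ | i) <;> rfl

/-- Rank in the matroid of algebraic independence: the closure of `T` has rank at most the number of
elements of `T`. -/
theorem AlgebraicIndependent.card_le_encard {K : Subfield ℂ} {ι : Type*} [Fintype ι] {x : ι → ℂ}
    (hx : AlgebraicIndependent K x) (T : Set ℂ)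
    (h : ∀ i, IsAlgebraic (Algebra.adjoin K T) (x i)) : (Fintype.card ι : ℕ∞) ≤ T.encard := by
  let M := AlgebraicIndependent.matroid K ℂ
  have h1 : M.Indep (Set.range x) := AlgebraicIndependent.matroid_indep_iff.2 hx.coe_range
  have h2 : Set.range x ⊆ M.closure T := by
    rintro _ ⟨i, rfl⟩
    rw [AlgebraicIndependent.matroid_closure_eq]
    exact h i
  have h3 := M.eRk_mono h2
  rw [h1.eRk_eq_encard, M.eRk_closure_eq] at h3
  refine le_trans (le_of_eq ?_) (h3.trans (M.eRk_le_encard T))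
  rw [← Set.image_univ, hx.injective.encard_image, Set.encard_univ]
  simp

theorem IsAlgebraic.sum {R A ι : Type*} [CommRing R] [IsDomain R] [CommRing A] [Algebra R A]
    (s : Finset ι) (f : ι → A) (h : ∀ i ∈ s, IsAlgebraic R (f i)) : IsAlgebraic R (∑ i ∈ s, f i) := by
  classical
  induction s using Finset.induction_on with
  | empty => simpa using isAlgebraic_zero
  | insert i s hi ih =>
    rw [Finset.sum_insert hi]
    exact (h i (Finset.mem_insert_self i s)).add (ih fun j hj => h j (Finset.mem_insert_of_mem hj))

/-- A root of `(z₀ - r z₁) (w₀ - r w₁) = u` is algebraic over the coefficients. -/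
theorem isAlgebraic_of_mul_eq {R : Type*} [CommRing R] [IsDomain R] [Algebra R ℂ]
    {z w : Fin 2 → ℂ} {r u : ℂ} (hz0 : IsAlgebraic R (z 0)) (hw0 : IsAlgebraic R (w 0))
    (hz1 : z 1 = 1 ∨ z 1 = 0 ∧ z 0 = 1) (hw1 : w 1 = 1 ∨ w 1 = 0 ∧ w 0 = 1)
    (hzw : ¬ (z 1 = 0 ∧ w 1 = 0)) (hu : IsAlgebraic R u)
    (h : (z 0 - r * z 1) * (w 0 - r * w 1) = u) : IsAlgebraic R r := by
  have two : IsAlgebraic R (2 : ℂ) := by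
    rw [← one_add_one_eq_two]
    exact isAlgebraic_one.add isAlgebraic_one
  rcases hz1 with hz1 | ⟨hz1, hz0'⟩ <;> rcases hw1 with hw1 | ⟨hw1, hw0'⟩
  · have h1 : (2 * r - (z 0 + w 0)) ^ 2 = (z 0 - w 0) ^ 2 + 2 * 2 * u := by
      rw [← h, hz1, hw1]
      ring
    have h2 : IsAlgebraic R (2 * r - (z 0 + w 0)) := IsAlgebraic.of_pow two_pos
      (h1 ▸ ((hz0.sub hw0).pow 2).add ((two.mul two).mul hu))
    have h3 : r = ((2 * r - (z 0 + w 0)) + (z 0 + w 0)) * 2⁻¹ := by ring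
    rw [h3]
    exact (h2.add (hz0.add hw0)).mul two.inv
  · have h3 : r = z 0 - u := by
      rw [← h, hz1, hw1, hw0']
      ring
    rw [h3]
    exact hz0.sub hu
  · have h3 : r = w 0 - u := by
      rw [← h, hz1, hw1, hz0']
      ring
    rw [h3]
    exact hw0.sub hu
  · exact absurd ⟨hz1, hw1⟩ hzw

theorem exists_smul_normalized {z : Fin 2 → ℂ} (hz : z ≠ 0) : ∃ (c : ℂ) (y : Fin 2 → ℂ), c ≠ 0 ∧
    z = c • y ∧ (y 1 = 1 ∨ y 1 = 0 ∧ y 0 = 1) := by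
  by_cases h : z 1 = 0
  · have h0 : z 0 ≠ 0 := fun h0 => hz (by ext i; fin_cases i <;> simp [h, h0])
    exact ⟨z 0, ![1, 0], h0, by ext i; fin_cases i <;> simp [h], by simp⟩
  · refine ⟨z 1, ![z 0 / z 1, 1], h, ?_, by simp⟩
    ext i
    fin_cases i
    · simp; field_simp
    · simp

namespace ConeData

variable {ι : Type*} [Fintype ι] [DecidableEq ι] {D : ConeData ι}

/-- Suppose all three sums vanish. Given z, w and all roots but three, the equations determine the
remaining terms 1/((z - rᵢ)(w - rᵢ)), hence the remaining roots up to algebraic dependence. Then n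
roots would be algebraic over n - 1 elements, against `hr`. -/
theorem exists_sum_ne_of_normalized {K : Subfield ℂ} (hκ : ∀ i, D.κ i ∈ K) (hm : ∀ i, D.m i ∈ K)
    (hκ0 : ∀ i, D.κ i ≠ 0) (hmi : Function.Injective D.m) (hsum : ∑ i, D.κ i ≠ 0)
    (hι : 2 ≤ Fintype.card ι)
    (hr : ∀ T : Set ℂ, (∀ i, IsAlgebraic (Algebra.adjoin K T) (D.r i)) →
      (Fintype.card ι : ℕ∞) ≤ T.encard)
    {z w : Fin 2 → ℂ} (hz : z 1 = 1 ∨ z 1 = 0 ∧ z 0 = 1) (hw : w 1 = 1 ∨ w 1 = 0 ∧ w 0 = 1)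
    (hzr : ∀ i, z 0 - D.r i * z 1 ≠ 0) (hwr : ∀ i, w 0 - D.r i * w 1 ≠ 0) :
    ∃ j, ∑ i, D.res i j * ((z 0 - D.r i * z 1) * (w 0 - D.r i * w 1))⁻¹ ≠ 0 := by
  by_contra! hcon
  set e : ι → ℂ := fun i => ((z 0 - D.r i * z 1) * (w 0 - D.r i * w 1))⁻¹ with he
  have he0 : ∀ i, e i ≠ 0 := fun i => inv_ne_zero (mul_ne_zero (hzr i) (hwr i))
  have h0 : ∑ i, D.κ i * D.m i ^ 2 * e i = 0 := by simpa only [res, dir, Matrix.cons_val, mul_one] using hcon 0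
  have h1 : ∑ i, D.κ i * D.m i * e i = 0 := by simpa only [res, dir, Matrix.cons_val, mul_one] using hcon 1
  have h2 : ∑ i, D.κ i * e i = 0 := by simpa only [res, dir, Matrix.cons_val, mul_one] using hcon 2
  -- When both parameters are at infinity the last sum reduces to Σ κᵢ, so it does not vanish.
  have hzw : ¬ (z 1 = 0 ∧ w 1 = 0) := by
    rintro ⟨hz1, hw1⟩
    have hz0 : z 0 = 1 := by simpa [hz1] using hz
    have hw0 : w 0 = 1 := by simpa [hw1] using hw
    apply hsum
    simpa [he, hz1, hw1, hz0, hw0] using h2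
  -- Combinations of the three equations with weights (m - m_b), and below (m - m_b)(m - m_c),
  -- eliminate the chosen indices.
  have hlin : ∀ b, ∑ i, D.κ i * (D.m i - D.m b) * e i = 0 := fun b => by
    have : ∑ i, D.κ i * (D.m i - D.m b) * e i = ∑ i, D.κ i * D.m i * e i -
        D.m b * ∑ i, D.κ i * e i := by
      rw [Finset.mul_sum, ← Finset.sum_sub_distrib]
      exact Finset.sum_congr rfl fun i _ => by ring
    rw [this, h1, h2, mul_zero, sub_zero]
  have hquad : ∀ b c, ∑ i, D.κ i * (D.m i - D.m b) * (D.m i - D.m c) * e i = 0 := fun b c => by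
    have : ∑ i, D.κ i * (D.m i - D.m b) * (D.m i - D.m c) * e i = ∑ i, D.κ i * D.m i ^ 2 * e i -
        (D.m b + D.m c) * ∑ i, D.κ i * D.m i * e i + D.m b * D.m c * ∑ i, D.κ i * e i := by
      rw [Finset.mul_sum, Finset.mul_sum, ← Finset.sum_sub_distrib, ← Finset.sum_add_distrib]
      exact Finset.sum_congr rfl fun i _ => by ring
    rw [this, h0, h1, h2]
    ring
  rcases hι.eq_or_lt with hι2 | hι3
  · -- two roots
    obtain ⟨a, b, hab, huniv⟩ := Finset.card_eq_two.1 (show (Finset.univ : Finset ι).card = 2 from hι2.symm)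
    have := hlin b
    rw [Finset.sum_eq_single a (fun i _ hi => by
      have : i = b := by
        have hi' := Finset.mem_univ i
        rw [huniv, Finset.mem_insert, Finset.mem_singleton] at hi'
        exact hi'.resolve_left hi
      rw [this]; ring) (by simp)] at this
    exact mul_ne_zero (mul_ne_zero (hκ0 a) (sub_ne_zero.2 fun h => hab (hmi h))) (he0 a) this
  · obtain ⟨a, b, c, hab, hac, hbc⟩ := Fintype.two_lt_card_iff.1 hι3
    let S : Finset ι := ((Finset.univ.erase a).erase b).erase c
    -- z₀, w₀ and the n - 3 roots in `S`: at most n - 1 elements.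
    let T : Set ℂ := {z 0, w 0} ∪ D.r '' S
    have hS : S.card + 3 = Fintype.card ι := by
      have e1 : (Finset.univ.erase a).card + 1 = Fintype.card ι :=
        Finset.card_erase_add_one (Finset.mem_univ a)
      have e2 : ((Finset.univ.erase a).erase b).card + 1 = (Finset.univ.erase a).card :=
        Finset.card_erase_add_one (by simp [hab.symm])
      have e3 : S.card + 1 = ((Finset.univ.erase a).erase b).card :=
        Finset.card_erase_add_one (by simp [hac.symm, hbc.symm])
      lia
    have hT : T.encard ≤ (2 : ℕ) + (S.card : ℕ∞) := by
      refine (Set.encard_union_le _ _).trans (add_le_add ?_ ?_)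
      · refine (Set.encard_insert_le _ _).trans ?_
        rw [Set.encard_singleton]
        norm_num
      · refine (Set.encard_image_le _ _).trans ?_
        rw [Set.encard_coe_eq_coe_finsetCard]
    have hsub : ∀ x ∈ T, IsAlgebraic (Algebra.adjoin K T) x := fun x hx =>
      isAlgebraic_algebraMap (⟨x, Algebra.subset_adjoin hx⟩ : Algebra.adjoin K T)
    have hKalg : ∀ x ∈ K, IsAlgebraic (Algebra.adjoin K T) x := fun x hx =>
      isAlgebraic_algebraMap (A := ℂ) (algebraMap K (Algebra.adjoin K T) ⟨x, hx⟩)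
    have hz0 := hsub (z 0) (by simp [T])
    have hw0 := hsub (w 0) (by simp [T])
    have hcoord : ∀ y : Fin 2 → ℂ, (y 1 = 1 ∨ y 1 = 0 ∧ y 0 = 1) →
        IsAlgebraic (Algebra.adjoin K T) (y 1) := by
      rintro y (hy | ⟨hy, -⟩) <;> rw [hy]
      · exact isAlgebraic_one
      · exact isAlgebraic_zero
    have heS : ∀ i ∈ S, IsAlgebraic (Algebra.adjoin K T) (e i) := fun i hi => by
      have hri := hsub (D.r i) (Or.inr ⟨i, hi, rfl⟩)
      exact ((hz0.sub (hri.mul (hcoord z hz))).mul (hw0.sub (hri.mul (hcoord w hw)))).inv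
    -- With b' and c' eliminated, e a' is a combination of the terms from `S`; it is therefore
    -- algebraic, and so is the root r a'.
    have key : ∀ a' b' c', a' ≠ b' → a' ≠ c' → (∀ i, i ≠ a' → i ≠ b' → i ≠ c' → i ∈ S) →
        IsAlgebraic (Algebra.adjoin K T) (D.r a') := by
      intro a' b' c' hab' hac' hS'
      have hq := hquad b' c'
      rw [← Finset.add_sum_erase _ _ (Finset.mem_univ a')] at hq
      have hne : D.κ a' * (D.m a' - D.m b') * (D.m a' - D.m c') ≠ 0 :=
        mul_ne_zero (mul_ne_zero (hκ0 a') (sub_ne_zero.2 fun h => hab' (hmi h)))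
          (sub_ne_zero.2 fun h => hac' (hmi h))
      have hsumalg : IsAlgebraic (Algebra.adjoin K T) (∑ i ∈ Finset.univ.erase a',
          D.κ i * (D.m i - D.m b') * (D.m i - D.m c') * e i) := by
        refine IsAlgebraic.sum _ _ fun i hi => ?_
        by_cases hib : i = b'
        · rw [hib]
          simpa using isAlgebraic_zero
        by_cases hic : i = c'
        · rw [hic]
          simpa using isAlgebraic_zero
        have hD := (hKalg _ (K.mul_mem (K.mul_mem (hκ i) (K.sub_mem (hm i) (hm b')))
          (K.sub_mem (hm i) (hm c'))))
        exact hD.mul (heS i (hS' i (Finset.mem_erase.1 hi).1 hib hic))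
      have hea : e a' = -(D.κ a' * (D.m a' - D.m b') * (D.m a' - D.m c'))⁻¹ *
          ∑ i ∈ Finset.univ.erase a', D.κ i * (D.m i - D.m b') * (D.m i - D.m c') * e i := by
        rw [eq_neg_of_add_eq_zero_right hq]
        set A := D.κ a' * (D.m a' - D.m b') * (D.m a' - D.m c')
        linear_combination (-e a') * mul_inv_cancel₀ hne
      have hea' : IsAlgebraic (Algebra.adjoin K T) (e a') := by
        rw [hea]
        exact ((hKalg _ (K.mul_mem (K.mul_mem (hκ a') (K.sub_mem (hm a') (hm b')))
          (K.sub_mem (hm a') (hm c')))).inv.neg).mul hsumalg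
      exact isAlgebraic_of_mul_eq hz0 hw0 hz hw hzw hea'.inv (by rw [he, inv_inv])
    have hall : ∀ i, IsAlgebraic (Algebra.adjoin K T) (D.r i) := by
      intro i
      by_cases hia : i = a
      · rw [hia]
        exact key a b c hab hac fun i h1 h2 h3 => by simp [S, h1, h2, h3]
      by_cases hib : i = b
      · rw [hib]
        exact key b a c hab.symm hbc fun i h1 h2 h3 => by simp [S, h1, h2, h3]
      by_cases hic : i = c
      · rw [hic]
        exact key c a b hac.symm hbc.symm fun i h1 h2 h3 => by simp [S, h1, h2, h3]
      exact hsub _ (Or.inr ⟨i, by simp [S, hia, hib, hic], rfl⟩)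
    have hle := (hr T hall).trans hT
    have : Fintype.card ι ≤ 2 + S.card := by exact_mod_cast hle
    lia

theorem generic_of_rank {K : Subfield ℂ} (hκ : ∀ i, D.κ i ∈ K) (hm : ∀ i, D.m i ∈ K) (hk : D.k ≠ 0)
    (hκ0 : ∀ i, D.κ i ≠ 0) (hmi : Function.Injective D.m) (hri : Function.Injective D.r)
    (hsum : ∑ i, D.κ i ≠ 0) (hι : 2 ≤ Fintype.card ι)
    (hr : ∀ T : Set ℂ, (∀ i, IsAlgebraic (Algebra.adjoin K T) (D.r i)) →
      (Fintype.card ι : ℕ∞) ≤ T.encard) : D.Generic where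
  k_ne := hk
  κ_ne := hκ0
  r_inj := hri
  m_inj := hmi
  sum_ne := by
    intro z w hz hw hzr hwr
    obtain ⟨c, z, hc, rfl, hz'⟩ := exists_smul_normalized hz
    obtain ⟨c', w, hc', rfl, hw'⟩ := exists_smul_normalized hw
    have e1 : ∀ (c : ℂ) (z : Fin 2 → ℂ) i, (c • z) 0 - D.r i * (c • z) 1 = c * (z 0 - D.r i * z 1) :=
      fun c z i => by simp only [Pi.smul_apply, smul_eq_mul]; ring
    simp only [e1] at hzr hwr ⊢
    obtain ⟨j, hj⟩ := exists_sum_ne_of_normalized hκ hm hκ0 hmi hsum hι hr hz' hw'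
      (fun i => right_ne_zero_of_mul (hzr i)) (fun i => right_ne_zero_of_mul (hwr i))
    refine ⟨j, ?_⟩
    have : ∑ i, D.res i j * (c * (z 0 - D.r i * z 1) * (c' * (w 0 - D.r i * w 1)))⁻¹ =
        (c * c')⁻¹ * ∑ i, D.res i j * ((z 0 - D.r i * z 1) * (w 0 - D.r i * w 1))⁻¹ := by
      rw [Finset.mul_sum]
      refine Finset.sum_congr rfl fun i _ => ?_
      rw [mul_mul_mul_comm, mul_inv]
      ring
    rw [this]
    exact mul_ne_zero (inv_ne_zero (mul_ne_zero hc hc')) hj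

end ConeData

end

/-! ### Every curve in general position has a partial fraction description -/

noncomputable section

set_option linter.unusedSectionVars false

section dehomogenize

open MvPolynomial

variable {R : Type*} [CommRing R]

/-- The univariate polynomial `f (X, 1)`. -/
def dehom (f : MvPolynomial (Fin 2) R) : Polynomial R := aeval ![Polynomial.X, 1] f

theorem eval_dehom (f : MvPolynomial (Fin 2) R) (ζ : R) : (dehom f).eval ζ = eval ![ζ, 1] f := by
  unfold dehom
  induction f using MvPolynomial.induction_on with
  | C a => simp
  | add p q hp hq => simp [hp, hq]
  | mul_X p i hp => fin_cases i <;> simp [hp]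

theorem dehom_pderiv (f : MvPolynomial (Fin 2) R) :
    dehom (pderiv 0 f) = Polynomial.derivative (dehom f) := by
  unfold dehom
  induction f using MvPolynomial.induction_on with
  | C a => simp
  | add p q hp hq => simp [hp, hq]
  | mul_X p i hp =>
    fin_cases i
    · simp [hp, Derivation.leibniz, pderiv_X]
      ring
    · simp [hp, Derivation.leibniz, pderiv_X]

variable {d : ℕ} {f : MvPolynomial (Fin 2) R}

theorem homogenize_dehom (hf : f.IsHomogeneous d) : (dehom f).homogenize d = f :=
  Polynomial.homogenize_eq_of_isHomogeneous hf rfl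

theorem natDegree_dehom_le (hf : f.IsHomogeneous d) : (dehom f).natDegree ≤ d := by
  rw [dehom, f.as_sum, map_sum]
  refine Polynomial.natDegree_sum_le_of_forall_le _ _ fun m hm => ?_
  have h1 : m.weight 1 = d := hf (by simpa using hm)
  have h2 : m 0 + m 1 = d := by
    rw [← h1]
    simp [Finsupp.weight_apply, Finsupp.sum_fintype, Fin.sum_univ_two]
  rw [aeval_monomial]
  simp only [Finsupp.prod_fintype, pow_zero, Fin.prod_univ_two, Matrix.cons_val_zero,
    Matrix.cons_val_one, one_pow, mul_one, implies_true]
  rw [← Polynomial.C_eq_algebraMap]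
  exact (Polynomial.natDegree_C_mul_X_pow_le _ _).trans (by lia)

theorem coeff_dehom (hf : f.IsHomogeneous d) : (dehom f).coeff d = eval ![1, 0] f := by
  conv_rhs => rw [← homogenize_dehom hf]
  rw [Polynomial.homogenize, map_sum, Finset.sum_eq_single (d, 0)]
  · rw [eval_monomial]
    simp [Finsupp.prod_fintype, Fin.prod_univ_two]
  · rintro ⟨a, b⟩ hab hne
    have hb : b ≠ 0 := by
      rintro rfl
      rw [Finset.HasAntidiagonal.mem_antidiagonal] at hab
      simp only [add_zero] at hab
      exact hne (by rw [hab])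
    rw [eval_monomial]
    simp [Finsupp.prod_fintype, Fin.prod_univ_two, hb]
  · simp

end dehomogenize

open MvPolynomial in
/-- A binary form of degree `d` that vanishes at `[1 : 0]` and at `d` other points is zero. -/
theorem eq_zero_of_eval_eq_zero {ι : Type*} [Fintype ι] {r : ι → ℂ} (hr : Function.Injective r)
    {f : MvPolynomial (Fin 2) ℂ} (hf : f.IsHomogeneous (Fintype.card ι)) (h0 : eval ![1, 0] f = 0)
    (h : ∀ i, eval ![r i, 1] f = 0) : f = 0 := by
  have h1 : dehom f = 0 := by
    refine Polynomial.eq_zero_of_degree_lt_of_eval_index_eq_zero (v := r) Finset.univ hr.injOn ?_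
      fun i _ => by rw [eval_dehom, h]
    rw [Finset.card_univ, Polynomial.degree_lt_iff_coeff_zero]
    intro m hm
    rcases hm.eq_or_lt with rfl | hm
    · rw [coeff_dehom hf, h0]
    · exact Polynomial.coeff_eq_zero_of_natDegree_lt ((natDegree_dehom_le hf).trans_lt hm)
  rw [← homogenize_dehom hf, h1, Polynomial.homogenize_zero]

namespace ConeData

open MvPolynomial

variable {ι : Type*} [Fintype ι] [DecidableEq ι] (D : ConeData ι)

/-- The data are invariant under complex conjugation, which acts on the roots by `τ`. -/
structure IsReal (τ : Equiv.Perm ι) : Prop where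
  invol : ∀ i, τ (τ i) = i
  k : starRingEnd ℂ D.k = D.k
  c : ∀ j, starRingEnd ℂ (D.c j) = D.c j
  r : ∀ i, starRingEnd ℂ (D.r i) = D.r (τ i)
  κ : ∀ i, starRingEnd ℂ (D.κ i) = D.κ (τ i)
  m : ∀ i, starRingEnd ℂ (D.m i) = D.m (τ i)

variable {D} {τ : Equiv.Perm ι}

theorem IsReal.map_prodLin (h : D.IsReal τ) (S : Finset ι) :
    map (starRingEnd ℂ) (D.prodLin S) = D.prodLin (S.map τ.toEmbedding) := by
  simp [prodLin, lin, map_prod, h.r]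

theorem map_erase_equiv (S : Finset ι) (i : ι) :
    (S.erase i).map τ.toEmbedding = (S.map τ.toEmbedding).erase (τ i) :=
  Finset.map_erase _ _ _

theorem IsReal.conj_res (h : D.IsReal τ) (i : ι) (j : Fin 3) :
    starRingEnd ℂ (D.res i j) = D.res (τ i) j := by
  fin_cases j <;> simp [res, dir, h.κ, h.m]

theorem IsReal.conj_polar (h : D.IsReal τ) (i j : ι) :
    starRingEnd ℂ (ConeData.polar (D.res i) (D.res j)) = ConeData.polar (D.res (τ i)) (D.res (τ j)) := by
  simp [ConeData.polar, h.conj_res, Complex.conj_ofNat]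

theorem IsReal.conj_polar_c (h : D.IsReal τ) (i : ι) :
    starRingEnd ℂ (polar D.c (D.res i)) = polar D.c (D.res (τ i)) := by
  simp [ConeData.polar, h.conj_res, h.c, Complex.conj_ofNat]

theorem IsReal.map_form (h : D.IsReal τ) (i : Fin 5) :
    map (starRingEnd ℂ) (D.form i) = D.form i := by
  have hu : (Finset.univ : Finset ι).map τ.toEmbedding = Finset.univ := by simp
  have hX : map (starRingEnd ℂ) D.formX = D.formX := by
    simp only [formX, map_mul, map_C, h.k, h.map_prodLin, hu]
  have hW : ∀ j, map (starRingEnd ℂ) (D.formW j) = D.formW j := by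
    intro j
    simp only [formW, map_mul, map_add, map_C, map_X, map_sum, h.k, h.c, h.map_prodLin, hu, h.conj_res,
      map_erase_equiv]
    rw [Equiv.sum_comp τ (fun i => C (D.res i j) * D.prodLin (Finset.univ.erase i))]
  have hY : map (starRingEnd ℂ) D.formY = D.formY := by
    have hc : starRingEnd ℂ (polar D.c D.c / 2) = polar D.c D.c / 2 := by
      simp [ConeData.polar, h.c, Complex.conj_ofNat]
    simp only [formY, map_mul, map_add, map_C, map_X, map_sum, map_pow, h.k, hc, h.map_prodLin, hu,
      h.conj_polar_c, map_erase_equiv, map_div₀, h.conj_polar, map_ofNat]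
    rw [Equiv.sum_comp τ (fun i => C (polar D.c (D.res i)) * D.prodLin (Finset.univ.erase i))]
    simp only [fun i => Equiv.sum_comp τ (fun j => C (polar (D.res (τ i)) (D.res j) / 2) *
      D.prodLin ((Finset.univ.erase (τ i)).erase j))]
    rw [Equiv.sum_comp τ (fun i => ∑ j, C (polar (D.res i) (D.res j) / 2) *
      D.prodLin ((Finset.univ.erase i).erase j))]
  fin_cases i
  exacts [hX, hW 0, hW 1, hW 2, hY]

theorem eval_one_zero_prodLin (S : Finset ι) : eval ![1, 0] (D.prodLin S) = 1 := by
  simp [eval_prodLin]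

theorem prod_sub_conj (hr : ∀ i, starRingEnd ℂ (D.r i) = D.r (τ i)) (i : ι) :
    starRingEnd ℂ (∏ l ∈ Finset.univ.erase i, (D.r i - D.r l)) =
      ∏ l ∈ Finset.univ.erase (τ i), (D.r (τ i) - D.r l) := by
  rw [map_prod]
  refine Finset.prod_equiv τ (by simp) fun l _ => ?_
  rw [map_sub, hr, hr]

end ConeData

open MvPolynomial in
theorem star_eval {f : MvPolynomial (Fin 2) ℂ} (hf : map (starRingEnd ℂ) f = f) (z : Fin 2 → ℂ) :
    starRingEnd ℂ (eval z f) = eval (fun i => starRingEnd ℂ (z i)) f := by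
  conv_rhs => rw [← hf]
  exact map_eval _ z f

open MvPolynomial in
/-- Every conjugation-invariant curve on the cone whose first coordinate has simple finite roots,
at which the fourth coordinate does not vanish, is described by `ConeData`. -/
theorem exists_coneData {d : ℕ} {G : Fin 5 → MvPolynomial (Fin 2) ℂ}
    (hd : 2 ≤ d) (hG : ∀ i, (G i).IsHomogeneous d) (hN : G 0 * G 4 - G 1 * G 3 + G 2 ^ 2 = 0)
    (hconj : ∀ i, map (starRingEnd ℂ) (G i) = G i) (hX : eval ![1, 0] (G 0) ≠ 0)
    (hs : ∀ ζ, eval ![ζ, 1] (G 0) = 0 → eval ![ζ, 1] (pderiv 0 (G 0)) ≠ 0)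
    (hC : ∀ ζ, eval ![ζ, 1] (G 0) = 0 → eval ![ζ, 1] (G 3) ≠ 0) :
    ∃ (ι : Type) (_ : Fintype ι) (_ : DecidableEq ι) (D : ConeData ι) (τ : Equiv.Perm ι),
      Fintype.card ι = d ∧ D.IsReal τ ∧ D.k ≠ 0 ∧ Function.Injective D.r ∧ (∀ i, D.κ i ≠ 0) ∧
        D.form = G := by
  set p := dehom (G 0) with hp
  have hcoeff : p.coeff d ≠ 0 := by rwa [hp, coeff_dehom (hG 0)]
  have hp0 : p ≠ 0 := fun h => hcoeff (by simp [h])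
  have hdeg : p.natDegree = d :=
    le_antisymm (natDegree_dehom_le (hG 0)) (Polynomial.le_natDegree_of_ne_zero hcoeff)
  have hnodup : p.roots.Nodup := by
    rw [Multiset.nodup_iff_count_le_one]
    intro ζ
    rw [Polynomial.count_roots]
    by_contra! h
    obtain ⟨h1, h2⟩ := (Polynomial.one_lt_rootMultiplicity_iff_isRoot hp0).1 h
    refine hs ζ ?_ ?_
    · rw [← eval_dehom]; exact h1
    · rw [← eval_dehom, dehom_pderiv]; exact h2
  let S := p.roots.toFinset
  have hmemS : ∀ ζ, ζ ∈ S ↔ eval ![ζ, 1] (G 0) = 0 := fun ζ => by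
    rw [Multiset.mem_toFinset, Polynomial.mem_roots hp0, Polynomial.IsRoot, eval_dehom]
  have hcardS : Fintype.card S = d := by
    rw [Fintype.card_coe, Multiset.toFinset_card_of_nodup hnodup, IsAlgClosed.card_roots_eq_natDegree,
      hdeg]
  have hstar : ∀ (ζ : ℂ) i, starRingEnd ℂ (eval ![ζ, 1] (G i)) = eval ![starRingEnd ℂ ζ, 1] (G i) := by
    intro ζ i
    rw [star_eval (hconj i)]
    congr 1
    congr 1
    ext j
    fin_cases j <;> simp
  have hstar' : ∀ i, starRingEnd ℂ (eval ![1, 0] (G i)) = eval ![1, 0] (G i) := by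
    intro i
    rw [star_eval (hconj i)]
    congr 1
    congr 1
    ext j
    fin_cases j <;> simp
  have hτ : ∀ ζ : S, starRingEnd ℂ ζ.1 ∈ S := fun ζ => by
    rw [hmemS, ← hstar, (hmemS _).1 ζ.2, map_zero]
  let τ : Equiv.Perm S := Function.Involutive.toPerm (fun ζ => ⟨starRingEnd ℂ ζ.1, hτ ζ⟩)
    fun ζ => Subtype.ext (by simp)
  let k := eval ![1, 0] (G 0)
  let P : S → ℂ := fun i => ∏ l ∈ Finset.univ.erase i, (i.1 - l.1)
  have hP : ∀ i, P i ≠ 0 := fun i => Finset.prod_ne_zero_iff.2 fun l hl h =>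
    (Finset.mem_erase.1 hl).1 (Subtype.ext (sub_eq_zero.1 h).symm)
  -- Partial fractions of (G₁, G₂, G₃)/G₀: `c` is the value at infinity and `κ` the residue of
  -- G₃/G₀. At a root G₁G₃ = G₂², so the residue vector is a multiple of (m², m, 1) with m = G₂/G₃.
  let D : ConeData S :=
    { k := k
      c := fun j => eval ![1, 0] (G (j.succ.castSucc)) / k
      r := fun i => i.1
      κ := fun i => eval ![i.1, 1] (G 3) / (k * P i)
      m := fun i => eval ![i.1, 1] (G 2) / eval ![i.1, 1] (G 3) }
  have hk : k ≠ 0 := hX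
  have hκ : ∀ i, D.κ i ≠ 0 := fun i => div_ne_zero (hC _ ((hmemS _).1 i.2)) (mul_ne_zero hk (hP i))
  have hreal : D.IsReal τ :=
    { invol := Function.Involutive.toPerm_involutive _
      k := hstar' 0
      c := fun j => by simp only [D, map_div₀, hstar', k]
      r := fun i => rfl
      κ := fun i => by
        have := ConeData.prod_sub_conj (D := D) (τ := τ) (fun i => rfl) i
        have h' : starRingEnd ℂ (P i) = P (τ i) := this
        simp only [D, map_div₀, map_mul, hstar, h', k, hstar']
        rfl
      m := fun i => by
        simp only [D, map_div₀, hstar]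
        rfl }
  have hri : Function.Injective D.r := Subtype.val_injective
  have hhom := fun i => D.isHomogeneous_form (by rw [hcardS]; exact hd) i
  have hevX : ∀ i : S, eval ![i.1, 1] (D.form 0) = 0 := fun i => by
    change eval _ D.formX = 0
    rw [ConeData.formX, map_mul, ConeData.eval_prodLin, Finset.prod_eq_zero (Finset.mem_univ i), mul_zero]
    simp [D]
  have hFX : D.form 0 = G 0 := by
    rw [← sub_eq_zero]
    refine eq_zero_of_eval_eq_zero hri ((hhom 0).sub (hcardS ▸ hG 0)) ?_ fun i => ?_
    · change eval _ (D.formX - _) = 0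
      rw [map_sub, ConeData.formX, map_mul, D.eval_one_zero_prodLin]
      simp [D, k]
    · rw [map_sub, hevX, (hmemS _).1 i.2, sub_zero]
  have hWroot : ∀ i : S, eval ![i.1, 1] (G 1) * eval ![i.1, 1] (G 3) = eval ![i.1, 1] (G 2) ^ 2 := by
    intro i
    have h1 := congrArg (eval ![i.1, 1]) hN
    have h2 := (hmemS _).1 i.2
    simp only [map_add, map_sub, map_mul, map_pow, map_zero, h2] at h1
    linear_combination - h1
  -- Both sides are forms of degree d that agree at [1:0] and at the d roots.
  have hFW : ∀ j : Fin 3, D.formW j = G (j.succ.castSucc) := by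
    intro j
    have hhomW : (D.formW j).IsHomogeneous (Fintype.card S) := by
      fin_cases j
      exacts [hhom 1, hhom 2, hhom 3]
    rw [← sub_eq_zero]
    refine eq_zero_of_eval_eq_zero hri (hhomW.sub (hcardS ▸ hG _)) ?_ fun i => ?_
    · simp only [map_sub, ConeData.formW, map_mul, map_add, eval_C, eval_X, D.eval_one_zero_prodLin]
      simp [D]
      field_simp
      ring
    · have h0 : (![i.1, 1] : Fin 2 → ℂ) 0 - D.r i * (![i.1, 1] : Fin 2 → ℂ) 1 = 0 := by simp [D]
      rw [map_sub, ConeData.eval_formW_of_root h0]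
      have hprod : ∏ l ∈ Finset.univ.erase i, ((![i.1, 1] : Fin 2 → ℂ) 0 - D.r l *
          (![i.1, 1] : Fin 2 → ℂ) 1) = P i := by
        refine Finset.prod_congr rfl fun l _ => ?_
        simp [D]
      have h3 := hC _ ((hmemS _).1 i.2)
      have hw := hWroot i
      have hPi := hP i
      rw [hprod]
      fin_cases j
      · simp [ConeData.res, ConeData.dir, D]
        field_simp
        linear_combination - hw
      · simp [ConeData.res, ConeData.dir, D]
        field_simp
        ring
      · simp [ConeData.res, ConeData.dir, D]
        field_simp
        ring
  -- The last coordinate is determined by the cone equation, since G₀ can be cancelled.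
  have hFY : D.form 4 = G 4 := by
    have hX0 : G 0 ≠ 0 := fun h => hX (by simp [h])
    refine mul_left_cancel₀ hX0 ?_
    have h1 := D.formX_mul_formY
    rw [hFW, hFW, hFW] at h1
    have h2 : D.formX = G 0 := hFX
    rw [h2] at h1
    change G 0 * D.formY = _
    have h3 : G 0 * D.formY - G 1 * G 3 + G 2 ^ 2 = 0 := h1
    linear_combination h3 - hN
  refine ⟨S, inferInstance, inferInstance, D, τ, hcardS, hreal, hk, hri, hκ, ?_⟩
  ext1 i
  fin_cases i
  exacts [hFX, hFW 0, hFW 1, hFW 2, hFY]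

end

/-! ### Approximation by embedded real curves -/

noncomputable section

set_option linter.unusedSectionVars false

namespace ConeData

open MvPolynomial

variable {ι : Type} [Fintype ι] [DecidableEq ι] (D : ConeData ι)

/-- A conjugation-equivariant deformation of the data. -/
def perturb (τ : Equiv.Perm ι) (e : ℝ) (x : ι → ℝ) : ConeData ι where
  k := D.k
  c := D.c
  -- The increment at τ i is the conjugate of that at i, and both x i and x (τ i) can be recovered
  -- from the two increments. Reality is kept and algebraic independence is inherited.
  r i := D.r i + ((1 + Complex.I) * x i + (1 - Complex.I) * x (τ i))
  -- The real shift makes the sum of the κᵢ nonzero; in the next line the multiples of the distinct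
  -- rᵢ separate the mᵢ.
  κ i := D.κ i + e
  m i := D.m i + e * D.r i

variable {D} {τ : Equiv.Perm ι}

theorem IsReal.perturb (h : D.IsReal τ) (e : ℝ) (x : ι → ℝ) : (D.perturb τ e x).IsReal τ where
  invol := h.invol
  k := h.k
  c := h.c
  r i := by
    simp only [ConeData.perturb, map_add, map_mul, map_sub, map_one, Complex.conj_I, Complex.conj_ofReal,
      h.r, h.invol]
    ring
  κ i := by simp only [ConeData.perturb, map_add, h.κ, Complex.conj_ofReal]
  m i := by simp only [ConeData.perturb, map_add, map_mul, h.m, h.r, Complex.conj_ofReal]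

/-- All coefficients of a family of polynomials are continuous. -/
def ContCoeff {P : Type*} [TopologicalSpace P] (f : P → MvPolynomial (Fin 2) ℂ) : Prop :=
  ∀ n, Continuous fun q => coeff n (f q)

namespace ContCoeff

variable {P : Type*} [TopologicalSpace P] {f g : P → MvPolynomial (Fin 2) ℂ}

theorem const (p : MvPolynomial (Fin 2) ℂ) : ContCoeff fun _ : P => p := fun _ => continuous_const

theorem C {a : P → ℂ} (ha : Continuous a) : ContCoeff fun q => MvPolynomial.C (a q) := fun n => by
  simp only [coeff_C]
  split_ifs
  · exact ha
  · exact continuous_const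

theorem add (hf : ContCoeff f) (hg : ContCoeff g) : ContCoeff fun q => f q + g q := fun n => by
  simp only [coeff_add]
  exact (hf n).add (hg n)

theorem sub (hf : ContCoeff f) (hg : ContCoeff g) : ContCoeff fun q => f q - g q := fun n => by
  simp only [coeff_sub]
  exact (hf n).sub (hg n)

theorem mul (hf : ContCoeff f) (hg : ContCoeff g) : ContCoeff fun q => f q * g q := fun n => by
  simp only [coeff_mul]
  exact continuous_finsetSum _ fun x _ => (hf x.1).mul (hg x.2)

theorem sum {κ : Type*} {f : κ → P → MvPolynomial (Fin 2) ℂ} {s : Finset κ}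
    (hf : ∀ i ∈ s, ContCoeff (f i)) : ContCoeff fun q => ∑ i ∈ s, f i q := fun n => by
  simp only [coeff_sum]
  exact continuous_finsetSum _ fun i hi => hf i hi n

theorem prod {κ : Type*} {f : κ → P → MvPolynomial (Fin 2) ℂ} {s : Finset κ}
    (hf : ∀ i ∈ s, ContCoeff (f i)) : ContCoeff fun q => ∏ i ∈ s, f i q := by
  classical
  induction s using Finset.induction_on with
  | empty => simpa using const 1
  | insert i s hi ih =>
    simp only [Finset.prod_insert hi]
    exact (hf i (Finset.mem_insert_self i s)).mul (ih fun j hj => hf j (Finset.mem_insert_of_mem hj))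

end ContCoeff

theorem contCoeff_form {P : Type*} [TopologicalSpace P] {E : P → ConeData ι}
    (hk : Continuous fun q => (E q).k) (hc : Continuous fun q => (E q).c)
    (hr : Continuous fun q => (E q).r) (hκ : Continuous fun q => (E q).κ)
    (hm : Continuous fun q => (E q).m) (i : Fin 5) : ContCoeff fun q => (E q).form i := by
  have hprod : ∀ S : Finset ι, ContCoeff fun q => (E q).prodLin S := fun S =>
    ContCoeff.prod fun i _ => (ContCoeff.const _).sub
      ((ContCoeff.C ((continuous_apply i).comp hr)).mul (ContCoeff.const _))
  have hcj : ∀ j, Continuous fun q => (E q).c j := fun j => (continuous_apply j).comp hc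
  have hres : ∀ i j, Continuous fun q => (E q).res i j := by
    intro i j
    have h1 : Continuous fun q => (E q).κ i := (continuous_apply i).comp hκ
    have h2 : Continuous fun q => (E q).m i := (continuous_apply i).comp hm
    refine h1.mul ?_
    fin_cases j
    · exact h2.pow 2
    · exact h2
    · exact continuous_const
  have hpolar : ∀ {v w : P → Fin 3 → ℂ}, (∀ j, Continuous fun q => v q j) →
      (∀ j, Continuous fun q => w q j) → Continuous fun q => polar (v q) (w q) := fun hv hw =>
    (((hv 0).mul (hw 2)).add ((hv 2).mul (hw 0))).sub ((continuous_const.mul (hv 1)).mul (hw 1))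
  have hX : ContCoeff fun q => (E q).formX := (ContCoeff.C hk).mul (hprod _)
  have hW : ∀ j, ContCoeff fun q => (E q).formW j := fun j =>
    (ContCoeff.C hk).mul (((ContCoeff.C (hcj j)).mul (hprod _)).add
      ((ContCoeff.const _).mul (ContCoeff.sum fun i _ => (ContCoeff.C (hres i j)).mul (hprod _))))
  have hY : ContCoeff fun q => (E q).formY :=
    (ContCoeff.C hk).mul ((((ContCoeff.C ((hpolar hcj hcj).div_const 2)).mul (hprod _)).add
      ((ContCoeff.const _).mul (ContCoeff.sum fun i _ =>
        (ContCoeff.C (hpolar hcj (hres i))).mul (hprod _)))).add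
      ((ContCoeff.const _).mul (ContCoeff.sum fun i _ => ContCoeff.sum fun j _ =>
        (ContCoeff.C ((hpolar (hres i) (hres j)).div_const 2)).mul (hprod _))))
  fin_cases i
  exacts [hX, hW 0, hW 1, hW 2, hY]

theorem contCoeff_perturb (i : Fin 5) :
    ContCoeff fun q : ℝ × (ι → ℝ) => (D.perturb τ q.1 q.2).form i := by
  have h1 : Continuous fun q : ℝ × (ι → ℝ) => (q.1 : ℂ) :=
    Complex.continuous_ofReal.comp continuous_fst
  have h2 : ∀ i, Continuous fun q : ℝ × (ι → ℝ) => (q.2 i : ℂ) := fun i =>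
    Complex.continuous_ofReal.comp ((continuous_apply i).comp continuous_snd)
  have hr : Continuous fun (q : ℝ × (ι → ℝ)) (i : ι) =>
      D.r i + ((1 + Complex.I) * (q.2 i : ℂ) + (1 - Complex.I) * (q.2 (τ i) : ℂ)) :=
    continuous_pi fun i =>
      continuous_const.add ((continuous_const.mul (h2 i)).add (continuous_const.mul (h2 (τ i))))
  have hκ : Continuous fun (q : ℝ × (ι → ℝ)) (i : ι) => D.κ i + (q.1 : ℂ) :=
    continuous_pi fun i => continuous_const.add h1
  have hm : Continuous fun (q : ℝ × (ι → ℝ)) (i : ι) => D.m i + (q.1 : ℂ) * D.r i :=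
    continuous_pi fun i => continuous_const.add (h1.mul continuous_const)
  exact contCoeff_form (E := fun q : ℝ × (ι → ℝ) => D.perturb τ q.1 q.2) continuous_const
    continuous_const hr hκ hm i

theorem perturb_zero : D.perturb τ 0 0 = D := by
  cases D
  simp [perturb]

theorem eventually_add_mul_ne {a b : ℂ} (h : a ≠ 0 ∨ b ≠ 0) :
    ∀ᶠ e : ℝ in 𝓝[≠] 0, a + e * b ≠ 0 := by
  by_cases ha : a = 0
  · have hb := h.resolve_left (not_not.2 ha)
    filter_upwards [self_mem_nhdsWithin] with e he
    rw [ha, zero_add]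
    exact mul_ne_zero (Complex.ofReal_ne_zero.2 he) hb
  · have : Continuous fun e : ℝ => a + e * b := by fun_prop
    exact (this.continuousAt.eventually_ne (y := 0) (by simpa using ha)).filter_mono nhdsWithin_le_nhds

theorem exists_generic_perturb (hτ : D.IsReal τ) (hk : D.k ≠ 0)
    (hr : Function.Injective D.r) (hκ : ∀ i, D.κ i ≠ 0) (hι : 2 ≤ Fintype.card ι) {δ : ℝ} (hδ : 0 < δ) :
    ∃ (e : ℝ) (x : ι → ℝ), |e| < δ ∧ (∀ i, |x i| < δ) ∧ (D.perturb τ e x).Generic := by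
  have ev1 : ∀ᶠ e : ℝ in 𝓝[≠] 0, ∀ i, D.κ i + e * 1 ≠ 0 :=
    Filter.eventually_all.2 fun i => eventually_add_mul_ne (Or.inl (hκ i))
  have ev2 : ∀ᶠ e : ℝ in 𝓝[≠] 0, ∀ i j, i ≠ j → (D.m i - D.m j) + e * (D.r i - D.r j) ≠ 0 := by
    refine Filter.eventually_all.2 fun i => Filter.eventually_all.2 fun j => ?_
    by_cases hij : i = j
    · simp [hij]
    · filter_upwards [eventually_add_mul_ne (a := D.m i - D.m j)
        (Or.inr (sub_ne_zero.2 fun h => hij (hr h)))] with e he _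
      exact he
  have ev3 : ∀ᶠ e : ℝ in 𝓝[≠] 0, ∑ i, D.κ i + e * (Fintype.card ι : ℂ) ≠ 0 :=
    eventually_add_mul_ne (Or.inr (Nat.cast_ne_zero.2 (by lia)))
  have ev4 : ∀ᶠ e : ℝ in 𝓝[≠] 0, |e| < δ := by
    have : Filter.Tendsto (fun e : ℝ => |e|) (𝓝 0) (𝓝 0) := by
      simpa using (continuous_abs (G := ℝ)).tendsto 0
    exact (this.eventually (gt_mem_nhds hδ)).filter_mono nhdsWithin_le_nhds
  obtain ⟨e, h1, h2, h3, h4⟩ := (ev1.and (ev2.and (ev3.and ev4))).exists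
  -- All data other than x are put into a countable field, over which x is then chosen algebraically
  -- independent.
  let S : Set ℂ := {Complex.I} ∪ Set.range D.r ∪ Set.range (fun i => D.κ i + e) ∪
    Set.range (fun i => D.m i + e * D.r i)
  let K := Subfield.closure S
  have hSK : S ⊆ K := Subfield.subset_closure
  have hScount : S.Countable := (((Set.countable_singleton _).union (Set.countable_range _)).union
    (Set.countable_range _)).union (Set.countable_range _)
  have : Countable K := by
    rw [← Cardinal.mk_le_aleph0_iff]
    exact (Subfield.cardinalMk_closure_le_max S).trans
      (max_le (Cardinal.mk_le_aleph0_iff.2 hScount.to_subtype) le_rfl)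
  obtain ⟨x, hx, hxi⟩ := exists_small_algebraicIndependent K hδ ι
  have hI : Complex.I ∈ K := hSK (by simp [S])
  have hrK : ∀ i, D.r i ∈ K := fun i => hSK (by simp [S])
  have hrank : ∀ T : Set ℂ, (∀ i, IsAlgebraic (Algebra.adjoin K T) ((D.perturb τ e x).r i)) →
      (Fintype.card ι : ℕ∞) ≤ T.encard := by
    intro T hT
    refine hxi.card_le_encard T fun i => ?_
    have hK : ∀ x ∈ K, IsAlgebraic (Algebra.adjoin K T) x := fun x hx =>
      isAlgebraic_algebraMap (A := ℂ) (algebraMap K (Algebra.adjoin K T) ⟨x, hx⟩)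
    -- The increments at i and τ i are solved for x i; the determinant is (1 + i)² - (1 - i)² = 4i.
    have e1 : (x i : ℂ) = (4 * Complex.I)⁻¹ * ((1 + Complex.I) * ((D.perturb τ e x).r i - D.r i) -
        (1 - Complex.I) * ((D.perturb τ e x).r (τ i) - D.r (τ i))) := by
      simp only [perturb, hτ.invol]
      have := Complex.I_ne_zero
      field_simp
      ring
    rw [e1]
    have h4 : (4 * Complex.I)⁻¹ ∈ K := K.inv_mem (K.mul_mem (by exact_mod_cast natCast_mem K 4) hI)
    exact (hK _ h4).mul (((hK _ (K.add_mem K.one_mem hI)).mul ((hT i).sub (hK _ (hrK i)))).sub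
      ((hK _ (K.sub_mem K.one_mem hI)).mul ((hT (τ i)).sub (hK _ (hrK (τ i))))))
  refine ⟨e, x, h4, hx, generic_of_rank (K := K) (fun i => hSK (by simp [S, perturb]))
    (fun i => hSK (by simp [S, perturb])) hk (fun i => by simpa [perturb] using h1 i) ?_ ?_ ?_ hι hrank⟩
  · intro i j hij
    by_contra hne
    refine h2 i j hne ?_
    simp only [perturb] at hij
    linear_combination hij
  -- A coincidence of two roots would make all of them algebraic over a set of n - 1 elements.
  · by_contra hinj
    obtain ⟨i, j, hij, hne⟩ : ∃ i j, (D.perturb τ e x).r i = (D.perturb τ e x).r j ∧ i ≠ j := by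
      simpa [Function.Injective] using hinj
    let T : Set ℂ := (D.perturb τ e x).r '' ((Finset.univ.erase i : Finset ι) : Set ι)
    have hle := hrank T fun l => by
      refine isAlgebraic_algebraMap (A := ℂ) (⟨_, Algebra.subset_adjoin ?_⟩ : Algebra.adjoin K T)
      by_cases hl : l = i
      · exact ⟨j, by simp [hne.symm], by rw [hl]; exact hij.symm⟩
      · exact ⟨l, by simp [hl], rfl⟩
    have hle2 := hle.trans (Set.encard_image_le _ _)
    rw [Set.encard_coe_eq_coe_finsetCard, Finset.card_erase_of_mem (Finset.mem_univ i),
      Finset.card_univ] at hle2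
    have : Fintype.card ι ≤ Fintype.card ι - 1 := by exact_mod_cast hle2
    lia
  · simp only [perturb, Finset.sum_add_distrib, Finset.sum_const, Finset.card_univ, nsmul_eq_mul]
    rwa [mul_comm]

end ConeData

open MvPolynomial

theorem exists_map_ofReal {f : MvPolynomial (Fin 2) ℂ} (hf : map (starRingEnd ℂ) f = f) :
    ∃ g : MvPolynomial (Fin 2) ℝ, map (algebraMap ℝ ℂ) g = f := by
  have h : f ∈ Set.range (map (algebraMap ℝ ℂ) : MvPolynomial (Fin 2) ℝ →+* MvPolynomial (Fin 2) ℂ) := by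
    rw [mem_range_map_iff_coeffs_subset]
    intro a ha
    obtain ⟨n, -, rfl⟩ := mem_coeffs_iff.1 ha
    have := congrArg (coeff n) hf
    rw [coeff_map] at this
    exact ⟨_, Complex.conj_eq_iff_re.1 this⟩
  exact h

theorem aeval_eq_eval_map (f : MvPolynomial (Fin 2) ℝ) (z : Fin 2 → ℂ) :
    aeval z f = eval z (map (algebraMap ℝ ℂ) f) := by
  rw [eval_map]
  rfl

/-- A real rational curve on the cone whose first coordinate has simple finite roots, at which the
fourth coordinate does not vanish, is approximated by embedded ones. -/
theorem exists_isEmbedding_approx {d : ℕ} (hd : 2 ≤ d) (F : Fin 5 → MvPolynomial (Fin 2) ℝ)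
    (hF : ∀ i, (F i).IsHomogeneous d) (hN : F 0 * F 4 - F 1 * F 3 + F 2 ^ 2 = 0)
    (hX : eval ![1, 0] (F 0) ≠ 0)
    (hs : ∀ ζ : ℂ, aeval ![ζ, 1] (F 0) = 0 → aeval ![ζ, 1] (pderiv 0 (F 0)) ≠ 0)
    (hC : ∀ ζ : ℂ, aeval ![ζ, 1] (F 0) = 0 → aeval ![ζ, 1] (F 3) ≠ 0)
    (s : Finset (Fin 2 →₀ ℕ)) {ε : ℝ} (hε : 0 < ε) :
    ∃ F' : Fin 5 → MvPolynomial (Fin 2) ℝ, (∀ i, (F' i).IsHomogeneous d) ∧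
      F' 0 * F' 4 - F' 1 * F' 3 + F' 2 ^ 2 = 0 ∧
      (∀ i, ∀ n ∈ s, |coeff n (F' i) - coeff n (F i)| < ε) ∧
      IsEmbedding fun i => map (algebraMap ℝ ℂ) (F' i) := by
  have hinj : Function.Injective (map (algebraMap ℝ ℂ) : MvPolynomial (Fin 2) ℝ →+* MvPolynomial (Fin 2) ℂ) :=
    map_injective _ (algebraMap ℝ ℂ).injective
  obtain ⟨ι, _, _, D, τ, hcard, hτ, hk, hr, hκ, hform⟩ := exists_coneData
    (G := fun i => map (algebraMap ℝ ℂ) (F i)) hd (fun i => (hF i).map _)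
    (by simpa using congrArg (map (algebraMap ℝ ℂ)) hN)
    (fun i => by
      rw [map_map]
      congr 2
      ext x
      simp)
    (by
      have : (![1, 0] : Fin 2 → ℂ) = algebraMap ℝ ℂ ∘ ![1, 0] := by
        ext i
        fin_cases i <;> simp
      rw [this, ← map_eval]
      simpa using hX)
    (fun ζ h => by
      rw [pderiv_map, ← aeval_eq_eval_map]
      exact hs ζ (by rwa [aeval_eq_eval_map]))
    (fun ζ h => by
      rw [← aeval_eq_eval_map]
      exact hC ζ (by rwa [aeval_eq_eval_map]))
  have hι : 2 ≤ Fintype.card ι := hcard ▸ hd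
  have hcont : ∀ᶠ q : ℝ × (ι → ℝ) in 𝓝 0, ∀ i, ∀ n ∈ s,
      ‖coeff n ((D.perturb τ q.1 q.2).form i) - coeff n (D.form i)‖ < ε := by
    rw [Filter.eventually_all]
    intro i
    rw [Filter.eventually_all_finset]
    intro n _
    have h1 : Continuous fun q : ℝ × (ι → ℝ) =>
        ‖coeff n ((D.perturb τ q.1 q.2).form i) - coeff n (D.form i)‖ :=
      ((ConeData.contCoeff_perturb i n).sub continuous_const).norm
    refine h1.continuousAt.eventually_lt continuousAt_const ?_
    simp only [Prod.fst_zero, Prod.snd_zero, ConeData.perturb_zero, sub_self, norm_zero, hε]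
  obtain ⟨δ, hδ, hball⟩ := Metric.eventually_nhds_iff.1 hcont
  obtain ⟨e, x, he, hx, hgen⟩ := ConeData.exists_generic_perturb hτ hk hr hκ hι hδ
  have hclose := @hball (e, x) (by
    rw [dist_zero_right, Prod.norm_def]
    refine max_lt he ?_
    rw [pi_norm_lt_iff hδ]
    exact hx)
  choose F' hF' using fun i => exists_map_ofReal ((hτ.perturb e x).map_form i)
  refine ⟨F', fun i => ?_, ?_, ?_, ?_⟩
  · refine IsHomogeneous.of_map (f := algebraMap ℝ ℂ) (algebraMap ℝ ℂ).injective ?_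
    rw [hF', ← hcard]
    exact (D.perturb τ e x).isHomogeneous_form hι i
  · apply hinj
    simp only [map_add, map_sub, map_mul, map_pow, hF', map_zero]
    exact (D.perturb τ e x).formX_mul_formY
  · intro i n hn
    have h1 := hclose i n hn
    rw [← hF', hform] at h1
    simp only [coeff_map] at h1
    rw [← map_sub, norm_algebraMap', Real.norm_eq_abs] at h1
    exact h1
  · simp only [hF']
    exact ConeData.isEmbedding_form hgen hι

end

/-! ### Linear changes of coordinates and parameters; normal form of an isotropic vector -/

noncomputable section

open MvPolynomial

section transformations

variable {R : Type*} [CommRing R]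

/-- The quadratic form `x y - a c + b ^ 2` in the coordinates `(x, a, b, c, y)`. -/
def nForm (v : Fin 5 → R) : R := v 0 * v 4 - v 1 * v 3 + v 2 ^ 2

/-- The linear combinations of binary forms given by a matrix. -/
def linComp (M : Matrix (Fin 5) (Fin 5) R) (P : Fin 5 → MvPolynomial (Fin 2) R) :
    Fin 5 → MvPolynomial (Fin 2) R := fun i => ∑ j, C (M i j) * P j

/-- The linear form given by a row of a matrix. -/
def linForm (A : Matrix (Fin 2) (Fin 2) R) (k : Fin 2) : MvPolynomial (Fin 2) R :=
  C (A k 0) * X 0 + C (A k 1) * X 1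

/-- The substitution of linear forms given by a matrix. -/
def reparam (A : Matrix (Fin 2) (Fin 2) R) (f : MvPolynomial (Fin 2) R) : MvPolynomial (Fin 2) R :=
  bind₁ (linForm A) f

theorem eval_linComp (M : Matrix (Fin 5) (Fin 5) R) (P : Fin 5 → MvPolynomial (Fin 2) R)
    (z : Fin 2 → R) :
    (fun i => eval z (linComp M P i)) = M.mulVec fun i => eval z (P i) := by
  ext i
  simp [linComp, Matrix.mulVec, dotProduct]

theorem pderiv_linComp (M : Matrix (Fin 5) (Fin 5) R) (P : Fin 5 → MvPolynomial (Fin 2) R)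
    (j : Fin 2) (i : Fin 5) : pderiv j (linComp M P i) = linComp M (fun i => pderiv j (P i)) i := by
  simp [linComp, Derivation.leibniz]

theorem isHomogeneous_linComp (M : Matrix (Fin 5) (Fin 5) R) {P : Fin 5 → MvPolynomial (Fin 2) R}
    {d : ℕ} (h : ∀ i, (P i).IsHomogeneous d) (i : Fin 5) : (linComp M P i).IsHomogeneous d :=
  IsHomogeneous.sum _ _ _ fun j _ => by simpa using (isHomogeneous_C (Fin 2) (M i j)).mul (h j)

theorem eval_linForm (A : Matrix (Fin 2) (Fin 2) R) (k : Fin 2) (z : Fin 2 → R) :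
    eval z (linForm A k) = A.mulVec z k := by
  simp [linForm, Matrix.mulVec, dotProduct, Fin.sum_univ_two]

theorem eval_reparam (A : Matrix (Fin 2) (Fin 2) R) (f : MvPolynomial (Fin 2) R) (z : Fin 2 → R) :
    eval z (reparam A f) = eval (A.mulVec z) f := by
  unfold reparam
  induction f using MvPolynomial.induction_on with
  | C a => simp only [bind₁_C_right, eval_C]
  | add p q hp hq => simp only [map_add, hp, hq]
  | mul_X p i hp => simp only [map_mul, hp, bind₁_X_right, eval_linForm, eval_X]

theorem pderiv_reparam (A : Matrix (Fin 2) (Fin 2) R) (f : MvPolynomial (Fin 2) R) (j : Fin 2) :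
    pderiv j (reparam A f) = C (A 0 j) * reparam A (pderiv 0 f) + C (A 1 j) * reparam A (pderiv 1 f) := by
  have h1 : ∀ i, pderiv j (linForm A i) = C (A i j) := fun i => by
    fin_cases j <;> simp [linForm, Derivation.leibniz, pderiv_X]
  unfold reparam
  induction f using MvPolynomial.induction_on with
  | C a => simp only [bind₁_C_right, pderiv_C, map_zero, mul_zero, add_zero]
  | add p q hp hq =>
    simp only [map_add, hp, hq]
    ring
  | mul_X p i hp =>
    simp only [map_mul, Derivation.leibniz, smul_eq_mul, bind₁_X_right, h1, hp, map_add, pderiv_X]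
    fin_cases i
    · simp
      ring
    · simp
      ring

theorem isHomogeneous_linForm (A : Matrix (Fin 2) (Fin 2) R) (k : Fin 2) :
    (linForm A k).IsHomogeneous 1 := by
  refine IsHomogeneous.add ?_ ?_
  · simpa using (isHomogeneous_C (Fin 2) (A k 0)).mul (isHomogeneous_X R 0)
  · simpa using (isHomogeneous_C (Fin 2) (A k 1)).mul (isHomogeneous_X R 1)

theorem isHomogeneous_reparam (A : Matrix (Fin 2) (Fin 2) R) {f : MvPolynomial (Fin 2) R}
    {d : ℕ} (h : f.IsHomogeneous d) : (reparam A f).IsHomogeneous d := by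
  have := h.aeval (S := R) (linForm A) (n := 1) (isHomogeneous_linForm A)
  rwa [one_mul] at this

theorem map_linComp {S : Type*} [CommRing S] (φ : R →+* S) (M : Matrix (Fin 5) (Fin 5) R)
    (P : Fin 5 → MvPolynomial (Fin 2) R) :
    (fun i => map φ (linComp M P i)) = linComp (M.map φ) fun i => map φ (P i) := by
  ext1 i
  simp [linComp]

theorem map_reparam {S : Type*} [CommRing S] (φ : R →+* S) (A : Matrix (Fin 2) (Fin 2) R)
    (f : MvPolynomial (Fin 2) R) : map φ (reparam A f) = reparam (A.map φ) (map φ f) := by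
  rw [reparam, reparam, map_bind₁]
  congr 2
  ext1 k
  simp [linForm]

end transformations

theorem IsEmbedding.linComp {P : Fin 5 → MvPolynomial (Fin 2) ℂ} (h : IsEmbedding P)
    {M M' : Matrix (Fin 5) (Fin 5) ℂ} (hM : M' * M = 1) : IsEmbedding (linComp M P) := by
  have hinv : ∀ v : Fin 5 → ℂ, M'.mulVec (M.mulVec v) = v := fun v => by
    rw [Matrix.mulVec_mulVec, hM, Matrix.one_mulVec]
  refine ⟨fun z hz => ?_, ?_, fun z hz => ?_⟩
  · by_contra! hcon
    obtain ⟨i, hi⟩ := h.no_common_zero z hz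
    apply hi
    have h1 : (fun i => eval z (_root_.linComp M P i)) = 0 := funext hcon
    rw [eval_linComp] at h1
    have := congrFun (hinv fun i => eval z (P i)) i
    rw [h1, Matrix.mulVec_zero] at this
    exact this.symm
  · rintro z w hz hw ⟨c, hc⟩
    refine h.injective z w hz hw ⟨c, fun i => ?_⟩
    have h1 : (fun i => eval z (_root_.linComp M P i)) = c • fun i => eval w (_root_.linComp M P i) :=
      funext hc
    rw [eval_linComp, eval_linComp] at h1
    have := congrFun (hinv fun i => eval z (P i)) i
    rw [h1, Matrix.mulVec_smul, hinv] at this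
    exact this.symm
  · have h0 := h.immersive z hz
    rw [Fintype.linearIndependent_iff] at h0 ⊢
    intro g hg
    refine h0 g ?_
    have h1 : M.mulVec (∑ j, g j • fun i => eval z (pderiv j (P i))) = 0 := by
      rw [Matrix.mulVec_sum, ← hg]
      refine Finset.sum_congr rfl fun j _ => ?_
      rw [Matrix.mulVec_smul, ← eval_linComp]
      simp only [pderiv_linComp]
    rw [← hinv (∑ j, g j • fun i => eval z (pderiv j (P i))), h1, Matrix.mulVec_zero]

theorem IsEmbedding.reparam {P : Fin 5 → MvPolynomial (Fin 2) ℂ} (h : IsEmbedding P)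
    {A B : Matrix (Fin 2) (Fin 2) ℂ} (hA : B * A = 1) : IsEmbedding fun i => reparam A (P i) := by
  have hinv : ∀ v : Fin 2 → ℂ, B.mulVec (A.mulVec v) = v := fun v => by
    rw [Matrix.mulVec_mulVec, hA, Matrix.one_mulVec]
  have hne : ∀ z : Fin 2 → ℂ, z ≠ 0 → A.mulVec z ≠ 0 := fun z hz h0 => hz (by
    rw [← hinv z, h0, Matrix.mulVec_zero])
  refine ⟨fun z hz => ?_, ?_, fun z hz => ?_⟩
  · simpa only [eval_reparam] using h.no_common_zero _ (hne z hz)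
  · rintro z w hz hw ⟨c, hc⟩
    simp only [eval_reparam] at hc
    obtain ⟨c', h'⟩ := h.injective _ _ (hne z hz) (hne w hw) ⟨c, hc⟩
    exact ⟨c', by rw [← hinv z, h', Matrix.mulVec_smul, hinv]⟩
  · have h0 := h.immersive _ (hne z hz)
    rw [Fintype.linearIndependent_iff] at h0 ⊢
    intro g hg
    have h1 := h0 (A.mulVec g) (by
      rw [← hg]
      ext i
      simp only [Fin.sum_univ_two, Pi.add_apply, Pi.smul_apply, smul_eq_mul, pderiv_reparam, map_add,
        map_mul, eval_C, eval_reparam, Matrix.mulVec, dotProduct]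
      ring)
    have h2 : A.mulVec g = 0 := funext h1
    have h3 := hinv g
    rw [h2, Matrix.mulVec_zero] at h3
    exact fun i => (congrFun h3 i).symm

namespace RealRationalKnot

variable {d : ℕ}

theorem isEmbedding (K : RealRationalKnot d) :
    IsEmbedding fun i => map (algebraMap ℝ ℂ) (K.coord i) where
  no_common_zero z hz := by simpa only [aeval_eq_eval_map] using K.no_common_zero z hz
  injective z w hz hw := by simpa only [aeval_eq_eval_map] using K.injective z w hz hw
  immersive z hz := by simpa only [aeval_eq_eval_map, pderiv_map] using K.immersive z hz

/-- The knot given by forms that define an embedding. -/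
def ofIsEmbedding (P : Fin 5 → MvPolynomial (Fin 2) ℝ) (hP : ∀ i, (P i).IsHomogeneous d)
    (h : IsEmbedding fun i => map (algebraMap ℝ ℂ) (P i)) : RealRationalKnot d where
  coord := P
  homogeneous := hP
  no_common_zero z hz := by simpa only [aeval_eq_eval_map] using h.no_common_zero z hz
  injective z w hz hw := by simpa only [aeval_eq_eval_map] using h.injective z w hz hw
  immersive z hz := by simpa only [aeval_eq_eval_map, pderiv_map] using h.immersive z hz

theorem form32_evalReal (K : RealRationalKnot d) (hK : K.points ⊆ quadric32) {z : Fin 2 → ℝ}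
    (hz : z ≠ 0) : form32 (K.evalReal z) = 0 := by
  by_cases h : K.evalReal z = 0
  · simp [h, form32]
  · exact (mk_mem_quadric32 h).1 (hK ⟨z, hz, h, rfl⟩)

end RealRationalKnot

theorem eval_map_ofReal (f : MvPolynomial (Fin 2) ℝ) (z : Fin 2 → ℝ) :
    eval (fun i => (z i : ℂ)) (map (algebraMap ℝ ℂ) f) = (eval z f : ℂ) :=
  (map_eval (algebraMap ℝ ℂ) z f).symm

theorem IsEmbedding.eval_ne_zero {P : Fin 5 → MvPolynomial (Fin 2) ℝ}
    (h : IsEmbedding fun i => map (algebraMap ℝ ℂ) (P i)) {z : Fin 2 → ℝ} (hz : z ≠ 0) :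
    (fun i => eval z (P i)) ≠ 0 := by
  intro h0
  obtain ⟨i, hi⟩ := h.no_common_zero (fun i => (z i : ℂ)) fun h => hz (by
    ext i
    simpa using congrFun h i)
  rw [eval_map_ofReal, congrFun h0 i] at hi
  simp at hi

/-- Orthonormal coordinates on the positive ℝ³ and the negative ℝ², each with first axis along the
projection of p. Isotropy of p makes the two projections equally long, of length n. -/
theorem exists_orthogonal_functionals {p : Fin 5 → ℝ} (hp : p ≠ 0) (hpq : form32 p = 0) :
    ∃ (n : ℝ) (ℓ : Fin 3 → (Fin 5 → ℝ) →ₗ[ℝ] ℝ) (U V : (Fin 5 → ℝ) →ₗ[ℝ] ℝ), 0 < n ∧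
      (∀ x, ℓ 0 x ^ 2 + ℓ 1 x ^ 2 + ℓ 2 x ^ 2 = x 1 ^ 2 + x 2 ^ 2 + x 3 ^ 2) ∧
      (∀ x, U x ^ 2 + V x ^ 2 = x 0 ^ 2 + x 4 ^ 2) ∧ (ℓ 0 p = n ∧ ℓ 1 p = 0 ∧ ℓ 2 p = 0) ∧
      U p = n ∧ V p = 0 := by
  set n := √(p 0 ^ 2 + p 4 ^ 2) with hn
  have hn2 : n ^ 2 = p 0 ^ 2 + p 4 ^ 2 := Real.sq_sqrt (by positivity)
  have hpq' : p 1 ^ 2 + p 2 ^ 2 + p 3 ^ 2 = p 0 ^ 2 + p 4 ^ 2 := by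
    simp only [form32] at hpq
    linarith
  have hn0 : 0 < n := by
    apply Real.sqrt_pos.2
    by_contra! h
    have h0 : p 0 = 0 := by nlinarith [sq_nonneg (p 0), sq_nonneg (p 4)]
    have h4 : p 4 = 0 := by nlinarith [sq_nonneg (p 0), sq_nonneg (p 4)]
    have h1 : p 1 = 0 := by nlinarith [sq_nonneg (p 1), sq_nonneg (p 2), sq_nonneg (p 3)]
    have h2 : p 2 = 0 := by nlinarith [sq_nonneg (p 1), sq_nonneg (p 2), sq_nonneg (p 3)]
    have h3 : p 3 = 0 := by nlinarith [sq_nonneg (p 1), sq_nonneg (p 2), sq_nonneg (p 3)]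
    exact hp (by ext i; fin_cases i <;> simp [h0, h1, h2, h3, h4])
  let v : EuclideanSpace ℝ (Fin 3) := !₂[p 1 / n, p 2 / n, p 3 / n]
  have hv : ‖v‖ = 1 := by
    rw [EuclideanSpace.norm_eq, Real.sqrt_eq_one, Fin.sum_univ_three]
    simp only [v, Real.norm_eq_abs, sq_abs]
    simp
    field_simp
    linarith
  obtain ⟨B, hB⟩ := Orthonormal.exists_orthonormalBasis_extension_of_card_eq (𝕜 := ℝ)
    (E := EuclideanSpace ℝ (Fin 3)) (ι := Fin 3) (by simp) (v := fun _ => v) (s := {0}) (by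
      rw [orthonormal_iff_ite]
      rintro ⟨i, hi⟩ ⟨j, hj⟩
      obtain rfl : i = 0 := hi
      obtain rfl : j = 0 := hj
      simp [hv])
  have hB0 : B 0 = v := hB 0 rfl
  let tl : (Fin 5 → ℝ) →ₗ[ℝ] EuclideanSpace ℝ (Fin 3) :=
    { toFun := fun x => !₂[x 1, x 2, x 3]
      map_add' := fun x y => by ext i; fin_cases i <;> simp
      map_smul' := fun c x => by ext i; fin_cases i <;> simp }
  let ℓ : Fin 3 → (Fin 5 → ℝ) →ₗ[ℝ] ℝ := fun i => (innerₛₗ ℝ (B i)).comp tl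
  have hℓ : ∀ x, ℓ 0 x ^ 2 + ℓ 1 x ^ 2 + ℓ 2 x ^ 2 = x 1 ^ 2 + x 2 ^ 2 + x 3 ^ 2 := by
    intro x
    have h1 := B.sum_sq_norm_inner_right (tl x)
    rw [EuclideanSpace.real_norm_sq_eq, Fin.sum_univ_three, Fin.sum_univ_three] at h1
    simpa [tl, ℓ] using h1
  have hℓp : ℓ 0 p = n ∧ ℓ 1 p = 0 ∧ ℓ 2 p = 0 := by
    have htl : tl p = n • v := by
      ext i
      fin_cases i <;> simp [tl, v] <;> field_simp
    have h1 : ∀ i, ℓ i p = n * inner ℝ (B i) (B 0) := fun i => by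
      change inner ℝ (B i) (tl p) = _
      rw [htl, inner_smul_right, hB0]
    simp [h1, B.inner_eq_ite]
  let c0 : Fin 5 → (Fin 5 → ℝ) →ₗ[ℝ] ℝ := fun i => LinearMap.proj i
  let U : (Fin 5 → ℝ) →ₗ[ℝ] ℝ := (p 0 / n) • c0 0 + (p 4 / n) • c0 4
  let V : (Fin 5 → ℝ) →ₗ[ℝ] ℝ := (p 4 / n) • c0 0 - (p 0 / n) • c0 4
  have hUV : ∀ x, U x ^ 2 + V x ^ 2 = x 0 ^ 2 + x 4 ^ 2 := by
    intro x
    simp only [U, V, c0, LinearMap.add_apply, LinearMap.sub_apply, LinearMap.smul_apply,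
      LinearMap.proj_apply, smul_eq_mul]
    have : (p 0 / n) ^ 2 + (p 4 / n) ^ 2 = 1 := by
      field_simp
      exact hn2.symm
    linear_combination (x 0 ^ 2 + x 4 ^ 2) * this
  have hUp : U p = n := by
    simp only [U, c0, LinearMap.add_apply, LinearMap.smul_apply, LinearMap.proj_apply, smul_eq_mul]
    field_simp
    exact hn2.symm
  have hVp : V p = 0 := by
    simp only [V, c0, LinearMap.sub_apply, LinearMap.smul_apply, LinearMap.proj_apply, smul_eq_mul]
    ring
  exact ⟨n, ℓ, U, V, hn0, hℓ, hUV, hℓp, hUp, hVp⟩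

/-- Isotropic vectors can be moved to a standard position. -/
theorem exists_normal_coordinates {p : Fin 5 → ℝ} (hp : p ≠ 0) (hpq : form32 p = 0) :
    ∃ Λ : (Fin 5 → ℝ) ≃ₗ[ℝ] (Fin 5 → ℝ), (∀ x, nForm (Λ x) = form32 x) ∧ Λ p = Pi.single 0 1 := by
  obtain ⟨n, ℓ, U, V, hn0, hℓ, hUV, ⟨l0, l1, l2⟩, hUp, hVp⟩ := exists_orthogonal_functionals hp hpq
  -- Null coordinates: xy = ℓ₀² - U² and ac = V² - ℓ₁². The factors 2n and its inverse normalise the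
  -- first coordinate of p to 1.
  let T : (Fin 5 → ℝ) →ₗ[ℝ] (Fin 5 → ℝ) := LinearMap.pi
    ![(2 * n)⁻¹ • (ℓ 0 + U), V + ℓ 1, ℓ 2, V - ℓ 1, (2 * n) • (ℓ 0 - U)]
  have hT0 : ∀ x, T x 0 = (2 * n)⁻¹ * (ℓ 0 x + U x) := fun x => rfl
  have hT1 : ∀ x, T x 1 = V x + ℓ 1 x := fun x => rfl
  have hT2 : ∀ x, T x 2 = ℓ 2 x := fun x => rfl
  have hT3 : ∀ x, T x 3 = V x - ℓ 1 x := fun x => rfl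
  have hT4 : ∀ x, T x 4 = 2 * n * (ℓ 0 x - U x) := fun x => rfl
  have hinj : Function.Injective T := by
    rw [injective_iff_map_eq_zero]
    intro x hx
    have e0 : (2 * n)⁻¹ * (ℓ 0 x + U x) = 0 := by rw [← hT0, hx]; rfl
    have e1 : V x + ℓ 1 x = 0 := by rw [← hT1, hx]; rfl
    have e2 : ℓ 2 x = 0 := by rw [← hT2, hx]; rfl
    have e3 : V x - ℓ 1 x = 0 := by rw [← hT3, hx]; rfl
    have e4 : 2 * n * (ℓ 0 x - U x) = 0 := by rw [← hT4, hx]; rfl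
    have f0 := (mul_eq_zero.1 e0).resolve_left (by positivity)
    have f4 := (mul_eq_zero.1 e4).resolve_left (by positivity)
    have hU0 : U x = 0 := by linarith
    have hl0 : ℓ 0 x = 0 := by linarith
    have hV0 : V x = 0 := by linarith
    have hl1 : ℓ 1 x = 0 := by linarith
    have g1 := hℓ x
    have g2 := hUV x
    rw [hl0, hl1, e2] at g1
    rw [hU0, hV0] at g2
    have h0 : x 0 = 0 := by nlinarith [sq_nonneg (x 0), sq_nonneg (x 4)]
    have h4 : x 4 = 0 := by nlinarith [sq_nonneg (x 0), sq_nonneg (x 4)]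
    have h1 : x 1 = 0 := by nlinarith [sq_nonneg (x 1), sq_nonneg (x 2), sq_nonneg (x 3)]
    have h2 : x 2 = 0 := by nlinarith [sq_nonneg (x 1), sq_nonneg (x 2), sq_nonneg (x 3)]
    have h3 : x 3 = 0 := by nlinarith [sq_nonneg (x 1), sq_nonneg (x 2), sq_nonneg (x 3)]
    ext i
    fin_cases i <;> simp [h0, h1, h2, h3, h4]
  refine ⟨LinearEquiv.ofInjectiveEndo T hinj, fun x => ?_, ?_⟩
  · change nForm (T x) = form32 x
    simp only [nForm, hT0, hT1, hT2, hT3, hT4, form32]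
    have g1 := hℓ x
    have g2 := hUV x
    field_simp
    linear_combination g1 - g2
  · change T p = Pi.single 0 1
    ext i
    fin_cases i
    · change T p 0 = _
      rw [hT0, hUp, l0]
      simp
      field_simp
      ring
    · change T p 1 = _
      simp [hT1, hVp, l1]
    · change T p 2 = _
      simp [hT2, l2]
    · change T p 3 = _
      simp [hT3, hVp, l1]
    · change T p 4 = _
      simp [hT4, hUp, l0]

end

/-! ### Knots as curves through the standard point, and generic choices of real parameters -/

noncomputable section

open MvPolynomial

theorem RealRationalKnot.mem_pointsInQ32 {d : ℕ} (K : RealRationalKnot d) (x : Q32) :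
    x ∈ K.pointsInQ32 ↔ ∃ z : Fin 2 → ℝ, z ≠ 0 ∧ x.On (K.evalReal z) := by
  constructor
  · rintro ⟨z, hz, h, hx⟩
    refine ⟨z, hz, ?_⟩
    obtain ⟨a, ha⟩ := Projectivization.exists_smul_eq_mk_rep ℝ _ h
    exact ⟨a, by rw [hx, ← ha]; rfl⟩
  · rintro ⟨z, hz, c, hc⟩
    have h : K.evalReal z ≠ 0 := K.isEmbedding.eval_ne_zero hz
    refine ⟨z, hz, h, ?_⟩
    rw [← x.1.mk_rep, Projectivization.mk_eq_mk_iff']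
    exact ⟨c, hc.symm⟩

/-- A curve on the cone `nForm = 0` whose point at parameter `[0 : 1]` is standard. -/
structure ConeCurve (d : ℕ) (G : Fin 5 → MvPolynomial (Fin 2) ℝ) : Prop where
  hom : ∀ i, (G i).IsHomogeneous d
  cone : nForm G = 0
  emb : IsEmbedding fun i => map (algebraMap ℝ ℂ) (G i)
  base : (fun i => eval ![0, 1] (G i)) = Pi.single 0 1

theorem eval_nForm {R : Type*} [CommRing R] (G : Fin 5 → MvPolynomial (Fin 2) R) (z : Fin 2 → R) :
    eval z (nForm G) = nForm fun i => eval z (G i) := by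
  simp [nForm]

theorem ConeCurve.linComp {d : ℕ} {G : Fin 5 → MvPolynomial (Fin 2) ℝ} (h : ConeCurve d G)
    {M M' : Matrix (Fin 5) (Fin 5) ℝ} (hM : M' * M = 1) (hN : ∀ v, nForm (M.mulVec v) = nForm v)
    (h0 : M.mulVec (Pi.single 0 1) = Pi.single 0 1) : ConeCurve d (linComp M G) where
  hom := isHomogeneous_linComp M h.hom
  cone := MvPolynomial.funext fun z => by
    rw [eval_nForm, eval_linComp, hN, ← eval_nForm, h.cone]
  emb := by
    rw [map_linComp]
    refine h.emb.linComp (M' := M'.map (algebraMap ℝ ℂ)) ?_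
    rw [← Matrix.map_mul, hM, Matrix.map_one _ (map_zero _) (map_one _)]
  base := by rw [eval_linComp, h.base, h0]

theorem RealRationalKnot.exists_coneCurve {d : ℕ} (K : RealRationalKnot d) (hK : K.points ⊆ quadric32)
    {p : Q32} (hp : p ∈ K.pointsInQ32) {Λ : (Fin 5 → ℝ) ≃ₗ[ℝ] (Fin 5 → ℝ)}
    (hΛ : ∀ x, nForm (Λ x) = form32 x) (hΛp : Λ p.1.rep = Pi.single 0 1) :
    ∃ G, ConeCurve d G ∧ ∀ x : Q32, x ∈ K.pointsInQ32 ↔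
      ∃ z : Fin 2 → ℝ, z ≠ 0 ∧ x.On (Λ.symm fun i => eval z (G i)) := by
  obtain ⟨z₀, hz₀, a, ha⟩ := (K.mem_pointsInQ32 p).1 hp
  have ha0 : a ≠ 0 := by
    rintro rfl
    exact p.1.rep_nonzero (by rw [ha, zero_smul])
  -- A scaled rotation of the parameter line sending [0:1] to a parameter of p; multiplying the
  -- forms by `a` below makes the value there equal to the standard vector, not just proportional.
  let A : Matrix (Fin 2) (Fin 2) ℝ := !![z₀ 1, z₀ 0; -z₀ 0, z₀ 1]
  let δ := z₀ 0 ^ 2 + z₀ 1 ^ 2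
  have hδ : δ ≠ 0 := by
    intro h
    have h0 : z₀ 0 = 0 := by nlinarith [sq_nonneg (z₀ 0), sq_nonneg (z₀ 1)]
    have h1 : z₀ 1 = 0 := by nlinarith [sq_nonneg (z₀ 0), sq_nonneg (z₀ 1)]
    exact hz₀ (by ext i; fin_cases i <;> simp [h0, h1])
  let B : Matrix (Fin 2) (Fin 2) ℝ := !![z₀ 1 / δ, -z₀ 0 / δ; z₀ 0 / δ, z₀ 1 / δ]
  have hBA : B * A = 1 := by
    ext i j
    fin_cases i <;> fin_cases j <;> simp [A, B] <;> field_simp <;> simp [δ] <;> ring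
  have hAB : A * B = 1 := mul_eq_one_comm.1 hBA
  have hAz : A.mulVec ![0, 1] = z₀ := by
    ext i
    fin_cases i <;> simp [A, Matrix.mulVec, dotProduct]
  let M := LinearMap.toMatrix' (Λ : (Fin 5 → ℝ) →ₗ[ℝ] (Fin 5 → ℝ))
  let M' := LinearMap.toMatrix' (Λ.symm : (Fin 5 → ℝ) →ₗ[ℝ] (Fin 5 → ℝ))
  have hM'M : M' * M = 1 := by
    rw [← LinearMap.toMatrix'_comp]
    simp
  have hMv : ∀ v, M.mulVec v = Λ v := fun v => LinearMap.toMatrix'_mulVec _ v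
  let G := _root_.linComp (a • M) fun i => reparam A (K.coord i)
  have hGev : ∀ z : Fin 2 → ℝ, (fun i => eval z (G i)) = a • Λ (K.evalReal (A.mulVec z)) := fun z => by
    rw [eval_linComp, Matrix.smul_mulVec, hMv]
    simp only [eval_reparam]
    rfl
  have hAne : ∀ z : Fin 2 → ℝ, z ≠ 0 → A.mulVec z ≠ 0 := fun z hz h0 => hz (by
    rw [← Matrix.one_mulVec z, ← hBA, ← Matrix.mulVec_mulVec, h0, Matrix.mulVec_zero])
  have hBne : ∀ z : Fin 2 → ℝ, z ≠ 0 → B.mulVec z ≠ 0 := fun z hz h0 => hz (by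
    rw [← Matrix.one_mulVec z, ← hAB, ← Matrix.mulVec_mulVec, h0, Matrix.mulVec_zero])
  have hnsmul : ∀ (c : ℝ) (v : Fin 5 → ℝ), nForm (c • v) = c ^ 2 * nForm v := fun c v => by
    simp only [nForm, Pi.smul_apply, smul_eq_mul]
    ring
  refine ⟨G, ⟨isHomogeneous_linComp _ fun i => isHomogeneous_reparam A (K.homogeneous i), ?_, ?_, ?_⟩,
    fun x => ?_⟩
  · refine MvPolynomial.funext fun z => ?_
    rw [eval_nForm, hGev, hnsmul, hΛ, map_zero]
    -- The knot only controls the forms at nonzero parameters; multiplying the polynomial identity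
    -- by a variable removes the exception at the origin.
    by_cases hz : z = 0
    · have hd : ∀ y : Fin 2 → ℝ, form32 (K.evalReal y) = eval y (-(K.coord 0) ^ 2 + (K.coord 1) ^ 2 +
          (K.coord 2) ^ 2 + (K.coord 3) ^ 2 - (K.coord 4) ^ 2) := fun y => by
        simp [form32, evalReal]
      have h0 : (-(K.coord 0) ^ 2 + (K.coord 1) ^ 2 + (K.coord 2) ^ 2 + (K.coord 3) ^ 2 -
          (K.coord 4) ^ 2) * X 0 = 0 := by
        refine MvPolynomial.funext fun y => ?_
        rw [map_mul, ← hd, map_zero]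
        by_cases hy : y = 0
        · simp [hy]
        · rw [K.form32_evalReal hK hy, zero_mul]
      have h1 := (mul_eq_zero.1 h0).resolve_right (X_ne_zero 0)
      rw [hd, h1, map_zero, mul_zero]
    · rw [K.form32_evalReal hK (hAne z hz), mul_zero]
  · rw [map_linComp]
    have h1 := K.isEmbedding.reparam (A := A.map (algebraMap ℝ ℂ)) (B := B.map (algebraMap ℝ ℂ)) (by
      rw [← Matrix.map_mul, hBA, Matrix.map_one _ (map_zero _) (map_one _)])
    simp only [← map_reparam] at h1
    refine h1.linComp (M' := (a⁻¹ • M').map (algebraMap ℝ ℂ)) ?_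
    rw [← Matrix.map_mul, Matrix.smul_mul, Matrix.mul_smul, smul_smul, inv_mul_cancel₀ ha0, one_smul,
      hM'M, Matrix.map_one _ (map_zero _) (map_one _)]
  · rw [hGev, hAz, ← map_smul, ← ha, hΛp]
  · rw [K.mem_pointsInQ32]
    have hon : ∀ z : Fin 2 → ℝ, x.On (Λ.symm fun i => eval z (G i)) ↔ x.On (K.evalReal (A.mulVec z)) := by
      intro z
      rw [hGev, map_smul, LinearEquiv.symm_apply_apply]
      constructor
      · rintro ⟨c, hc⟩
        exact ⟨c * a, by rw [hc, smul_smul]⟩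
      · rintro ⟨c, hc⟩
        exact ⟨c * a⁻¹, by rw [hc, smul_smul, mul_assoc, inv_mul_cancel₀ ha0, mul_one]⟩
    simp only [hon]
    constructor
    · rintro ⟨z, hz, hx⟩
      refine ⟨B.mulVec z, hBne z hz, ?_⟩
      rwa [Matrix.mulVec_mulVec, hAB, Matrix.one_mulVec]
    · rintro ⟨z, hz, hx⟩
      exact ⟨_, hAne z hz, hx⟩

namespace ConeCurve

variable {d : ℕ} {G : Fin 5 → MvPolynomial (Fin 2) ℝ}

theorem base_apply (h : ConeCurve d G) (i : Fin 5) :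
    eval ![0, 1] (G i) = (Pi.single 0 1 : Fin 5 → ℝ) i := congrFun h.base i

/-- The cone equation differentiated at the standard point gives y' = 0, since there x = 1 and the
other coordinates vanish. -/
theorem tangent_four (h : ConeCurve d G) : eval ![0, 1] (pderiv 0 (G 4)) = 0 := by
  have h1 := congrArg (fun f => eval ![0, 1] (pderiv 0 f)) h.cone
  simp only [nForm, map_add, map_sub, Derivation.leibniz, Derivation.leibniz_pow, smul_eq_mul, map_mul,
    h.base_apply, nsmul_eq_mul, map_zero, map_pow] at h1
  simpa using h1

/-- Otherwise one partial derivative would be a multiple of the standard vector. By Euler's relation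
the other one is too, and the curve would not be immersed. -/
theorem tangent_ne (h : ConeCurve d G) : ∃ j ∈ ({1, 2, 3} : Finset (Fin 5)),
    eval ![0, 1] (pderiv 0 (G j)) ≠ 0 := by
  by_contra! hcon
  have h1 := h.emb.immersive ![0, 1] (by simp)
  rw [Fintype.linearIndependent_iff] at h1
  have hz : (![0, 1] : Fin 2 → ℂ) = fun i => ((![0, 1] : Fin 2 → ℝ) i : ℂ) := by
    ext i
    fin_cases i <;> simp
  have heul : ∀ i, eval ![0, 1] (pderiv 1 (G i)) = d * (Pi.single 0 1 : Fin 5 → ℝ) i := fun i => by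
    have := congrArg (eval ![0, 1]) (h.hom i).sum_X_mul_pderiv
    simp only [Fin.sum_univ_two, map_add, map_mul, eval_X, nsmul_eq_mul, map_natCast, h.base_apply] at this
    simpa using this
  set g0 : ℝ := eval ![0, 1] (pderiv 0 (G 0)) with hg0
  have ht : ∀ i, eval ![0, 1] (pderiv 0 (G i)) = g0 * (Pi.single 0 1 : Fin 5 → ℝ) i := by
    intro i
    fin_cases i
    · simp [hg0]
    · simpa using hcon 1 (by simp)
    · simpa using hcon 2 (by simp)
    · simpa using hcon 3 (by simp)
    · simpa using h.tangent_four
  have h2 : ∀ a b : ℝ, a * g0 + b * d = 0 → a = 0 ∧ b = 0 := by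
    intro a b hab
    have := h1 ![(a : ℂ), (b : ℂ)] (by
      ext i
      simp only [Fin.sum_univ_two, Pi.add_apply, Pi.smul_apply, smul_eq_mul, pderiv_map, hz,
        eval_map_ofReal, ht, heul, Matrix.cons_val_zero, Matrix.cons_val_one, Pi.zero_apply]
      have : (a : ℂ) * g0 + b * d = 0 := by exact_mod_cast hab
      push_cast
      linear_combination this * (Pi.single 0 1 : Fin 5 → ℝ) i)
    have h0 := this 0
    have h1 := this 1
    simp at h0 h1
    exact ⟨h0, h1⟩
  by_cases hg : g0 = 0
  · exact one_ne_zero (h2 1 0 (by simp [hg])).1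
  · exact hg (neg_eq_zero.1 (h2 d (-g0) (by ring)).2)

end ConeCurve

theorem eventually_quadratic_ne {a b c : ℂ} (h : a ≠ 0 ∨ b ≠ 0 ∨ c ≠ 0) :
    ∀ᶠ x : ℝ in Filter.cofinite, a + b * x + c * x ^ 2 ≠ 0 := by
  let p : Polynomial ℂ := Polynomial.C a + Polynomial.C b * Polynomial.X +
    Polynomial.C c * Polynomial.X ^ 2
  have hp : p ≠ 0 := by
    intro hp
    have h0 : p.coeff 0 = a := by simp [p]
    have h1 : p.coeff 1 = b := by simp [p, Polynomial.coeff_C]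
    have h2 : p.coeff 2 = c := by simp [p]
    rw [hp, Polynomial.coeff_zero] at h0 h1 h2
    rcases h with h | h | h
    exacts [h h0.symm, h h1.symm, h h2.symm]
  have hfin := (Polynomial.finite_setOfPred_isRoot hp).preimage Complex.ofReal_injective.injOn
  refine hfin.subset fun x hx => ?_
  have hx' : a + b * x + c * x ^ 2 = 0 := by
    by_contra h
    exact hx h
  change Polynomial.eval (x : ℂ) p = 0
  simpa [p] using hx'

section generic

open scoped Polynomial

variable {D : Fin 5 → ℂ[X]} {v : Fin 5 → ℂ}

/-- First of three successive choices. The shear with parameters l, μ, ν turns x into f + l·g with g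
= c + νy and f = x + νa - 2μb - μ²y. Choosing ν keeps x + νa nonzero wherever b = c = y = 0; `v`
plays the role of the values at infinity. -/
theorem eventually_generic_first (hD : ∀ ζ, ∃ j, (D j).eval ζ ≠ 0) (hv : ∃ j, v j ≠ 0)
    (h3 : D 3 ≠ 0) :
    ∀ᶠ ν : ℝ in Filter.cofinite,
      (∀ ζ, (D 2).eval ζ = 0 → (D 3).eval ζ = 0 → (D 4).eval ζ = 0 →
        (D 0).eval ζ + ν * (D 1).eval ζ ≠ 0) ∧
      (v 2 = 0 → v 3 = 0 → v 4 = 0 → v 0 + ν * v 1 ≠ 0) := by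
  have key : ∀ w : Fin 5 → ℂ, (∃ j, w j ≠ 0) → ∀ᶠ ν : ℝ in Filter.cofinite,
      w 2 = 0 → w 3 = 0 → w 4 = 0 → w 0 + ν * w 1 ≠ 0 := by
    intro w hw
    by_cases h : w 2 = 0 ∧ w 3 = 0 ∧ w 4 = 0
    · have : w 0 ≠ 0 ∨ w 1 ≠ 0 := by
        by_contra! hcon
        obtain ⟨j, hj⟩ := hw
        fin_cases j
        exacts [hj hcon.1, hj hcon.2, hj h.1, hj h.2.1, hj h.2.2]
      filter_upwards [eventually_quadratic_ne (a := w 0) (b := w 1) (c := 0) (by tauto)] with ν hν _ _ _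
      intro h0
      exact hν (by linear_combination h0)
    · exact Filter.Eventually.of_forall fun ν h2 h3 h4 => absurd ⟨h2, h3, h4⟩ h
  refine Filter.Eventually.and ?_ (key v hv)
  have hfin := Polynomial.finite_setOfPred_isRoot h3
  have := (Filter.eventually_all_finite hfin).2 fun ζ _ => key (fun j => (D j).eval ζ) (hD ζ)
  filter_upwards [this] with ν hν ζ e2 e3 e4
  exact hν ζ e3 e2 e3 e4

/-- At a zero of g, f is a polynomial in μ. If it vanished identically then b = c = y = 0 and x + νa
= 0, against the choice of ν. So f and g get no common zero. -/
theorem eventually_generic_second {ν : ℝ} (h3 : D 3 + Polynomial.C (ν : ℂ) * D 4 ≠ 0)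
    (hν : (∀ ζ, (D 2).eval ζ = 0 → (D 3).eval ζ = 0 → (D 4).eval ζ = 0 →
        (D 0).eval ζ + ν * (D 1).eval ζ ≠ 0) ∧
      (v 2 = 0 → v 3 = 0 → v 4 = 0 → v 0 + ν * v 1 ≠ 0)) :
    ∀ᶠ μ : ℝ in Filter.cofinite,
      (∀ ζ, (D 3).eval ζ + ν * (D 4).eval ζ = 0 → (D 0).eval ζ + ν * (D 1).eval ζ -
        2 * μ * (D 2).eval ζ - μ ^ 2 * (D 4).eval ζ ≠ 0) ∧
      (v 3 + ν * v 4 = 0 → v 0 + ν * v 1 - 2 * μ * v 2 - μ ^ 2 * v 4 ≠ 0) := by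
  have key : ∀ w : Fin 5 → ℂ, (w 2 = 0 → w 3 = 0 → w 4 = 0 → w 0 + ν * w 1 ≠ 0) →
      ∀ᶠ μ : ℝ in Filter.cofinite,
      w 3 + ν * w 4 = 0 → w 0 + ν * w 1 - 2 * μ * w 2 - μ ^ 2 * w 4 ≠ 0 := by
    intro w hw
    by_cases h : w 3 + ν * w 4 = 0
    · filter_upwards [eventually_quadratic_ne (a := w 0 + ν * w 1) (b := -2 * w 2) (c := -w 4) (by
        by_contra! hcon
        obtain ⟨c0, c2, c4⟩ := hcon
        have h4 : w 4 = 0 := neg_eq_zero.1 c4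
        refine hw ((mul_eq_zero.1 c2).resolve_left (by norm_num)) ?_ h4 c0
        rwa [h4, mul_zero, add_zero] at h)] with μ hμ _
      intro h0
      exact hμ (by linear_combination h0)
    · exact Filter.Eventually.of_forall fun μ h' => absurd h' h
  refine Filter.Eventually.and ?_ (key v hν.2)
  have hfin := Polynomial.finite_setOfPred_isRoot h3
  have := (Filter.eventually_all_finite hfin).2 fun ζ _ => key (fun j => (D j).eval ζ) (hν.1 ζ)
  filter_upwards [this] with μ hμ ζ e
  exact hμ ζ (by simpa using e) e

/-- A multiple root of f + l·g is a zero of the Wronskian of f and g. There are finitely many of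
these, and each excludes at most one l. -/
theorem eventually_generic_third {f g : ℂ[X]} {vf vg : ℂ} (hfg : ∀ ζ, g.eval ζ = 0 → f.eval ζ ≠ 0)
    (hv : vg = 0 → vf ≠ 0) (hw : f * Polynomial.derivative g - Polynomial.derivative f * g ≠ 0) :
    ∀ᶠ l : ℝ in Filter.cofinite, vf + l * vg ≠ 0 ∧ ∀ ζ, f.eval ζ + l * g.eval ζ = 0 →
      g.eval ζ ≠ 0 ∧ (Polynomial.derivative f).eval ζ + l * (Polynomial.derivative g).eval ζ ≠ 0 := by
  have key : ∀ a b : ℂ, (b = 0 → a ≠ 0) → ∀ᶠ l : ℝ in Filter.cofinite, a + l * b ≠ 0 := by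
    intro a b hab
    filter_upwards [eventually_quadratic_ne (a := a) (b := b) (c := 0) (by tauto)] with l hl h0
    exact hl (by linear_combination h0)
  have hfin := Polynomial.finite_setOfPred_isRoot hw
  filter_upwards [key vf vg hv, (Filter.eventually_all_finite hfin).2 fun ζ _ =>
    key (f.eval ζ) (g.eval ζ) (hfg ζ)] with l h1 h2
  refine ⟨h1, fun ζ hζ => ⟨fun hg => hfg ζ hg (by rw [hg] at hζ; simpa using hζ), fun h' => ?_⟩⟩
  refine h2 ζ ?_ hζ
  change Polynomial.eval ζ _ = 0
  simp only [Polynomial.eval_sub, Polynomial.eval_mul]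
  linear_combination (Polynomial.derivative g).eval ζ * hζ - g.eval ζ * h'

end generic

end

/-! ### Shears bringing both curves into general position -/

noncomputable section

open MvPolynomial

/-- A one-parameter group of shears fixing the standard point. -/
def tangentShear (θ : ℝ) : Matrix (Fin 5) (Fin 5) ℝ :=
  !![1, 0, 0, 0, 0; 0, 1, 0, 0, 0; 0, θ, 1, 0, 0; 0, θ ^ 2, 2 * θ, 1, 0; 0, 0, 0, 0, 1]

/-- The unipotent group of transformations that fix the standard point and its tangent directions. -/
def coneShear (l μ ν : ℝ) : Matrix (Fin 5) (Fin 5) ℝ :=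
  !![1, ν, -2 * μ, l, l * ν - μ ^ 2; 0, 1, 0, 0, l; 0, 0, 1, 0, μ; 0, 0, 0, 1, ν; 0, 0, 0, 0, 1]

theorem tangentShear_mul_neg (θ : ℝ) : tangentShear (-θ) * tangentShear θ = 1 := by
  ext i j
  fin_cases i <;> fin_cases j <;> simp [tangentShear, Matrix.mul_apply, Fin.sum_univ_five] <;> ring

theorem coneShear_mul_neg (l μ ν : ℝ) : coneShear (-l) (-μ) (-ν) * coneShear l μ ν = 1 := by
  ext i j
  fin_cases i <;> fin_cases j <;> simp [coneShear, Matrix.mul_apply, Fin.sum_univ_five] <;> ring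

theorem nForm_tangentShear (θ : ℝ) (v : Fin 5 → ℝ) :
    nForm ((tangentShear θ).mulVec v) = nForm v := by
  simp [nForm, tangentShear, Matrix.mulVec, dotProduct, Fin.sum_univ_five]
  ring

theorem nForm_coneShear (l μ ν : ℝ) (v : Fin 5 → ℝ) :
    nForm ((coneShear l μ ν).mulVec v) = nForm v := by
  simp [nForm, coneShear, Matrix.mulVec, dotProduct, Fin.sum_univ_five]
  ring

theorem tangentShear_single (θ : ℝ) : (tangentShear θ).mulVec (Pi.single 0 1) = Pi.single 0 1 := by
  ext i
  fin_cases i <;> simp [tangentShear]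

theorem coneShear_single (l μ ν : ℝ) : (coneShear l μ ν).mulVec (Pi.single 0 1) = Pi.single 0 1 := by
  ext i
  fin_cases i <;> simp [coneShear]

/-- A curve on the cone in general position with respect to the coordinates. -/
structure GoodCurve (d : ℕ) (G : Fin 5 → MvPolynomial (Fin 2) ℝ) : Prop extends ConeCurve d G where
  -- In the chart x = 1: no pole at [1:0], simple poles only, and principal parts with nonzero last
  -- entry, as the partial fraction description requires. The tangent condition serves the angular
  -- velocity at the standard point.
  lead : eval ![1, 0] (G 0) ≠ 0
  simple : ∀ ζ : ℂ, aeval ![ζ, 1] (G 0) = 0 → aeval ![ζ, 1] (pderiv 0 (G 0)) ≠ 0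
  residue : ∀ ζ : ℂ, aeval ![ζ, 1] (G 0) = 0 → aeval ![ζ, 1] (G 3) ≠ 0
  tangent : eval ![0, 1] (pderiv 0 (G 3)) ≠ 0

theorem eventually_real_quadratic_ne {a b c : ℝ} (h : a ≠ 0 ∨ b ≠ 0 ∨ c ≠ 0) :
    ∀ᶠ x : ℝ in Filter.cofinite, a + b * x + c * x ^ 2 ≠ 0 := by
  filter_upwards [eventually_quadratic_ne (a := a) (b := b) (c := c) (by simpa using h)] with x hx h0
  exact hx (by exact_mod_cast h0)

/-- The new c' is c' + 2θb' + θ²a', a polynomial in θ that is not identically zero because the curve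
is immersed at the standard point. -/
theorem eventually_tangentShear {d : ℕ} {G : Fin 5 → MvPolynomial (Fin 2) ℝ} (h : ConeCurve d G) :
    ∀ᶠ θ : ℝ in Filter.cofinite,
      eval ![0, 1] (pderiv 0 (linComp (tangentShear θ) G 3)) ≠ 0 := by
  obtain ⟨j, hj, hne⟩ := h.tangent_ne
  filter_upwards [eventually_real_quadratic_ne (a := eval ![0, 1] (pderiv 0 (G 3)))
    (b := 2 * eval ![0, 1] (pderiv 0 (G 2))) (c := eval ![0, 1] (pderiv 0 (G 1))) (by
      simp only [Finset.mem_insert, Finset.mem_singleton] at hj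
      rcases hj with rfl | rfl | rfl
      · exact .inr (.inr hne)
      · exact .inr (.inl (by simpa using hne))
      · exact .inl hne)] with θ hθ h0
  refine hθ ?_
  rw [pderiv_linComp] at h0
  simp [linComp, tangentShear, Fin.sum_univ_five] at h0
  linear_combination h0

theorem eval_dehom_map (f : MvPolynomial (Fin 2) ℝ) (ζ : ℂ) :
    (dehom (map (algebraMap ℝ ℂ) f)).eval ζ = aeval ![ζ, 1] f := by
  rw [eval_dehom, aeval_eq_eval_map]

theorem eval_zero_dehom_map (f : MvPolynomial (Fin 2) ℝ) :
    (dehom (map (algebraMap ℝ ℂ) f)).eval 0 = (eval ![0, 1] f : ℝ) := by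
  rw [eval_dehom, ← eval_map_ofReal]
  congr 2
  ext i
  fin_cases i <;> simp

theorem derivative_dehom_map (f : MvPolynomial (Fin 2) ℝ) :
    Polynomial.derivative (dehom (map (algebraMap ℝ ℂ) f)) =
      dehom (map (algebraMap ℝ ℂ) (pderiv 0 f)) := by
  rw [← dehom_pderiv, pderiv_map]

theorem exists_coneShear {d : Fin 2 → ℕ} {G : Fin 2 → Fin 5 → MvPolynomial (Fin 2) ℝ}
    (h : ∀ i, ConeCurve (d i) (G i)) (ht : ∀ i, eval ![0, 1] (pderiv 0 (G i 3)) ≠ 0) :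
    ∃ l μ ν, ∀ i, GoodCurve (d i) (linComp (coneShear l μ ν) (G i)) := by
  let D : Fin 2 → Fin 5 → Polynomial ℂ := fun i j => dehom (map (algebraMap ℝ ℂ) (G i j))
  let v : Fin 2 → Fin 5 → ℂ := fun i j => (eval ![1, 0] (G i j) : ℝ)
  have hD : ∀ i ζ, ∃ j, (D i j).eval ζ ≠ 0 := fun i ζ => by
    simpa only [D, eval_dehom] using (h i).emb.no_common_zero ![ζ, 1] (by simp)
  have hv : ∀ i, ∃ j, v i j ≠ 0 := fun i => by
    by_contra! hcon
    exact (h i).emb.eval_ne_zero (z := ![1, 0]) (by simp) (funext fun j => by simpa [v] using hcon j)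
  have hD0 : ∀ i j, (D i j).eval 0 = (Pi.single 0 1 : Fin 5 → ℝ) j := fun i j => by
    simp only [D, eval_zero_dehom_map, (h i).base_apply]
  have hD3 : ∀ i, (Polynomial.derivative (D i 3)).eval 0 ≠ 0 := fun i => by
    simp only [D, derivative_dehom_map, eval_zero_dehom_map]
    exact_mod_cast ht i
  have hD4 : ∀ i, (Polynomial.derivative (D i 4)).eval 0 = 0 := fun i => by
    simp only [D, derivative_dehom_map, eval_zero_dehom_map, (h i).tangent_four]
    simp
  have hne3 : ∀ i, D i 3 ≠ 0 := fun i h0 => hD3 i (by rw [h0]; simp)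
  obtain ⟨ν, hν⟩ := (Filter.eventually_all.2 fun i =>
    eventually_generic_first (hD i) (hv i) (hne3 i)).exists
  have hg' : ∀ i, (Polynomial.derivative (D i 3 + Polynomial.C (ν : ℂ) * D i 4)).eval 0 ≠ 0 := fun i => by
    simpa [hD4] using hD3 i
  have hg : ∀ i, D i 3 + Polynomial.C (ν : ℂ) * D i 4 ≠ 0 := fun i h0 => hg' i (by rw [h0]; simp)
  obtain ⟨μ, hμ⟩ := (Filter.eventually_all.2 fun i =>
    eventually_generic_second (hg i) (hν i)).exists
  obtain ⟨l, hl⟩ := (Filter.eventually_all.2 fun i =>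
    eventually_generic_third (f := D i 0 + Polynomial.C (ν : ℂ) * D i 1 -
      Polynomial.C (2 * μ : ℂ) * D i 2 - Polynomial.C (μ ^ 2 : ℂ) * D i 4)
      (g := D i 3 + Polynomial.C (ν : ℂ) * D i 4)
      (vf := v i 0 + ν * v i 1 - 2 * μ * v i 2 - μ ^ 2 * v i 4) (vg := v i 3 + ν * v i 4)
      (fun ζ hζ => by simpa using (hμ i).1 ζ (by simpa using hζ)) (hμ i).2 (by
        -- At the standard point f = 1 and g = 0, so the Wronskian equals g' there, which is
        -- nonzero.
        intro h0
        have h1 := congrArg (Polynomial.eval 0) h0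
        rw [Polynomial.eval_sub, Polynomial.eval_mul, Polynomial.eval_mul, Polynomial.eval_zero] at h1
        refine hg' i ?_
        simpa [hD0] using h1)).exists
  refine ⟨l, μ, ν, fun i => ⟨(h i).linComp (coneShear_mul_neg l μ ν) (nForm_coneShear l μ ν)
    (coneShear_single l μ ν), ?_, ?_, ?_, ?_⟩⟩
  · intro h0
    refine (hl i).1 ?_
    simp only [v]
    simp [linComp, coneShear, Fin.sum_univ_five] at h0
    norm_cast
    push_cast
    linear_combination h0
  · intro ζ h0 h1
    refine ((hl i).2 ζ ?_).2 ?_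
    · simp only [D, Polynomial.eval_add, Polynomial.eval_sub, Polynomial.eval_mul, Polynomial.eval_C,
        eval_dehom_map]
      simp [linComp, coneShear, Fin.sum_univ_five] at h0
      linear_combination h0
    · simp only [D, Polynomial.derivative_add, Polynomial.derivative_sub, Polynomial.derivative_C_mul,
        derivative_dehom_map, Polynomial.eval_add, Polynomial.eval_sub, Polynomial.eval_mul,
        Polynomial.eval_C, eval_dehom_map]
      rw [pderiv_linComp] at h1
      simp [linComp, coneShear, Fin.sum_univ_five] at h1
      linear_combination h1
  · intro ζ h0 h1
    refine ((hl i).2 ζ ?_).1 ?_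
    · simp only [D, Polynomial.eval_add, Polynomial.eval_sub, Polynomial.eval_mul, Polynomial.eval_C,
        eval_dehom_map]
      simp [linComp, coneShear, Fin.sum_univ_five] at h0
      linear_combination h0
    · simp only [D, Polynomial.eval_add, Polynomial.eval_mul, Polynomial.eval_C, eval_dehom_map]
      simp [linComp, coneShear, Fin.sum_univ_five] at h1
      linear_combination h1
  · rw [pderiv_linComp]
    simp [linComp, coneShear, Fin.sum_univ_five, (h i).tangent_four]
    exact ht i

theorem exists_linearEquiv_of_shear {M M' : Matrix (Fin 5) (Fin 5) ℝ} (hM : M' * M = 1) :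
    ∃ T : (Fin 5 → ℝ) ≃ₗ[ℝ] (Fin 5 → ℝ), ∀ v, T v = M.mulVec v :=
  ⟨Matrix.toLin'OfInv hM (mul_eq_one_comm.1 hM), fun v => Matrix.toLin'_apply M v⟩

/-- Two knots on the quadric through a common point are, in suitable coordinates, in general position. -/
theorem exists_goodCurves {d : Fin 2 → ℕ} (K : ∀ i, RealRationalKnot (d i))
    (hK : ∀ i, (K i).points ⊆ quadric32) {p : Q32} (hp : ∀ i, p ∈ (K i).pointsInQ32) :
    ∃ (Λ : (Fin 5 → ℝ) ≃ₗ[ℝ] (Fin 5 → ℝ)) (G : Fin 2 → Fin 5 → MvPolynomial (Fin 2) ℝ),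
      (∀ x, nForm (Λ x) = form32 x) ∧ Λ p.1.rep = Pi.single 0 1 ∧ (∀ i, GoodCurve (d i) (G i)) ∧
      ∀ i, ∀ x : Q32, x ∈ (K i).pointsInQ32 ↔
        ∃ z : Fin 2 → ℝ, z ≠ 0 ∧ x.On (Λ.symm fun j => eval z (G i j)) := by
  obtain ⟨Λ, hΛ, hΛp⟩ := exists_normal_coordinates p.1.rep_nonzero p.2
  choose G hG hpts using fun i => (K i).exists_coneCurve (hK i) (hp i) hΛ hΛp
  obtain ⟨θ, hθ⟩ := (Filter.eventually_all.2 fun i => eventually_tangentShear (hG i)).exists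
  obtain ⟨l, μ, ν, hgood⟩ := exists_coneShear (fun i => (hG i).linComp (tangentShear_mul_neg θ)
    (nForm_tangentShear θ) (tangentShear_single θ)) hθ
  obtain ⟨T₁, hT₁⟩ := exists_linearEquiv_of_shear (tangentShear_mul_neg θ)
  obtain ⟨T₂, hT₂⟩ := exists_linearEquiv_of_shear (coneShear_mul_neg l μ ν)
  refine ⟨(Λ.trans T₁).trans T₂, _, fun x => ?_, ?_, hgood, fun i x => ?_⟩
  · rw [LinearEquiv.trans_apply, LinearEquiv.trans_apply, hT₂, hT₁, nForm_coneShear,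
      nForm_tangentShear, hΛ]
  · rw [LinearEquiv.trans_apply, LinearEquiv.trans_apply, hT₂, hT₁, hΛp, tangentShear_single,
      coneShear_single]
  · have hev : ∀ z : Fin 2 → ℝ, (((Λ.trans T₁).trans T₂).symm fun j => eval z (linComp (coneShear l μ ν)
        (linComp (tangentShear θ) (G i)) j)) = Λ.symm fun j => eval z (G i j) := fun z => by
      rw [LinearEquiv.symm_apply_eq, eval_linComp, eval_linComp]
      simp [hT₁, hT₂]
    rw [hpts]
    simp only [hev]

end

/-! ### Affine charts and angular velocity near the standard point -/

noncomputable section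

open MvPolynomial

section binary

/-- The exponent of `X 0 ^ k * X 1 ^ (d - k)`. -/
def binaryExponent (d k : ℕ) : Fin 2 →₀ ℕ := Finsupp.single 0 k + Finsupp.single 1 (d - k)

variable {R : Type*} [CommRing R] {d : ℕ} {f : MvPolynomial (Fin 2) R}

theorem eval_eq_sum_binary (hf : f.IsHomogeneous d) (z : Fin 2 → R) :
    eval z f = ∑ k ∈ Finset.range (d + 1), coeff (binaryExponent d k) f * (z 0 ^ k * z 1 ^ (d - k)) := by
  have hinj : Set.InjOn (binaryExponent d) (Finset.range (d + 1)) := by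
    intro a _ b _ hab
    have := DFunLike.congr_fun hab 0
    simpa [binaryExponent] using this
  have hterm : ∀ k, coeff (binaryExponent d k) f * (z 0 ^ k * z 1 ^ (d - k)) =
      coeff (binaryExponent d k) f * ∏ i, z i ^ binaryExponent d k i := fun k => by
    simp [binaryExponent, Fin.prod_univ_two]
  simp only [hterm]
  rw [← Finset.sum_image (f := fun n => coeff n f * ∏ i, z i ^ n i) hinj, eval_eq']
  refine Finset.sum_subset (fun n hn => ?_) fun n _ hn => by
    rw [notMem_support_iff.1 hn, zero_mul]
  have h1 : n.weight 1 = d := hf (by simpa using hn)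
  have h2 : n 0 + n 1 = d := by
    rw [← h1]
    simp [Finsupp.weight_apply, Finsupp.sum_fintype, Fin.sum_univ_two]
  refine Finset.mem_image.2 ⟨n 0, Finset.mem_range.2 (by lia), ?_⟩
  ext i
  fin_cases i <;> simp [binaryExponent]
  lia

theorem MvPolynomial.IsHomogeneous.eval_smul_vec (hf : f.IsHomogeneous d) (c : R) (z : Fin 2 → R) :
    eval (c • z) f = c ^ d * eval z f := by
  rw [eval_eq_sum_binary hf, eval_eq_sum_binary hf, Finset.mul_sum]
  refine Finset.sum_congr rfl fun k hk => ?_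
  have : d = k + (d - k) := by have := Finset.mem_range.1 hk; lia
  have hc : c ^ d = c ^ k * c ^ (d - k) := by rw [← pow_add, ← this]
  simp only [Pi.smul_apply, smul_eq_mul, mul_pow, hc]
  ring

theorem MvPolynomial.IsHomogeneous.euler (hf : f.IsHomogeneous d) (z : Fin 2 → R) :
    z 0 * eval z (pderiv 0 f) + z 1 * eval z (pderiv 1 f) = d * eval z f := by
  have := congrArg (eval z) hf.sum_X_mul_pderiv
  simpa [Fin.sum_univ_two] using this

theorem hasDerivAt_eval_one_left (f : MvPolynomial (Fin 2) ℝ) (u : ℝ) :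
    HasDerivAt (fun u => eval ![1, u] f) (eval ![1, u] (pderiv 1 f)) u := by
  induction f using MvPolynomial.induction_on with
  | C a => simpa using hasDerivAt_const u a
  | add p q hp hq => simpa using hp.fun_add hq
  | mul_X p i hp =>
    fin_cases i
    · simpa [Derivation.leibniz, pderiv_X] using hp
    · have := hp.fun_mul (hasDerivAt_id' u)
      simpa [Derivation.leibniz, pderiv_X, mul_comm, add_comm] using this

theorem hasDerivAt_eval_one_right (f : MvPolynomial (Fin 2) ℝ) (u : ℝ) :
    HasDerivAt (fun u => eval ![u, 1] f) (eval ![u, 1] (pderiv 0 f)) u := by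
  induction f using MvPolynomial.induction_on with
  | C a => simpa using hasDerivAt_const u a
  | add p q hp hq => simpa using hp.fun_add hq
  | mul_X p i hp =>
    fin_cases i
    · have := hp.fun_mul (hasDerivAt_id' u)
      simpa [Derivation.leibniz, pderiv_X, mul_comm, add_comm] using this
    · simpa [Derivation.leibniz, pderiv_X] using hp

theorem ContDiff.eval_mvPolynomial {E : Type*} [NormedAddCommGroup E] [NormedSpace ℝ E]
    {z : E → Fin 2 → ℝ} (hz : ∀ i, ContDiff ℝ ∞ fun x => z x i) (f : MvPolynomial (Fin 2) ℝ) :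
    ContDiff ℝ ∞ fun x => eval (z x) f := by
  induction f using MvPolynomial.induction_on with
  | C a => simpa using contDiff_const
  | add p q hp hq => simpa using hp.add hq
  | mul_X p i hp => simpa using hp.mul (hz i)

theorem tendsto_inv_cocompact : Filter.Tendsto (fun u : ℝ => u⁻¹) (Filter.cocompact ℝ) (𝓝[≠] 0) := by
  rw [← Metric.cobounded_eq_cocompact]
  exact Filter.tendsto_inv₀_cobounded'

theorem eventually_ne_zero_cocompact : ∀ᶠ u : ℝ in Filter.cocompact ℝ, u ≠ 0 :=
  (tendsto_inv_cocompact.eventually self_mem_nhdsWithin).mono fun u hu => by simpa using hu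

theorem vec_one_left {u : ℝ} (hu : u ≠ 0) : (![1, u] : Fin 2 → ℝ) = u • ![u⁻¹, 1] := by
  ext i
  fin_cases i <;> simp [hu]

theorem eventually_eval_one_left_ne {d : ℕ} {f : MvPolynomial (Fin 2) ℝ} (hf : f.IsHomogeneous d)
    (h : ∀ᶠ w in 𝓝[≠] (0 : ℝ), eval ![w, 1] f ≠ 0) :
    ∀ᶠ u in Filter.cocompact ℝ, eval ![1, u] f ≠ 0 := by
  filter_upwards [tendsto_inv_cocompact.eventually h, eventually_ne_zero_cocompact] with u hu hu0
  rw [vec_one_left hu0, hf.eval_smul_vec]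
  exact mul_ne_zero (pow_ne_zero _ hu0) hu

/-- The plane curve given by two forms has nonzero angular velocity near a parameter at which
the second form has a simple zero. -/
theorem eventually_angular_ne {d : ℕ} {R J : MvPolynomial (Fin 2) ℝ} (hR : R.IsHomogeneous d)
    (hJ : J.IsHomogeneous d) (hR0 : eval ![0, 1] R ≠ 0) (hJ0 : eval ![0, 1] J = 0)
    (hJ1 : eval ![0, 1] (pderiv 0 J) ≠ 0) :
    ∀ᶠ u in Filter.cocompact ℝ, eval ![1, u] J ≠ 0 ∧
      eval ![1, u] R * eval ![1, u] (pderiv 1 J) - eval ![1, u] J * eval ![1, u] (pderiv 1 R) ≠ 0 := by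
  refine Filter.Eventually.and ?_ ?_
  · refine eventually_eval_one_left_ne hJ ?_
    have := (hasDerivAt_eval_one_right J 0).eventually_ne (c := 0) hJ1
    exact this
  · have hd : (d : ℝ) ≠ 0 := by
      intro hd
      obtain rfl : d = 0 := by exact_mod_cast hd
      rw [← totalDegree_zero_iff_isHomogeneous, totalDegree_eq_zero_iff_eq_C] at hJ
      rw [hJ] at hJ1
      simp at hJ1
    -- By Euler's relation the angular velocity in the chart [1:u] is, up to the factor d, this
    -- Jacobian. Being a form, it is nonzero for large |u| once it is nonzero at [0:1].
    let W := pderiv 0 R * pderiv 1 J - pderiv 1 R * pderiv 0 J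
    have hW : W.IsHomogeneous ((d - 1) + (d - 1)) :=
      ((hR.pderiv).mul hJ.pderiv).sub ((hR.pderiv).mul hJ.pderiv)
    have hW0 : eval ![0, 1] W ≠ 0 := by
      have e1 := hJ.euler ![0, 1]
      have e2 := hR.euler ![0, 1]
      simp [hJ0] at e1 e2
      simp only [W, map_sub, map_mul, e1, e2]
      simpa using ⟨⟨by exact_mod_cast hd, hR0⟩, hJ1⟩
    have hc : Continuous fun w : ℝ => eval ![w, 1] W :=
      continuous_iff_continuousAt.2 fun w => (hasDerivAt_eval_one_right W w).continuousAt
    have h1 := (hc.tendsto 0).eventually (isOpen_ne.mem_nhds hW0)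
    filter_upwards [eventually_eval_one_left_ne hW (h1.filter_mono nhdsWithin_le_nhds)] with u hu h0
    refine hu ?_
    have e1 := hJ.euler ![1, u]
    have e2 := hR.euler ![1, u]
    simp at e1 e2
    simp only [W, map_sub, map_mul]
    linear_combination d * h0 + eval ![1, u] (pderiv 1 J) * e2 - eval ![1, u] (pderiv 1 R) * e1

end binary

/-- Coordinates in which `nForm` is a difference of squared norms. -/
def splitEquiv (h : ℝ) (hh : h ≠ 0) : (Fin 5 → ℝ) ≃L[ℝ] ℂ × EuclideanSpace ℝ (Fin 3) :=
  LinearEquiv.toContinuousLinearEquiv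
    -- The factor h scales a and c inversely and so leaves ac unchanged. It is a free parameter,
    -- used to make the derivative of ha + h⁻¹c nonzero at the standard point.
    { toFun := fun v => (⟨(v 0 - v 4) / 2, (h * v 1 + h⁻¹ * v 3) / 2⟩,
        !₂[(v 0 + v 4) / 2, v 2, (h * v 1 - h⁻¹ * v 3) / 2])
      map_add' := fun v w => by
        refine Prod.ext (Complex.ext ?_ ?_) ?_
        · simp; ring
        · simp; ring
        · ext i
          fin_cases i <;> simp <;> ring
      map_smul' := fun c v => by
        refine Prod.ext (Complex.ext ?_ ?_) ?_
        · simp; ring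
        · simp; ring
        · ext i
          fin_cases i <;> simp <;> ring
      invFun := fun x => ![x.2 0 + x.1.re, h⁻¹ * (x.1.im + x.2 2), x.2 1, h * (x.1.im - x.2 2),
        x.2 0 - x.1.re]
      left_inv := fun v => by
        ext i
        fin_cases i <;> simp <;> field_simp <;> ring
      right_inv := fun x => by
        refine Prod.ext (Complex.ext ?_ ?_) ?_
        · simp
        · simp; field_simp; ring
        · ext i
          fin_cases i <;> simp <;> field_simp <;> ring }

theorem splitEquiv_fst (h : ℝ) (hh : h ≠ 0) (v : Fin 5 → ℝ) :
    (splitEquiv h hh v).1 = ⟨(v 0 - v 4) / 2, (h * v 1 + h⁻¹ * v 3) / 2⟩ := rfl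

theorem nForm_eq_splitEquiv (h : ℝ) (hh : h ≠ 0) (v : Fin 5 → ℝ) :
    nForm v = ‖(splitEquiv h hh v).2‖ ^ 2 - ‖(splitEquiv h hh v).1‖ ^ 2 := by
  have h2 : (splitEquiv h hh v).2 = !₂[(v 0 + v 4) / 2, v 2, (h * v 1 - h⁻¹ * v 3) / 2] := rfl
  rw [splitEquiv_fst, h2, EuclideanSpace.real_norm_sq_eq, Fin.sum_univ_three, Complex.sq_norm,
    Complex.normSq_mk]
  simp [nForm]
  field_simp
  ring

namespace ConeCurve

variable {d : ℕ} {G : Fin 5 → MvPolynomial (Fin 2) ℝ}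

theorem eval_smul_vec (h : ConeCurve d G) (c : ℝ) (z : Fin 2 → ℝ) :
    (fun j => eval (c • z) (G j)) = c ^ d • fun j => eval z (G j) := by
  ext j
  simp [(h.hom j).eval_smul_vec]

theorem nForm_eval (h : ConeCurve d G) (z : Fin 2 → ℝ) : (nForm fun j => eval z (G j)) = 0 := by
  rw [← eval_nForm, h.cone, map_zero]

theorem injective_real (h : ConeCurve d G) {z w : Fin 2 → ℝ} (hz : z ≠ 0) (hw : w ≠ 0) {c : ℝ}
    (hc : (fun j => eval z (G j)) = c • fun j => eval w (G j)) : ∃ c' : ℝ, z = c' • w := by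
  have hne : ∀ {z : Fin 2 → ℝ}, z ≠ 0 → (fun i => (z i : ℂ)) ≠ 0 := fun hz h0 => hz (by
    ext i
    simpa using congrFun h0 i)
  obtain ⟨c', h'⟩ := h.emb.injective _ _ (hne hz) (hne hw) ⟨c, fun j => by
    rw [eval_map_ofReal, eval_map_ofReal, congrFun hc j]
    simp⟩
  refine ⟨c'.re, ?_⟩
  ext i
  have := congrArg Complex.re (congrFun h' i)
  simpa using this

/-- If ∂₁ were proportional to the curve itself, so would ∂₀ be, by Euler's relation, and the
Jacobian would have rank less than two. -/
theorem immersive_real (h : ConeCurve d G) (u c : ℝ) :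
    (fun j => eval ![1, u] (pderiv 1 (G j))) ≠ c • fun j => eval ![1, u] (G j) := by
  intro hc
  have h1 := h.emb.immersive ![1, u] (by simp)
  have hz : (![1, (u : ℂ)] : Fin 2 → ℂ) = fun i => ((![1, u] : Fin 2 → ℝ) i : ℂ) := by
    ext i
    fin_cases i <;> simp
  have hc' : ∀ j, eval ![1, u] (pderiv 1 (G j)) = c * eval ![1, u] (G j) := fun j => congrFun hc j
  have he : ∀ j, eval ![1, u] (pderiv 0 (G j)) = (d - u * c) * eval ![1, u] (G j) := fun j => by
    have := (h.hom j).euler ![1, u]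
    simp [hc'] at this
    linear_combination this
  have h2 := Fintype.linearIndependent_iff.1 h1 ![(c : ℂ), -((d - u * c : ℝ) : ℂ)] (by
    ext j
    simp only [Fin.sum_univ_two, Pi.add_apply, Pi.smul_apply, smul_eq_mul, pderiv_map, hz,
      eval_map_ofReal, he, hc', Matrix.cons_val_zero, Matrix.cons_val_one, Pi.zero_apply]
    push_cast
    ring) 0
  have hc0 : c = 0 := by simpa using h2
  refine h1.ne_zero 1 ?_
  ext j
  simp only [hz, pderiv_map, eval_map_ofReal, hc', hc0]
  simp

theorem one_le (h : ConeCurve d G) : 1 ≤ d := by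
  by_contra! hd
  obtain rfl : d = 0 := by lia
  refine h.emb.immersive ![1, 0] (by simp) |>.ne_zero 1 ?_
  ext j
  have := h.hom j
  rw [← totalDegree_zero_iff_isHomogeneous, totalDegree_eq_zero_iff_eq_C] at this
  rw [this]
  simp

end ConeCurve

/-- A projection in which the curves have nonzero angular velocity near the standard point. -/
theorem exists_split_angular {d : Fin 2 → ℕ} {G : Fin 2 → Fin 5 → MvPolynomial (Fin 2) ℝ}
    (hG : ∀ i, GoodCurve (d i) (G i)) :
    ∃ (h : ℝ) (hh : h ≠ 0) (M : ℝ), 0 < M ∧ ∀ i u, M ≤ |u| →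
      (splitEquiv h hh fun j => eval ![1, u] (G i j)).1.im ≠ 0 ∧
      ((starRingEnd ℂ) (splitEquiv h hh fun j => eval ![1, u] (G i j)).1 *
        (splitEquiv h hh fun j => eval ![1, u] (pderiv 1 (G i j))).1).im ≠ 0 := by
  -- The condition h²a' + c' ≠ 0 fails for only finitely many h because c' ≠ 0 for both curves.
  obtain ⟨h, hh, hne⟩ := (Filter.Eventually.and (p := fun h : ℝ => h ≠ 0)
    (Set.finite_singleton (0 : ℝ)).compl_mem_cofinite
    (Filter.eventually_all.2 fun i => eventually_real_quadratic_ne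
      (a := eval ![0, 1] (pderiv 0 (G i 3))) (b := 0) (c := eval ![0, 1] (pderiv 0 (G i 1)))
      (.inl (hG i).tangent))).exists
  have hh0 : h ≠ 0 := hh
  have key : ∀ i, ∀ᶠ u in Filter.cocompact ℝ,
      (splitEquiv h hh0 fun j => eval ![1, u] (G i j)).1.im ≠ 0 ∧
      ((starRingEnd ℂ) (splitEquiv h hh0 fun j => eval ![1, u] (G i j)).1 *
        (splitEquiv h hh0 fun j => eval ![1, u] (pderiv 1 (G i j))).1).im ≠ 0 := by
    intro i
    have hhom := (hG i).hom
    have hC : ∀ (a : ℝ) {f : MvPolynomial (Fin 2) ℝ}, f.IsHomogeneous (d i) →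
        (C a * f).IsHomogeneous (d i) := fun a f hf => by
      simpa using (isHomogeneous_C (Fin 2) a).mul hf
    filter_upwards [eventually_angular_ne (R := C 2⁻¹ * (G i 0 - G i 4))
      (J := C 2⁻¹ * (C h * G i 1 + C h⁻¹ * G i 3)) (hC _ ((hhom 0).sub (hhom 4)))
      (hC _ ((hC _ (hhom 1)).add (hC _ (hhom 3)))) (by simp [(hG i).base_apply])
      (by simp [(hG i).base_apply]) (by
        simp [Derivation.leibniz]
        intro h0
        refine hne i ?_
        field_simp at h0
        linear_combination h0)] with u hu
    obtain ⟨h1, h2⟩ := hu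
    simp only [splitEquiv_fst]
    refine ⟨fun h0 => h1 ?_, fun h0 => h2 ?_⟩
    · simp
      linear_combination 2 * h0
    · simp [Derivation.leibniz] at h0 ⊢
      linear_combination h0
  obtain ⟨M, hM⟩ := (Metric.hasBasis_cobounded_compl_closedBall (0 : ℝ)).eventually_iff.1
    (Metric.cobounded_eq_cocompact (α := ℝ) ▸ Filter.eventually_all.2 key)
  refine ⟨h, hh0, |M| + 1, by positivity, fun i u hu => hM.2 ?_ i⟩
  simp only [Set.mem_compl_iff, Metric.mem_closedBall, dist_zero_right, Real.norm_eq_abs, not_le]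
  linarith [le_abs_self M]

end

/-! ### Gluing by addition in the affine chart -/

noncomputable section

open MvPolynomial

section product

variable {R : Type*} [CommRing R]

/-- A commutative product for which the cone `nForm = 0` is multiplicatively closed. -/
def coneMul (v w : Fin 5 → R) : Fin 5 → R :=
  ![v 0 * w 0, v 0 * w 1 + w 0 * v 1, v 0 * w 2 + w 0 * v 2, v 0 * w 3 + w 0 * v 3,
    v 0 * w 4 + w 0 * v 4 + (v 1 * w 3 + v 3 * w 1 - 2 * v 2 * w 2)]

theorem coneMul_comm (v w : Fin 5 → R) : coneMul v w = coneMul w v := by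
  ext i
  fin_cases i <;> simp [coneMul] <;> ring

/-- In the chart x = 1 the cone is the graph y = ac - b², and `coneMul` adds the coordinates (a, b,
c); the mixed term in the last entry is the polarisation of ac - b². -/
theorem nForm_coneMul (v w : Fin 5 → R) :
    nForm (coneMul v w) = v 0 ^ 2 * nForm w + w 0 ^ 2 * nForm v := by
  simp [nForm, coneMul]
  ring

theorem coneMul_single (v : Fin 5 → R) : coneMul v (Pi.single 0 1) = v := by
  ext i
  fin_cases i <;> simp [coneMul]

theorem coneMul_smul (a b : R) (v w : Fin 5 → R) :
    coneMul (a • v) (b • w) = (a * b) • coneMul v w := by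
  ext i
  fin_cases i <;> simp [coneMul] <;> ring

theorem map_coneMul {S : Type*} [CommRing S] (φ : R →+* S) (v w : Fin 5 → R) :
    (fun i => φ (coneMul v w i)) = coneMul (fun i => φ (v i)) fun i => φ (w i) := by
  ext i
  fin_cases i <;> simp [coneMul, map_ofNat]

theorem continuous_coneMul : Continuous fun x : (Fin 5 → ℝ) × (Fin 5 → ℝ) => coneMul x.1 x.2 := by
  refine continuous_pi fun i => ?_
  fin_cases i <;> simp [coneMul] <;> fun_prop

theorem ContDiff.coneMul {E : Type*} [NormedAddCommGroup E] [NormedSpace ℝ E]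
    {v w : E → Fin 5 → ℝ} (hv : ContDiff ℝ ∞ v) (hw : ContDiff ℝ ∞ w) :
    ContDiff ℝ ∞ fun x => coneMul (v x) (w x) := by
  have h1 : ∀ i, ContDiff ℝ ∞ fun x => v x i := contDiff_pi.1 hv
  have h2 : ∀ i, ContDiff ℝ ∞ fun x => w x i := contDiff_pi.1 hw
  refine contDiff_pi.2 fun i => ?_
  fin_cases i <;> simp [_root_.coneMul] <;> fun_prop

theorem isHomogeneous_coneMul {a b : ℕ} {P Q : Fin 5 → MvPolynomial (Fin 2) R}
    (hP : ∀ i, (P i).IsHomogeneous a) (hQ : ∀ i, (Q i).IsHomogeneous b) (i : Fin 5) :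
    (coneMul P Q i).IsHomogeneous (a + b) := by
  have h : ∀ i j, (P i * Q j).IsHomogeneous (a + b) := fun i j => (hP i).mul (hQ j)
  have h' : ∀ i j, (Q i * P j).IsHomogeneous (a + b) := fun i j => by
    rw [mul_comm]
    exact h j i
  have h2 : (2 * P 2 * Q 2).IsHomogeneous (a + b) := by
    have := (isHomogeneous_C (Fin 2) (2 : R)).mul (h 2 2)
    rw [zero_add] at this
    rwa [mul_assoc]
  fin_cases i
  exacts [h 0 0, (h 0 1).add (h' 0 1), (h 0 2).add (h' 0 2), (h 0 3).add (h' 0 3),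
    ((h 0 4).add (h' 0 4)).add (((h 1 3).add (h 3 1)).sub h2)]

/-- The curve obtained by gluing two curves at the standard point with parameter `ε`. -/
def glue (ε : R) (P Q : Fin 5 → MvPolynomial (Fin 2) R) : Fin 5 → MvPolynomial (Fin 2) R :=
  coneMul P fun j => reparam !![0, ε; 1, 0] (Q j)

/-- The second curve enters as Q(εt, s). Away from [0:1] it tends, up to a scalar, to the unit
Q(0,1) as ε → 0, so only P remains there. -/
theorem eval_glue (ε : R) (P Q : Fin 5 → MvPolynomial (Fin 2) R) (z : Fin 2 → R) :
    (fun j => eval z (glue ε P Q j)) =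
      coneMul (fun j => eval z (P j)) fun j => eval ![ε * z 1, z 0] (Q j) := by
  have hz : (!![0, ε; 1, 0] : Matrix (Fin 2) (Fin 2) R).mulVec z = ![ε * z 1, z 0] := by
    ext i
    fin_cases i <;> simp [Matrix.mulVec, dotProduct]
  rw [glue, map_coneMul]
  simp only [eval_reparam, hz]

theorem map_glue {S : Type*} [CommRing S] (φ : R →+* S) (ε : R)
    (P Q : Fin 5 → MvPolynomial (Fin 2) R) :
    (fun j => map φ (glue ε P Q j)) = glue (φ ε) (fun j => map φ (P j)) fun j => map φ (Q j) := by
  have hz : (!![0, ε; 1, 0] : Matrix (Fin 2) (Fin 2) R).map φ = !![0, φ ε; 1, 0] := by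
    ext i j
    fin_cases i <;> fin_cases j <;> simp
  rw [glue, map_coneMul]
  simp only [map_reparam, hz, glue]

end product

section roots

variable {a b : ℕ} {P Q : Fin 5 → MvPolynomial (Fin 2) ℂ} {ε : ℂ}

theorem vec_one_right {ε ζ : ℂ} (hζ : ζ ≠ 0) : (![ε, ζ] : Fin 2 → ℂ) = ζ • ![ε / ζ, 1] := by
  ext i
  fin_cases i <;> simp
  field_simp

/-- The first coordinate of a product is the product of the first coordinates. If the poles of the
two factors are disjoint, the poles of the glued curve are simple and inherit nonzero residues. -/
theorem glue_roots (hQ : ∀ i, (Q i).IsHomogeneous b) (hε : ε ≠ 0) (hQ1 : eval ![1, 0] (Q 0) ≠ 0)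
    (hsQ : ∀ ζ, eval ![ζ, 1] (Q 0) = 0 → eval ![ζ, 1] (pderiv 0 (Q 0)) ≠ 0)
    (hrQ : ∀ ζ, eval ![ζ, 1] (Q 0) = 0 → eval ![ζ, 1] (Q 3) ≠ 0)
    (hsP : ∀ ζ, eval ![ζ, 1] (P 0) = 0 → eval ![ζ, 1] (pderiv 0 (P 0)) ≠ 0)
    (hrP : ∀ ζ, eval ![ζ, 1] (P 0) = 0 → eval ![ζ, 1] (P 3) ≠ 0)
    (hPQ : ∀ ζ, eval ![ζ, 1] (P 0) = 0 → eval ![ε, ζ] (Q 0) ≠ 0)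
    {ζ : ℂ} (h0 : eval ![ζ, 1] (glue ε P Q 0) = 0) :
    eval ![ζ, 1] (pderiv 0 (glue ε P Q 0)) ≠ 0 ∧ eval ![ζ, 1] (glue ε P Q 3) ≠ 0 := by
  have e0 : eval ![ζ, 1] (glue ε P Q 0) = eval ![ζ, 1] (P 0) * eval ![ε, ζ] (Q 0) := by
    have := congrFun (eval_glue ε P Q ![ζ, 1]) 0
    simpa [coneMul] using this
  have e3 : eval ![ζ, 1] (glue ε P Q 3) = eval ![ζ, 1] (P 0) * eval ![ε, ζ] (Q 3) +
      eval ![ε, ζ] (Q 0) * eval ![ζ, 1] (P 3) := by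
    have := congrFun (eval_glue ε P Q ![ζ, 1]) 3
    simpa [coneMul] using this
  have hz : (!![0, ε; 1, 0] : Matrix (Fin 2) (Fin 2) ℂ).mulVec ![ζ, 1] = ![ε, ζ] := by
    ext i
    fin_cases i <;> simp [Matrix.mulVec, dotProduct]
  have ed : eval ![ζ, 1] (pderiv 0 (glue ε P Q 0)) = eval ![ζ, 1] (P 0) * eval ![ε, ζ] (pderiv 1 (Q 0)) +
      eval ![ε, ζ] (Q 0) * eval ![ζ, 1] (pderiv 0 (P 0)) := by
    change eval ![ζ, 1] (pderiv 0 (P 0 * reparam !![0, ε; 1, 0] (Q 0))) = _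
    rw [Derivation.leibniz, pderiv_reparam]
    simp only [smul_eq_mul, map_add, map_mul, eval_C, eval_reparam, hz]
    simp
  rw [ed, e3]
  rw [e0] at h0
  by_cases hp : eval ![ζ, 1] (P 0) = 0
  · rw [hp, zero_mul, zero_mul, zero_add, zero_add]
    exact ⟨mul_ne_zero (hPQ ζ hp) (hsP ζ hp), mul_ne_zero (hPQ ζ hp) (hrP ζ hp)⟩
  · have hq := (mul_eq_zero.1 h0).resolve_left hp
    have hζ : ζ ≠ 0 := by
      rintro rfl
      have hv : (![ε, 0] : Fin 2 → ℂ) = ε • ![1, 0] := by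
        ext i
        fin_cases i <;> simp
      rw [hv, (hQ 0).eval_smul_vec] at hq
      exact mul_ne_zero (pow_ne_zero _ hε) hQ1 hq
    have hq' : eval ![ε / ζ, 1] (Q 0) = 0 := by
      rw [vec_one_right hζ, (hQ 0).eval_smul_vec] at hq
      exact (mul_eq_zero.1 hq).resolve_left (pow_ne_zero _ hζ)
    rw [hq, zero_mul, zero_mul, add_zero, add_zero]
    refine ⟨mul_ne_zero hp fun h1 => ?_, mul_ne_zero hp ?_⟩
    -- The derivative falls on the other variable of Q; at a zero of Q₀ Euler's relation trades one
    -- partial derivative for the other.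
    · have e := (hQ 0).euler ![ε, ζ]
      simp [hq, h1, hε] at e
      rw [vec_one_right hζ, (hQ 0).pderiv.eval_smul_vec] at e
      exact mul_ne_zero (pow_ne_zero _ hζ) (hsQ _ hq') e
    · rw [vec_one_right hζ, (hQ 3).eval_smul_vec]
      exact mul_ne_zero (pow_ne_zero _ hζ) (hrQ _ hq')

theorem continuous_eval_mvPolynomial {X : Type*} [TopologicalSpace X] {A : Type*} [CommRing A]
    [TopologicalSpace A] [IsTopologicalRing A] {z : X → Fin 2 → A} (hz : Continuous z)
    (f : MvPolynomial (Fin 2) A) : Continuous fun x => eval (z x) f :=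
  (continuous_eval f).comp hz

/-- At ε = 0 the second factor is ζᵇ Q₀(0,1), which is nonzero at the finitely many roots ζ ≠ 0 of
the first. -/
theorem eventually_glue_roots_disjoint (hP0 : eval ![0, 1] (P 0) ≠ 0) (hQ : ∀ i, (Q i).IsHomogeneous b)
    (hQ0 : eval ![0, 1] (Q 0) ≠ 0) :
    ∀ᶠ ε in 𝓝 (0 : ℂ), ∀ ζ, eval ![ζ, 1] (P 0) = 0 → eval ![ε, ζ] (Q 0) ≠ 0 := by
  have hne : dehom (P 0) ≠ 0 := fun h => hP0 (by rw [← eval_dehom, h, Polynomial.eval_zero])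
  refine ((Filter.eventually_all_finite (Polynomial.finite_setOfPred_isRoot hne)).2
    fun ζ hζ => ?_).mono fun ε hε ζ hζ => hε ζ (by
      change Polynomial.eval ζ _ = 0
      rwa [eval_dehom])
  have hζ' : Polynomial.eval ζ (dehom (P 0)) = 0 := hζ
  rw [eval_dehom] at hζ'
  have hζ0 : ζ ≠ 0 := by
    rintro rfl
    exact hP0 hζ'
  have hc : Continuous fun ε : ℂ => eval ![ε, ζ] (Q 0) :=
    continuous_eval_mvPolynomial (continuous_pi fun i => by fin_cases i <;> simp <;> fun_prop) _
  refine hc.tendsto 0 |>.eventually (isOpen_ne.mem_nhds ?_)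
  rw [vec_one_right hζ0, (hQ 0).eval_smul_vec, zero_div]
  exact mul_ne_zero (pow_ne_zero _ hζ0) hQ0

end roots

/-- For small gluing parameters the glued curve can be approximated by embedded ones. -/
theorem eventually_glue_approx {a b : ℕ} {P Q : Fin 5 → MvPolynomial (Fin 2) ℝ} (hP : GoodCurve a P)
    (hQ : GoodCurve b Q) :
    ∀ᶠ ε : ℝ in 𝓝[≠] 0, ∀ (s : Finset (Fin 2 →₀ ℕ)) {η : ℝ}, 0 < η →
      ∃ F : Fin 5 → MvPolynomial (Fin 2) ℝ, (∀ i, (F i).IsHomogeneous (a + b)) ∧ nForm F = 0 ∧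
        (∀ i, ∀ n ∈ s, |coeff n (F i) - coeff n (glue ε P Q i)| < η) ∧
        IsEmbedding fun i => map (algebraMap ℝ ℂ) (F i) := by
  have hz1 : ∀ f : MvPolynomial (Fin 2) ℝ, eval ![0, 1] (map (algebraMap ℝ ℂ) f) = (eval ![0, 1] f : ℝ) := by
    intro f
    rw [← eval_dehom, eval_zero_dehom_map]
  have hz2 : ∀ f : MvPolynomial (Fin 2) ℝ, eval ![1, 0] (map (algebraMap ℝ ℂ) f) = (eval ![1, 0] f : ℝ) := by
    intro f
    rw [← eval_map_ofReal]
    congr 2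
    ext i
    fin_cases i <;> simp
  have h1 : ∀ᶠ ε : ℝ in 𝓝 0, ∀ ζ : ℂ, eval ![ζ, 1] (map (algebraMap ℝ ℂ) (P 0)) = 0 →
      eval ![(ε : ℂ), ζ] (map (algebraMap ℝ ℂ) (Q 0)) ≠ 0 :=
    (Complex.continuous_ofReal.tendsto' (0 : ℝ) (0 : ℂ) Complex.ofReal_zero).eventually
      (eventually_glue_roots_disjoint (P := fun i => map (algebraMap ℝ ℂ) (P i))
        (Q := fun i => map (algebraMap ℝ ℂ) (Q i)) (by simp [hz1, hP.base_apply])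
        (fun i => (hQ.hom i).map _) (by simp [hz1, hQ.base_apply]))
  filter_upwards [h1.filter_mono nhdsWithin_le_nhds, self_mem_nhdsWithin] with ε hε hε0 s η hη
  have hε0' : (ε : ℂ) ≠ 0 := Complex.ofReal_ne_zero.2 hε0
  have hmap : ∀ j, map (algebraMap ℝ ℂ) (glue ε P Q j) =
      glue (ε : ℂ) (fun j => map (algebraMap ℝ ℂ) (P j)) (fun j => map (algebraMap ℝ ℂ) (Q j)) j :=
    fun j => congrFun (map_glue (algebraMap ℝ ℂ) ε P Q) j
  have hroots : ∀ ζ : ℂ, aeval ![ζ, 1] (glue ε P Q 0) = 0 →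
      aeval ![ζ, 1] (pderiv 0 (glue ε P Q 0)) ≠ 0 ∧ aeval ![ζ, 1] (glue ε P Q 3) ≠ 0 := by
    intro ζ hζ
    simp only [aeval_eq_eval_map, ← pderiv_map, hmap] at hζ ⊢
    refine glue_roots (b := b) (fun i => (hQ.hom i).map _) hε0' ?_ ?_ ?_ ?_ ?_ hε hζ
    · rw [hz2]
      exact_mod_cast hQ.lead
    · simpa only [aeval_eq_eval_map, ← pderiv_map] using hQ.simple
    · simpa only [aeval_eq_eval_map] using hQ.residue
    · simpa only [aeval_eq_eval_map, ← pderiv_map] using hP.simple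
    · simpa only [aeval_eq_eval_map] using hP.residue
  refine exists_isEmbedding_approx (by have := hP.one_le; have := hQ.one_le; lia) (glue ε P Q)
    (isHomogeneous_coneMul hP.hom fun i => isHomogeneous_reparam _ (hQ.hom i)) ?_ ?_
    (fun ζ hζ => (hroots ζ hζ).1) (fun ζ hζ => (hroots ζ hζ).2) s hη
  · change nForm (glue ε P Q) = 0
    refine MvPolynomial.funext fun z => ?_
    rw [eval_nForm, eval_glue, nForm_coneMul, hP.nForm_eval, hQ.nForm_eval]
    simp
  · have := congrFun (eval_glue ε P Q ![1, 0]) 0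
    have e : (![ε * (![1, 0] : Fin 2 → ℝ) 1, (![1, 0] : Fin 2 → ℝ) 0] : Fin 2 → ℝ) = ![0, 1] := by simp
    rw [this, e]
    simpa [coneMul, hQ.base_apply] using hP.lead

end

/-! ### Perturbed glued curves as a smooth family near the two given curves -/

noncomputable section

open MvPolynomial

/-- The parameters of deformations of a pair of curves: a gluing parameter and a perturbation of the
coefficients of both curves. -/
abbrev GlueParam (D : ℕ) : Type := ℝ × (Fin 2 → Fin (D + 1) → Fin 5 → ℝ)

/-- The exponents of the monomials of a binary form in the two affine charts. -/
def chartExponent (D : ℕ) (i : Fin 2) (k : Fin (D + 1)) : ℕ := if i = 0 then D - k else k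

/-- The two branches of a perturbed glued curve, each in its own affine chart. -/
def glueFamily (D : ℕ) (G : Fin 2 → Fin 5 → MvPolynomial (Fin 2) ℝ) (i : Fin 2)
    (x : GlueParam D × ℝ) : Fin 5 → ℝ :=
  coneMul (fun j => eval ![1, x.2] (G i j)) (fun j => eval ![x.1.1 * x.2, 1] (G (1 - i) j)) +
    ∑ k, x.2 ^ chartExponent D i k • x.1.2 i k

section family

variable {D : ℕ} {G : Fin 2 → Fin 5 → MvPolynomial (Fin 2) ℝ} {d : Fin 2 → ℕ}

theorem contDiff_glueFamily (i : Fin 2) : ContDiff ℝ ∞ (glueFamily D G i) := by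
  refine ContDiff.add (ContDiff.coneMul ?_ ?_) ?_
  · exact contDiff_pi.2 fun j => ContDiff.eval_mvPolynomial (fun i => by
      fin_cases i <;> simp <;> fun_prop) _
  · exact contDiff_pi.2 fun j => ContDiff.eval_mvPolynomial (fun i => by
      fin_cases i <;> simp <;> fun_prop) _
  · fun_prop

theorem glueFamily_zero (hG : ∀ i, ConeCurve (d i) (G i)) (i : Fin 2) (u : ℝ) :
    glueFamily D G i (0, u) = fun j => eval ![1, u] (G i j) := by
  simp only [glueFamily, Prod.fst_zero, Prod.snd_zero, zero_mul, (hG (1 - i)).base, coneMul_single,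
    Pi.zero_apply, smul_zero, Finset.sum_const_zero, add_zero]

theorem eval_eq_add_sum {F H : Fin 5 → MvPolynomial (Fin 2) ℝ} (hF : ∀ j, (F j).IsHomogeneous D)
    (hH : ∀ j, (H j).IsHomogeneous D) (z : Fin 2 → ℝ) :
    (fun j => eval z (F j)) = (fun j => eval z (H j)) + ∑ k : Fin (D + 1), (z 0 ^ (k : ℕ) * z 1 ^ (D - k)) •
      fun j => coeff (binaryExponent D k) (F j) - coeff (binaryExponent D k) (H j) := by
  ext j
  simp only [Pi.add_apply, Finset.sum_apply, Pi.smul_apply, smul_eq_mul, eval_eq_sum_binary (hF j),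
    eval_eq_sum_binary (hH j), Finset.sum_range, ← Finset.sum_add_distrib]
  exact Finset.sum_congr rfl fun k _ => by ring

variable {ε : ℝ} {F : Fin 5 → MvPolynomial (Fin 2) ℝ} {δ : Fin (D + 1) → Fin 5 → ℝ}

/-- The parameter that describes the perturbation `δ` of the glued curve. -/
def glueParam (ε : ℝ) (b : ℕ) (δ : Fin (D + 1) → Fin 5 → ℝ) : GlueParam D :=
  (ε, ![δ, fun k => (ε ^ (k : ℕ) / ε ^ b) • δ k])

theorem eval_left_eq_glueFamily (b : ℕ)
    (hF : ∀ z : Fin 2 → ℝ, (fun j => eval z (F j)) = (fun j => eval z (glue ε (G 0) (G 1) j)) +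
      ∑ k : Fin (D + 1), (z 0 ^ (k : ℕ) * z 1 ^ (D - k)) • δ k) (u : ℝ) :
    (fun j => eval ![1, u] (F j)) = glueFamily D G 0 (glueParam ε b δ, u) := by
  rw [hF, eval_glue]
  simp [glueFamily, glueParam, chartExponent]

/-- Substituting [εu : 1] gives Q(ε, εu) = ε^{d 1} Q(1, u). Dividing by this power restores the
second curve, at the price of dividing the coefficient errors by it too. -/
theorem eval_right_eq_glueFamily (hG : ∀ i, ConeCurve (d i) (G i)) (hε : ε ≠ 0)
    (hF : ∀ z : Fin 2 → ℝ, (fun j => eval z (F j)) = (fun j => eval z (glue ε (G 0) (G 1) j)) +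
      ∑ k : Fin (D + 1), (z 0 ^ (k : ℕ) * z 1 ^ (D - k)) • δ k) (u : ℝ) :
    (fun j => eval ![ε * u, 1] (F j)) = ε ^ d 1 • glueFamily D G 1 (glueParam ε (d 1) δ, u) := by
  have hv : (![ε * 1, ε * u] : Fin 2 → ℝ) = ε • ![1, u] := by
    ext i
    fin_cases i <;> simp
  rw [hF, eval_glue]
  simp only [glueFamily, glueParam, chartExponent, Matrix.cons_val_zero, Matrix.cons_val_one, hv,
    (hG 1).eval_smul_vec, smul_add, Finset.smul_sum]
  congr 1
  · rw [coneMul_comm]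
    have := coneMul_smul (ε ^ d 1) 1 (fun j => eval ![1, u] (G 1 j)) fun j => eval ![ε * u, 1] (G 0 j)
    rw [one_smul, mul_one] at this
    exact this
  · refine Finset.sum_congr rfl fun k _ => ?_
    rw [smul_smul, smul_smul]
    congr 1
    simp
    field_simp
    ring

/-- Between the two branches both w and ε/w are small, so both factors are close to the unit. -/
theorem eval_gap_eq (hG : ∀ i, ConeCurve (d i) (G i))
    (hF : ∀ z : Fin 2 → ℝ, (fun j => eval z (F j)) = (fun j => eval z (glue ε (G 0) (G 1) j)) +
      ∑ k : Fin (D + 1), (z 0 ^ (k : ℕ) * z 1 ^ (D - k)) • δ k) {w : ℝ} (hw : w ≠ 0) :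
    (fun j => eval ![w, 1] (F j)) = w ^ d 1 • (coneMul (fun j => eval ![w, 1] (G 0 j))
      (fun j => eval ![ε / w, 1] (G 1 j)) + ∑ k : Fin (D + 1), (w ^ (k : ℕ) / w ^ d 1) • δ k) := by
  have hv : (![ε * 1, w] : Fin 2 → ℝ) = w • ![ε / w, 1] := by
    ext i
    fin_cases i <;> simp
    field_simp
  rw [hF, eval_glue]
  simp only [Matrix.cons_val_zero, Matrix.cons_val_one, hv, (hG 1).eval_smul_vec, smul_add,
    Finset.smul_sum]
  congr 1
  · have := coneMul_smul 1 (w ^ d 1) (fun j => eval ![w, 1] (G 0 j)) fun j => eval ![ε / w, 1] (G 1 j)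
    rw [one_smul, one_mul] at this
    exact this
  · refine Finset.sum_congr rfl fun k _ => ?_
    rw [smul_smul]
    congr 1
    simp
    field_simp

theorem norm_glueParam_lt {b : ℕ} {ρ : ℝ} (hε : 0 < ε) (hε1 : ε ≤ 1) (hερ : ε < ρ)
    (hδ : ∀ k j, |δ k j| < ρ * ε ^ b) : ‖glueParam ε b δ‖ < ρ := by
  have hρ : 0 < ρ := hε.trans hερ
  have hb : 0 < ε ^ b := by positivity
  rw [glueParam, Prod.norm_def, max_lt_iff]
  refine ⟨by simpa [abs_of_pos hε] using hερ, (pi_norm_lt_iff hρ).2 fun i => (pi_norm_lt_iff hρ).2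
    fun k => (pi_norm_lt_iff hρ).2 fun j => ?_⟩
  have h1 := hδ k j
  fin_cases i
  · refine h1.trans_le ?_
    exact mul_le_of_le_one_right hρ.le (pow_le_one₀ hε.le hε1)
  · simp only [Fin.mk_one, Matrix.cons_val_one, Matrix.cons_val_fin_one, Pi.smul_apply, smul_eq_mul,
      Real.norm_eq_abs, abs_mul, abs_div, abs_pow, abs_of_pos hε]
    rw [div_mul_eq_mul_div, div_lt_iff₀ hb]
    exact (mul_le_of_le_one_left (abs_nonneg _) (pow_le_one₀ hε.le hε1)).trans_lt h1

/-- The division by w^b is harmless because |w| ≥ ε and the errors are small relative to ε^b. -/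
theorem norm_gap_sum_lt {b : ℕ} {η w : ℝ} (hη : 0 < η) (hε : 0 < ε) (hw : ε ≤ |w|) (hw1 : |w| ≤ 1)
    (hδ : ∀ k j, |δ k j| < η / (D + 1) * ε ^ b) :
    ‖∑ k : Fin (D + 1), (w ^ (k : ℕ) / w ^ b) • δ k‖ < η := by
  have hb : 0 < ε ^ b := by positivity
  have hterm : ∀ k : Fin (D + 1), ‖(w ^ (k : ℕ) / w ^ b) • δ k‖ < η / (D + 1) := fun k => by
    refine (pi_norm_lt_iff (by positivity)).2 fun j => ?_
    rw [Pi.smul_apply, smul_eq_mul, Real.norm_eq_abs, abs_mul, abs_div, abs_pow, abs_pow,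
      div_mul_eq_mul_div, div_lt_iff₀ (pow_pos (hε.trans_le hw) _)]
    calc |w| ^ (k : ℕ) * |δ k j| ≤ |δ k j| :=
          mul_le_of_le_one_left (abs_nonneg _) (pow_le_one₀ (abs_nonneg _) hw1)
      _ < η / (D + 1) * ε ^ b := hδ k j
      _ ≤ η / (D + 1) * |w| ^ b := by gcongr
  calc ‖∑ k : Fin (D + 1), (w ^ (k : ℕ) / w ^ b) • δ k‖
      ≤ ∑ k : Fin (D + 1), ‖(w ^ (k : ℕ) / w ^ b) • δ k‖ := norm_sum_le _ _
    _ < ∑ _k : Fin (D + 1), η / (D + 1) := Finset.sum_lt_sum_of_nonempty Finset.univ_nonempty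
        fun k _ => hterm k
    _ = η := by
      rw [Finset.sum_const, Finset.card_univ, Fintype.card_fin, nsmul_eq_mul]
      push_cast
      field_simp

end family

theorem Q32.on_smul {x : Q32} {c : ℝ} (hc : c ≠ 0) {v : Fin 5 → ℝ} : x.On (c • v) ↔ x.On v := by
  constructor
  · rintro ⟨a, ha⟩
    exact ⟨a * c, by rw [ha, smul_smul]⟩
  · rintro ⟨a, ha⟩
    exact ⟨a * c⁻¹, by rw [ha, smul_smul, mul_assoc, inv_mul_cancel₀ hc, mul_one]⟩

theorem ConeCurve.exists_on_iff {d : ℕ} {G : Fin 5 → MvPolynomial (Fin 2) ℝ} (h : ConeCurve d G)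
    (Λ : (Fin 5 → ℝ) ≃L[ℝ] (Fin 5 → ℝ)) (x : Q32) :
    (∃ z : Fin 2 → ℝ, z ≠ 0 ∧ x.On (Λ.symm fun j => eval z (G j))) ↔
      x.On (Λ.symm (Pi.single 0 1)) ∨ ∃ u, x.On (Λ.symm fun j => eval ![1, u] (G j)) := by
  constructor
  · rintro ⟨z, hz, hx⟩
    by_cases h0 : z 0 = 0
    · left
      have h1 : z 1 ≠ 0 := fun h1 => hz (by ext i; fin_cases i <;> simp [h0, h1])
      have hv : z = z 1 • ![0, 1] := by
        ext i
        fin_cases i <;> simp [h0]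
      rwa [hv, h.eval_smul_vec, map_smul, Q32.on_smul (pow_ne_zero _ h1), h.base] at hx
    · right
      have hv : z = z 0 • ![1, z 1 / z 0] := by
        ext i
        fin_cases i <;> simp
        field_simp
      rw [hv, h.eval_smul_vec, map_smul, Q32.on_smul (pow_ne_zero _ h0)] at hx
      exact ⟨_, hx⟩
  · rintro (hx | ⟨u, hx⟩)
    · exact ⟨![0, 1], by simp, by rwa [h.base]⟩
    · exact ⟨_, by simp, hx⟩

theorem ConeCurve.tendsto_projDist {d : ℕ} {G : Fin 5 → MvPolynomial (Fin 2) ℝ} (h : ConeCurve d G)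
    (Λ : (Fin 5 → ℝ) ≃L[ℝ] (Fin 5 → ℝ)) :
    Filter.Tendsto (fun u => projDist (Λ.symm (Pi.single 0 1)) (Λ.symm fun j => eval ![1, u] (G j)))
      (Filter.cocompact ℝ) (𝓝 0) := by
  have hne : Λ.symm (Pi.single 0 1) ≠ 0 := by simp
  have hc : Continuous fun w : ℝ => Λ.symm fun j => eval ![w, 1] (G j) :=
    Λ.symm.continuous.comp (continuous_pi fun j => continuous_eval_mvPolynomial
      (continuous_pi fun i => by fin_cases i <;> simp <;> fun_prop) _)
  have h0 : (Λ.symm fun j => eval ![0, 1] (G j)) = Λ.symm (Pi.single 0 1) := by rw [h.base]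
  have h1 : Filter.Tendsto (fun w : ℝ => projDist (Λ.symm (Pi.single 0 1))
      (Λ.symm fun j => eval ![w, 1] (G j))) (𝓝 0) (𝓝 0) := by
    have := ((continuousOn_projDist (Λ.symm (Pi.single 0 1))).continuousAt
      (isOpen_compl_singleton.mem_nhds hne)).tendsto
    rw [projDist_self hne] at this
    exact this.comp (hc.tendsto' 0 _ h0)
  refine ((h1.mono_left nhdsWithin_le_nhds).comp tendsto_inv_cocompact).congr' ?_
  filter_upwards [eventually_ne_zero_cocompact] with u hu
  rw [vec_one_left hu, h.eval_smul_vec, map_smul, projDist_smul _ (pow_ne_zero _ hu)]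
  rfl

end

/-! ### The glued knot -/

noncomputable section

open MvPolynomial

/-- The knot with given embedded forms, transformed by a linear automorphism. -/
theorem exists_knot_of_isEmbedding {D : ℕ} {F : Fin 5 → MvPolynomial (Fin 2) ℝ}
    (hF : ∀ j, (F j).IsHomogeneous D) (hFe : IsEmbedding fun i => map (algebraMap ℝ ℂ) (F i))
    (Λ : (Fin 5 → ℝ) ≃ₗ[ℝ] (Fin 5 → ℝ)) :
    ∃ K : RealRationalKnot D, ∀ z, K.evalReal z = Λ.symm fun j => eval z (F j) := by
  let M := LinearMap.toMatrix' (Λ : (Fin 5 → ℝ) →ₗ[ℝ] (Fin 5 → ℝ))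
  let M' := LinearMap.toMatrix' (Λ.symm : (Fin 5 → ℝ) →ₗ[ℝ] (Fin 5 → ℝ))
  have hMM' : M * M' = 1 := by
    rw [← LinearMap.toMatrix'_comp]
    simp
  refine ⟨RealRationalKnot.ofIsEmbedding (linComp M' F) (isHomogeneous_linComp M' hF) ?_, fun z => ?_⟩
  · rw [map_linComp]
    refine hFe.linComp (M' := M.map (algebraMap ℝ ℂ)) ?_
    rw [← Matrix.map_mul, hMM', Matrix.map_one _ (map_zero _) (map_one _)]
  · exact (eval_linComp M' F z).trans (LinearMap.toMatrix'_mulVec _ _)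

/-- Continuity at w = w' = 0, E = 0, where the product is the unit times itself. -/
theorem exists_gap_bound {G : Fin 2 → Fin 5 → MvPolynomial (Fin 2) ℝ} {d : Fin 2 → ℕ}
    (hG : ∀ i, ConeCurve (d i) (G i)) (Λ : (Fin 5 → ℝ) ≃L[ℝ] (Fin 5 → ℝ)) {W : Set (Fin 5 → ℝ)}
    (hW : IsOpen W) (hpW : Λ.symm (Pi.single 0 1) ∈ W) :
    ∃ η > 0, ∀ (w w' : ℝ) (E : Fin 5 → ℝ), |w| < η → |w'| < η → ‖E‖ < η →
      Λ.symm (coneMul (fun j => eval ![w, 1] (G 0 j)) (fun j => eval ![w', 1] (G 1 j)) + E) ∈ W := by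
  have hc : ∀ i, Continuous fun w : ℝ => fun j => eval ![w, 1] (G i j) := fun i =>
    continuous_pi fun j => continuous_eval_mvPolynomial
      (continuous_pi fun i => by fin_cases i <;> simp <;> fun_prop) _
  have hcont : Continuous fun x : ℝ × ℝ × (Fin 5 → ℝ) =>
      Λ.symm (coneMul (fun j => eval ![x.1, 1] (G 0 j)) (fun j => eval ![x.2.1, 1] (G 1 j)) + x.2.2) :=
    Λ.symm.continuous.comp ((continuous_coneMul.comp (((hc 0).comp continuous_fst).prodMk
      ((hc 1).comp (continuous_fst.comp continuous_snd)))).add (continuous_snd.comp continuous_snd))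
  have h0 := hcont.tendsto 0 |>.eventually (hW.mem_nhds (by
    simpa [(hG 0).base, (hG 1).base, coneMul_single] using hpW))
  obtain ⟨η, hη, h⟩ := Metric.eventually_nhds_iff.1 h0
  refine ⟨η, hη, fun w w' E hw hw' hE => h (y := (w, w', E)) ?_⟩
  rw [dist_zero_right, Prod.norm_def, Prod.norm_def]
  exact max_lt hw (max_lt hw' hE)

/-- Outside a cone that contains the middle part of a curve, the curve consists of two branches. -/
theorem exists_on_eval_iff_branches {D : ℕ} {F : Fin 5 → MvPolynomial (Fin 2) ℝ}
    (hF : ∀ j, (F j).IsHomogeneous D) (Λ : (Fin 5 → ℝ) ≃L[ℝ] (Fin 5 → ℝ)) {ε L c₀ : ℝ} (hε : 0 < ε)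
    (hL : 0 < L) (hc0 : c₀ ≠ 0) {W : Set (Fin 5 → ℝ)} (hWs : ∀ c : ℝ, c ≠ 0 → ∀ x ∈ W, c • x ∈ W)
    {γ : Fin 2 → ℝ → Fin 5 → ℝ} (hleft : ∀ u, (Λ.symm fun j => eval ![1, u] (F j)) = γ 0 u)
    (hright : ∀ u, (Λ.symm fun j => eval ![ε * u, 1] (F j)) = c₀ • γ 1 u)
    (hgap : ∀ w : ℝ, |w| * L < 1 → ε * L < |w| → (Λ.symm fun j => eval ![w, 1] (F j)) ∈ W)
    {x : Q32} (hx : x ∉ coneSet W) :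
    (∃ z : Fin 2 → ℝ, z ≠ 0 ∧ x.On (Λ.symm fun j => eval z (F j))) ↔
      ∃ i, ∃ u ∈ Set.Icc (-L) L, x.On (γ i u) := by
  have hFs : ∀ (c : ℝ) (z : Fin 2 → ℝ), (Λ.symm fun j => eval (c • z) (F j)) =
      c ^ D • Λ.symm fun j => eval z (F j) := fun c z => by
    rw [← map_smul]
    congr 1
    ext j
    simp [(hF j).eval_smul_vec]
  constructor
  · rintro ⟨z, hz, hxz⟩
    -- Three ranges: |t/s| ≤ L is the first branch, |s/t| ≤ εL the second, and everything between
    -- lies in the cone over V.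
    by_cases h0 : |z 1| ≤ L * |z 0|
    · have hz0 : z 0 ≠ 0 := by
        intro hz0
        rw [hz0, abs_zero, mul_zero] at h0
        have hz1 : z 1 = 0 := abs_nonpos_iff.1 h0
        exact hz (by ext i; fin_cases i <;> simp [hz0, hz1])
      have hv : z = z 0 • ![1, z 1 / z 0] := by
        ext i
        fin_cases i <;> simp
        field_simp
      rw [hv, hFs, Q32.on_smul (pow_ne_zero _ hz0), hleft] at hxz
      refine ⟨0, _, abs_le.1 ?_, hxz⟩
      rwa [abs_div, div_le_iff₀ (abs_pos.2 hz0)]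
    · push Not at h0
      have hz1 : z 1 ≠ 0 := by
        intro hz1
        rw [hz1, abs_zero] at h0
        have : 0 ≤ L * |z 0| := by positivity
        linarith
      have hz1' : 0 < |z 1| := abs_pos.2 hz1
      have hv : z = z 1 • ![z 0 / z 1, 1] := by
        ext i
        fin_cases i <;> simp
        field_simp
      rw [hv, hFs, Q32.on_smul (pow_ne_zero _ hz1)] at hxz
      by_cases hw : |z 0 / z 1| ≤ ε * L
      · have hu : (![z 0 / z 1, 1] : Fin 2 → ℝ) = ![ε * (z 0 / z 1 / ε), 1] := by
          congr 1
          field_simp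
        rw [hu, hright, Q32.on_smul hc0] at hxz
        refine ⟨1, _, abs_le.1 ?_, hxz⟩
        rw [abs_div, abs_of_pos hε, div_le_iff₀ hε]
        linarith
      · exfalso
        push Not at hw
        have hmemW := hgap _ (by
          rw [abs_div, div_mul_eq_mul_div, div_lt_one hz1']
          linarith) hw
        obtain ⟨c, hc⟩ := hxz
        refine hx ?_
        change x.1.rep ∈ W
        rw [hc]
        refine hWs c ?_ _ hmemW
        rintro rfl
        rw [zero_smul] at hc
        exact x.1.rep_nonzero hc
  · rintro ⟨i, u, -, hxu⟩
    fin_cases i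
    · refine ⟨![1, u], by simp, ?_⟩
      rw [hleft]
      exact hxu
    · refine ⟨![ε * u, 1], by simp, ?_⟩
      rw [hright, Q32.on_smul hc0]
      exact hxu

theorem exists_knot_isotopicOutside {d : Fin 2 → ℕ} (K : ∀ i, RealRationalKnot (d i))
    (hK : ∀ i, (K i).points ⊆ quadric32) {p : Q32} (hp : ∀ i, p ∈ (K i).pointsInQ32)
    (hp' : ∀ x, x ∈ (K 0).pointsInQ32 → x ∈ (K 1).pointsInQ32 → x = p) {U : Set Q32} (hU : U ∈ 𝓝 p) :
    ∃ K' : RealRationalKnot (d 0 + d 1), K'.points ⊆ quadric32 ∧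
      ∃ V : Set Q32, IsOpen V ∧ p ∈ V ∧ V ⊆ U ∧
        IsotopicOutside V K'.pointsInQ32 ((K 0).pointsInQ32 ∪ (K 1).pointsInQ32) := by
  obtain ⟨Λ₀, G, hΛ, hΛp, hGood, hpts⟩ := exists_goodCurves K hK hp
  let Λ := Λ₀.toContinuousLinearEquiv
  have hG : ∀ i, ConeCurve (d i) (G i) := fun i => (hGood i).toConeCurve
  have hpts' : ∀ i, ∀ x : Q32, x ∈ (K i).pointsInQ32 ↔
      x.On p.1.rep ∨ ∃ u, x.On (Λ.symm fun j => eval ![1, u] (G i j)) := fun i x => by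
    have hps : p.1.rep = Λ.symm (Pi.single 0 1) := by
      rw [ContinuousLinearEquiv.eq_symm_apply]
      exact hΛp
    rw [hpts, hps]
    exact (hG i).exists_on_iff Λ x
  have hform : ∀ v, form32 (Λ.symm v) = nForm v := fun v => by
    rw [← hΛ]
    exact congrArg nForm (Λ.apply_symm_apply v)
  have hps : Λ.symm (Pi.single 0 1) = p.1.rep := by
    rw [ContinuousLinearEquiv.symm_apply_eq]
    exact hΛp.symm
  have hp0 := p.1.rep_nonzero
  have hpq : form32 p.1.rep = 0 := p.2
  have hpmk : Q32.mk p.1.rep hp0 hpq = p := Subtype.ext p.1.mk_rep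
  let D := d 0 + d 1
  let Γ : Fin 2 → GlueParam D × ℝ → Fin 5 → ℝ := fun i x => Λ.symm (glueFamily D G i x)
  have hΓ0 : ∀ i u, Γ i (0, u) = Λ.symm fun j => eval ![1, u] (G i j) := fun i u =>
    congrArg Λ.symm (glueFamily_zero hG i u)
  have hγ0 : ∀ i u, Γ i (0, u) ≠ 0 := fun i u => by
    rw [hΓ0]
    exact (map_ne_zero_iff _ Λ.symm.injective).2 ((hG i).emb.eval_ne_zero (by simp))
  have hγq : ∀ i u, form32 (Γ i (0, u)) = 0 := fun i u => by
    rw [hΓ0, hform, (hG i).nForm_eval]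
  have hpγ : ∀ i u, ∀ c : ℝ, p.1.rep ≠ c • Γ i (0, u) := fun i u c hc => by
    rw [hΓ0, ← map_smul, ← hps, Λ.symm.injective.eq_iff, ← (hG i).base] at hc
    obtain ⟨c', h'⟩ := (hG i).injective_real (by simp) (by simp) hc
    have e0 := congrFun h' 0
    have e1 := congrFun h' 1
    simp at e0 e1
    rw [← e0, zero_mul] at e1
    exact one_ne_zero e1
  have hmem : ∀ i u, Q32.mk _ (hγ0 i u) (hγq i u) ∈ (K i).pointsInQ32 := fun i u => by
    refine (hpts' i _).2 (Or.inr ⟨u, (Q32.on_mk _ _).2 ⟨1, ?_⟩⟩)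
    rw [one_smul, hΓ0]
  have hdisj : ∀ i j, i ≠ j → ∀ u v, ∀ c : ℝ, Γ i (0, u) ≠ c • Γ j (0, v) := by
    intro i j hij u v c hc
    have hj : Q32.mk _ (hγ0 i u) (hγq i u) ∈ (K j).pointsInQ32 := by
      refine (hpts' j _).2 (Or.inr ⟨v, (Q32.on_mk _ _).2 ⟨c, ?_⟩⟩)
      rw [hc, hΓ0]
    have hx : Q32.mk _ (hγ0 i u) (hγq i u) = p := by
      have hi := hmem i u
      fin_cases i <;> fin_cases j
      exacts [absurd rfl hij, hp' _ hi hj, hp' _ hj hi, absurd rfl hij]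
    obtain ⟨a, -, ha⟩ := Q32.exists_mk_rep (hγ0 i u) (hγq i u)
    rw [hx] at ha
    exact hpγ i u a ha
  obtain ⟨h, hh, M, hM, hang⟩ := exists_split_angular hGood
  let e := Λ.trans (splitEquiv h hh)
  have heΛ : ∀ v, e (Λ.symm v) = splitEquiv h hh v := fun v => by
    simp [e]
  have hep : (e p.1.rep).1 = ⟨1 / 2, 0⟩ := by
    rw [← hps, heΛ, splitEquiv_fst]
    simp
  obtain ⟨W, hWo, hWs, hpW, hWU, L₀, hL⟩ := eventually_isotopicOutside e
    (fun x => by rw [← hΛ, nForm_eq_splitEquiv h hh]; rfl) hp0 hpq (by simp [hep]) (by simp [hep])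
    (0 : GlueParam D) Γ (fun i => Λ.symm.contDiff.comp (contDiff_glueFamily i)) hγ0 hγq
    (fun i u v c hc => by
      rw [hΓ0, hΓ0, ← map_smul, Λ.symm.injective.eq_iff] at hc
      obtain ⟨c', h'⟩ := (hG i).injective_real (by simp) (by simp) hc
      have e0 := congrFun h' 0
      have e1 := congrFun h' 1
      simp at e0 e1
      rw [e1, ← e0, one_mul])
    hdisj (fun i => by simpa only [hΓ0, hps] using (hG i).tendsto_projDist Λ) hpγ
    (γ' := fun i u => Λ.symm fun j => eval ![1, u] (pderiv 1 (G i j)))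
    (fun i u => by
      simp only [hΓ0]
      exact Λ.symm.hasFDerivAt.comp_hasDerivAt u
        (hasDerivAt_pi.2 fun j => hasDerivAt_eval_one_left (G i j) u))
    (fun i u c hc => by
      rw [hΓ0, ← map_smul, Λ.symm.injective.eq_iff] at hc
      exact (hG i).immersive_real u c hc)
    hM (fun i u hu => by
      simp only [hΓ0, heΛ]
      exact (hang i u hu).2)
    (fun i u hu => by
      simp only [hΓ0, heΛ]
      exact (hang i u hu).1)
    (U := U) (by rwa [hpmk])
  obtain ⟨η, hη, hηW⟩ := exists_gap_bound hG Λ hWo (by rwa [hps])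
  -- The bound 2/η gives 1/L < η, so in the gap both |w| < 1/L and ε/|w| < 1/L are admissible for
  -- `hηW`.
  set L := max L₀ (max 1 (2 / η)) with hLdef
  have hL1 : 1 ≤ L := (le_max_left _ _).trans (le_max_right _ _)
  have hLη : 1 / L < η := by
    have : 2 / η ≤ L := (le_max_right _ _).trans (le_max_right _ _)
    rw [div_le_iff₀ hη] at this
    rw [div_lt_iff₀ (by linarith)]
    linarith
  obtain ⟨ρ, hρ, hball⟩ := Metric.eventually_nhds_iff.1 (hL L (le_max_left _ _))
  -- Only after V, L and ρ are fixed is ε chosen, and the coefficient error after ε, relative to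
  -- ε^{d 1}. This order keeps both rescaled branches within ρ of the given curves.
  obtain ⟨ε, happ, hε, hε1⟩ := (((eventually_glue_approx (hGood 0) (hGood 1)).filter_mono
    (nhdsGT_le_nhdsNE 0)).and (Ioo_mem_nhdsGT (lt_min one_pos hρ))).exists
  have hε1' : ε < 1 := hε1.trans_le (min_le_left _ _)
  have hερ : ε < ρ := hε1.trans_le (min_le_right _ _)
  have hεb : 0 < ε ^ d 1 := by positivity
  have hη' : 0 < η / ((D : ℝ) + 1) := by positivity
  obtain ⟨F, hF, hFN, hFc, hFe⟩ := happ ((Finset.range (D + 1)).image (binaryExponent D))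
    (η := min ρ (η / (D + 1)) * ε ^ d 1) (mul_pos (lt_min hρ hη') hεb)
  let δ : Fin (D + 1) → Fin 5 → ℝ := fun k j =>
    coeff (binaryExponent D k) (F j) - coeff (binaryExponent D k) (glue ε (G 0) (G 1) j)
  have hδ : ∀ k j, |δ k j| < min ρ (η / (D + 1)) * ε ^ d 1 := fun k j =>
    hFc j _ (Finset.mem_image_of_mem _ (Finset.mem_range.2 k.2))
  have hev : ∀ z : Fin 2 → ℝ, (fun j => eval z (F j)) = (fun j => eval z (glue ε (G 0) (G 1) j)) +
      ∑ k : Fin (D + 1), (z 0 ^ (k : ℕ) * z 1 ^ (D - k)) • δ k := eval_eq_add_sum hF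
    (isHomogeneous_coneMul (hG 0).hom fun i => isHomogeneous_reparam _ ((hG 1).hom i))
  have hFq : ∀ z : Fin 2 → ℝ, form32 (Λ.symm fun j => eval z (F j)) = 0 := fun z => by
    rw [hform, ← eval_nForm, hFN, map_zero]
  let q := glueParam (D := D) ε (d 1) δ
  have hq : dist q 0 < ρ := by
    rw [dist_zero_right]
    exact norm_glueParam_lt hε hε1'.le hερ fun k j =>
      (hδ k j).trans_le (mul_le_mul_of_nonneg_right (min_le_left _ _) hεb.le)
  have hleft : ∀ u, (Λ.symm fun j => eval ![1, u] (F j)) = Γ 0 (q, u) := fun u =>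
    congrArg Λ.symm (eval_left_eq_glueFamily (d 1) hev u)
  have hright : ∀ u, (Λ.symm fun j => eval ![ε * u, 1] (F j)) = ε ^ d 1 • Γ 1 (q, u) := fun u => by
    rw [eval_right_eq_glueFamily hG hε.ne' hev u, map_smul]
  have hbranch : ∀ i u, form32 (Γ i (q, u)) = 0 := by
    refine Fin.forall_fin_two.2 ⟨fun u => by rw [← hleft, hFq], fun u => ?_⟩
    have := hFq ![ε * u, 1]
    rw [hright, form32_smul] at this
    exact (mul_eq_zero.1 this).resolve_left (pow_ne_zero _ hεb.ne')
  have hgap : ∀ w : ℝ, |w| * L < 1 → ε * L < |w| → (Λ.symm fun j => eval ![w, 1] (F j)) ∈ W := by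
    intro w hw1 hw2
    have hw0 : 0 < |w| := (by positivity : 0 < ε * L).trans hw2
    have hw : w ≠ 0 := abs_pos.1 hw0
    rw [eval_gap_eq hG hev hw, map_smul]
    refine hWs _ (pow_ne_zero _ hw) _ (hηW _ _ _ ?_ ?_ ?_)
    · exact ((lt_div_iff₀ (by linarith)).2 hw1).trans hLη
    · rw [abs_div, abs_of_pos hε]
      refine lt_trans ?_ hLη
      rw [div_lt_div_iff₀ hw0 (by linarith)]
      linarith
    · refine norm_gap_sum_lt hη hε ?_ ?_ fun k j =>
        (hδ k j).trans_le (mul_le_mul_of_nonneg_right (min_le_right _ _) hεb.le)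
      · nlinarith
      · nlinarith
  obtain ⟨K', hK'⟩ := exists_knot_of_isEmbedding hF hFe Λ₀
  have hK'' : ∀ z, K'.evalReal z = Λ.symm fun j => eval z (F j) := hK'
  refine ⟨K', ?_, coneSet W, isOpen_coneSet hWs hWo, hpW, hWU, ?_⟩
  · rintro x ⟨z, hz, hne, rfl⟩
    rw [mk_mem_quadric32, hK'', hFq]
  have hset : (K 0).pointsInQ32 ∪ (K 1).pointsInQ32 =
      {x | x.On p.1.rep ∨ ∃ i u, x.On (Γ i (0, u))} := by
    ext x
    rw [Set.mem_union, hpts', hpts', Set.mem_ofPred_eq]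
    simp only [hΓ0, Fin.exists_fin_two]
    exact or_or_distrib_left.symm
  rw [hset]
  refine hball hq (fun i u => ?_) _ fun x hx => ?_
  · exact hbranch i u
  · rw [K'.mem_pointsInQ32]
    simp only [hK'']
    exact exists_on_eval_iff_branches hF Λ hε (one_pos.trans_le hL1) hεb.ne' hWs
      (γ := fun i u => Γ i (q, u)) hleft hright hgap hx

theorem mainTheorem9 (d₁ d₂ : ℕ) (K₁ : RealRationalKnot d₁) (K₂ : RealRationalKnot d₂)
    (h₁ : K₁.points ⊆ quadric32) (h₂ : K₂.points ⊆ quadric32)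
    (p : Q32) (hp : K₁.points ∩ K₂.points = {(p : RP4)}) :
    ∀ U ∈ 𝓝 p, ∃ K : RealRationalKnot (d₁ + d₂), K.points ⊆ quadric32 ∧
      ∃ V : Set Q32, IsOpen V ∧ p ∈ V ∧ V ⊆ U ∧
        IsotopicOutside V K.pointsInQ32 (K₁.pointsInQ32 ∪ K₂.pointsInQ32) := by
  intro U hU
  have hmem : (p : RP4) ∈ K₁.points ∩ K₂.points := by
    rw [hp]
    rfl
  let K : ∀ i : Fin 2, RealRationalKnot (![d₁, d₂] i) := fun i => match i with
    | 0 => K₁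
    | 1 => K₂
  refine exists_knot_isotopicOutside K (fun i => ?_) (p := p) (fun i => ?_) (fun x hx₁ hx₂ => ?_) hU
  · fin_cases i
    exacts [h₁, h₂]
  · fin_cases i
    exacts [hmem.1, hmem.2]
  · have hx : (x : RP4) ∈ K₁.points ∩ K₂.points := ⟨hx₁, hx₂⟩
    rw [hp] at hx
    exact Subtype.ext hx

end
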